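/- Algorithms are (deterministic) programs of the word RAM: registers and memory cells hold words of $w$ bits; arithmetic modulo $2^w$, division, bitwise operations, shifts, comparisons, indirect loads and stores, and tests of branches and loops take one step each. A program has to work for every word length $w$ that is at least a constant (of its choice) times the number of bits of a bound on the input's entries and length; for CNF-SAT, times $\log_2(2^N+M+1)$. $\mathsf{SETH'}$ is the hypothesis that for no $\delta>0$ there is an algorithm that decides satisfiability of CNF formulas (unbounded clause width) with $N$ variables and $M$ clauses in time $\mathcal{O}^*((2-\delta)^N)$, where $\mathcal{O}^*$ hides factors polynomial in $N$ and $M$. A polygonal curve $P$ in $\mathbb{R}^d$ is given by its list of vertices $p_1,\dots,p_n$, $n \ge 1$, and parametrized over $[1,n]$ by linear interpolation. The continuous Fréchet distance of curves $P,Q$ with $n$ and $m$ vertices is $\inf_{\phi,\psi}\max_{t\in[0,1]}\|P(\phi(t))-Q(\psi(t))\|$ over all continuous nondecreasing $\phi$ from $[0,1]$ onto $[1,n]$ and $\psi$ from $[0,1]$ onto $[1,m]$; for the discrete Fréchet distance, $\phi$ and $\psi$ range over all nondecreasing functions from $[0,1]$ onto $\{1,\dots,n\}$ and $\{1,\dots,m\}$.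 The curve $P$ is $c$-packed if for every point $q$ and every radius $r>0$ the total length of $P$ inside the ball of radius $r$ around $q$ is at most $cr$. For an instance $(P,Q)$ let $n$ be the larger number of vertices and $c$ the least number such that $P$ and $Q$ are both $c$-packed. A $1.001$-approximation for a distance $D$ outputs a number $v$ (a quotient of two words) with $D(P,Q)\le v\le 1.001\cdot D(P,Q)$. **Theorem 3.** Assume $\mathsf{SETH'}$. Let $d\ge 2$, let $D$ be the continuous or the discrete Fréchet distance of curves in $\mathbb{R}^d$, and let $\delta>0$. Then no algorithm is a $1.001$-approximation for $D$ with runtime $\mathcal{O}((cn)^{1-\delta})$ on all instances with $1\le c\le n$. Moreover, this holds for any polynomial restriction of $1\le c\le n$: for all constants $\eta>0$ and $\eta\le\gamma\le 1-\eta$, no algorithm is a $1.001$-approximation for $D$ with runtime $\mathcal{O}((cn)^{1-\delta})$ on all instances with $n^{\gamma-\eta}\le c\le n^{\gamma+\eta}$. All this is true even if only curves whose vertices have nonnegative integer coordinates are considered. -/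

import Mathlib

open MeasureTheory Set

/-! ## Model of computation: the word RAM -/

namespace WordRAM

/-- The binary operations of the word RAM on words of `w` bits: arithmetic modulo `2 ^ w`,
unsigned division with remainder, bitwise operations, shifts and comparisons. -/
inductive BinOp
  | add | sub | mul | div | mod | and | or | xor | shl | shr | lt | eq

/-- The result of a binary operation on two words; comparisons return the word `1` or `0`. -/
def BinOp.eval {w : ℕ} : BinOp → BitVec w → BitVec w → BitVec w
  | .add, x, y => x + y
  | .sub, x, y => x - y
  | .mul, x, y => x * y
  | .div, x, y => x / y
  | .mod, x, y => x % y
  | .and, x, y => x &&& y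
  | .or, x, y => x ||| y
  | .xor, x, y => x ^^^ y
  | .shl, x, y => x <<< y.toNat
  | .shr, x, y => x >>> y.toNat
  | .lt, x, y => if x < y then 1 else 0
  | .eq, x, y => if x = y then 1 else 0

/-- A machine with word length `w`: registers, and one memory cell per address of `w` bits. -/
structure State (w : ℕ) where
  reg : ℕ → BitVec w
  mem : BitVec w → BitVec w

/-- Word RAM programs, in structured form. A program does not depend on the word length and
mentions only finitely many registers. -/
inductive Prog
  /-- do nothing -/
  | skip
  /-- `reg r := k` -/
  | const (r k : ℕ)
  /-- `reg r := reg a ∘ reg b` -/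
  | op (o : BinOp) (r a b : ℕ)
  /-- `reg r := mem[reg a]` -/
  | load (r a : ℕ)
  /-- `mem[reg a] := reg r` -/
  | store (a r : ℕ)
  /-- first `p`, then `q` -/
  | seq (p q : Prog)
  /-- if `reg r ≠ 0` then `p` else `q` -/
  | cond (r : ℕ) (p q : Prog)
  /-- while `reg r ≠ 0` do `p` -/
  | loop (r : ℕ) (p : Prog)

/-- `Runs p s t s'`: started in state `s`, the program `p` halts in state `s'` after exactly `t`
steps. Every instruction and every test of a branch or of a loop takes one step. -/
inductive Runs {w : ℕ} : Prog → State w → ℕ → State w → Prop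
  | skip (s : State w) : Runs .skip s 1 s
  | const (r k : ℕ) (s : State w) :
      Runs (.const r k) s 1 { s with reg := Function.update s.reg r (BitVec.ofNat w k) }
  | op (o : BinOp) (r a b : ℕ) (s : State w) :
      Runs (.op o r a b) s 1
        { s with reg := Function.update s.reg r (o.eval (s.reg a) (s.reg b)) }
  | load (r a : ℕ) (s : State w) :
      Runs (.load r a) s 1 { s with reg := Function.update s.reg r (s.mem (s.reg a)) }
  | store (a r : ℕ) (s : State w) :
      Runs (.store a r) s 1 { s with mem := Function.update s.mem (s.reg a) (s.reg r) }
  | seq {p q : Prog} {s s₁ s₂ : State w} {t₁ t₂ : ℕ} :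
      Runs p s t₁ s₁ → Runs q s₁ t₂ s₂ → Runs (.seq p q) s (t₁ + t₂) s₂
  | cond_true {r : ℕ} {p q : Prog} {s s₁ : State w} {t : ℕ} :
      s.reg r ≠ 0 → Runs p s t s₁ → Runs (.cond r p q) s (t + 1) s₁
  | cond_false {r : ℕ} {p q : Prog} {s s₁ : State w} {t : ℕ} :
      s.reg r = 0 → Runs q s t s₁ → Runs (.cond r p q) s (t + 1) s₁
  | loop_stop {r : ℕ} {p : Prog} {s : State w} :
      s.reg r = 0 → Runs (.loop r p) s 1 s
  | loop_step {r : ℕ} {p : Prog} {s s₁ s₂ : State w} {t₁ t₂ : ℕ} :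
      s.reg r ≠ 0 → Runs p s t₁ s₁ → Runs (.loop r p) s₁ t₂ s₂ →
      Runs (.loop r p) s (1 + t₁ + t₂) s₂

/-- The initial state on a given input: the input is in the memory cells `0, 1, 2, …`, all other
cells and all registers are zero. -/
def State.init (w : ℕ) (input : List ℕ) : State w where
  reg := fun _ => 0
  mem := fun a => BitVec.ofNat w (input.getD a.toNat 0)

end WordRAM

/-! ## Satisfiability of formulas in conjunctive normal form -/

/-- A formula in conjunctive normal form with `N` variables and `M` clauses of unbounded width.
Clause `j` is the disjunction of the `x i` for `i ∈ pos j` and of the `¬ x i` for `i ∈ neg j`. -/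
structure CNFFormula where
  N : ℕ
  M : ℕ
  pos : Fin M → Finset (Fin N)
  neg : Fin M → Finset (Fin N)

namespace CNFFormula

def Satisfiable (φ : CNFFormula) : Prop :=
  ∃ a : Fin φ.N → Bool, ∀ j : Fin φ.M,
    (∃ i ∈ φ.pos j, a i = true) ∨ (∃ i ∈ φ.neg j, a i = false)

/-- The formula as an input: `N`, `M`, and then, clause by clause and in each clause variable by
variable, two indicators telling whether `x i` and whether `¬ x i` occurs in the clause. -/
def encode (φ : CNFFormula) : List ℕ :=
  [φ.N, φ.M] ++ (List.finRange φ.M).flatMap fun j =>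
    (List.finRange φ.N).flatMap fun i =>
      [if i ∈ φ.pos j then 1 else 0, if i ∈ φ.neg j then 1 else 0]

end CNFFormula

/-- The hypothesis SETH-prime: for no `δ > 0` is there a word RAM program that decides CNF-SAT
within `(2 - δ) ^ N` steps, up to a factor polynomial in `N` and `M`. Words have at least
`κ * log₂ (2 ^ N + M + 1)` bits, for a constant `κ` of the program's choice, so that memory of
singly exponential size can be addressed. The program accepts by a nonzero register `0`. -/
def SETHprime : Prop :=
  ¬ ∃ δ : ℝ, 0 < δ ∧ δ < 2 ∧ ∃ (p : WordRAM.Prog) (K κ : ℕ),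
    ∀ (φ : CNFFormula) (w : ℕ), (2 ^ φ.N + φ.M + 1) ^ κ ≤ 2 ^ w →
      ∃ (t : ℕ) (s : WordRAM.State w),
        WordRAM.Runs p (WordRAM.State.init w φ.encode) t s ∧
        (t : ℝ) ≤ K * ((φ.N : ℝ) + φ.M + 1) ^ K * (2 - δ) ^ φ.N ∧
        (s.reg 0 ≠ 0 ↔ φ.Satisfiable)

/-! ## Polygonal curves, Fréchet distances, packedness -/

/-- A polygonal curve in `ℝ^d`, given by the list of its vertices. -/
abbrev Curve (d : ℕ) := List (EuclideanSpace ℝ (Fin d))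

namespace Curve

variable {d : ℕ}

/-- The vertex with index `i`, for `i < P.length`. -/
noncomputable def vertex (P : Curve d) (i : ℕ) : EuclideanSpace ℝ (Fin d) := P.getD i 0

/-- The point of the curve at parameter `x ∈ [0, P.length - 1]`, by linear interpolation between
the vertices, which are attained at the integers. -/
noncomputable def point (P : Curve d) (x : ℝ) : EuclideanSpace ℝ (Fin d) :=
  (1 - Int.fract x) • P.vertex ⌊x⌋₊ + Int.fract x • P.vertex (⌊x⌋₊ + 1)

/-- A continuous nondecreasing function from `[0, 1]` onto the parameter interval of a curve with
`n` vertices. -/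
def IsContReparam (n : ℕ) (φ : ℝ → ℝ) : Prop :=
  ContinuousOn φ (Icc 0 1) ∧ MonotoneOn φ (Icc 0 1) ∧ φ '' Icc 0 1 = Icc 0 ((n : ℝ) - 1)

/-- A nondecreasing function from `[0, 1]` onto the set `{0, …, n - 1}` of vertex indices. -/
def IsDiscReparam (n : ℕ) (φ : ℝ → ℕ) : Prop :=
  MonotoneOn φ (Icc 0 1) ∧ φ '' Icc 0 1 = Iio n

/-- The continuous Fréchet distance: the infimum of all `D` such that some continuous traversal
of the two curves has width at most `D`. -/
noncomputable def frechetDist (P Q : Curve d) : ℝ :=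
  sInf {D : ℝ | ∃ φ ψ : ℝ → ℝ, IsContReparam P.length φ ∧ IsContReparam Q.length ψ ∧
    ∀ t ∈ Icc (0 : ℝ) 1, dist (P.point (φ t)) (Q.point (ψ t)) ≤ D}

/-- The discrete Fréchet distance: the infimum of all `D` such that some discrete traversal of
the two curves has width at most `D`. -/
noncomputable def discreteFrechetDist (P Q : Curve d) : ℝ :=
  sInf {D : ℝ | ∃ φ ψ : ℝ → ℕ, IsDiscReparam P.length φ ∧ IsDiscReparam Q.length ψ ∧
    ∀ t ∈ Icc (0 : ℝ) 1, dist (P.vertex (φ t)) (Q.vertex (ψ t)) ≤ D}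

/-- The total length of the curve inside the ball of radius `r` around `q`, summed over the
segments. -/
noncomputable def lengthIn (P : Curve d) (q : EuclideanSpace ℝ (Fin d)) (r : ℝ) : ℝ :=
  ∑ i ∈ Finset.range (P.length - 1), dist (P.vertex i) (P.vertex (i + 1)) *
    volume.real {x : ℝ | x ∈ Icc (0 : ℝ) 1 ∧
      AffineMap.lineMap (P.vertex i) (P.vertex (i + 1)) x ∈ Metric.closedBall q r}

/-- The curve is `c`-packed. -/
def IsPacked (c : ℝ) (P : Curve d) : Prop :=
  ∀ (q : EuclideanSpace ℝ (Fin d)) (r : ℝ), 0 < r → P.lengthIn q r ≤ c * r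

/-- `c` is the packedness of the pair of curves: the least number such that both are
`c`-packed. -/
def IsPackedness (c : ℝ) (P Q : Curve d) : Prop :=
  IsLeast {c : ℝ | P.IsPacked c ∧ Q.IsPacked c} c

end Curve

/-! ## Approximation algorithms -/

/-- A curve with vertices on the integer grid, in the nonnegative orthant, as it is given to an
algorithm. -/
abbrev GridCurve (d : ℕ) := List (Fin d → ℕ)

/-- The curve in Euclidean space that a grid curve describes. -/
noncomputable def GridCurve.toCurve {d : ℕ} (P : GridCurve d) : Curve d :=
  P.map fun v => WithLp.toLp 2 fun i => (v i : ℝ)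

/-- A pair of curves as an input: the two numbers of vertices, then the coordinates of the
vertices of the first and of the second curve. -/
def GridCurve.encodePair {d : ℕ} (P Q : GridCurve d) : List ℕ :=
  [P.length, Q.length] ++ P.flatMap List.ofFn ++ Q.flatMap List.ofFn

/-- There is an `α`-approximation algorithm for the distance `D` of curves in `ℝ^d` that runs in
time `O(T(n, c))` on all pairs of curves with `R n c`, where `n` is the larger number of vertices
and `c` is the packedness of the pair. The algorithm is a word RAM program that gets the two
curves and has to output, as the quotient of the registers `0` and `1`, a number `v` with
`D(P, Q) ≤ v ≤ α * D(P, Q)`. The words have at least `κ` times as many bits as are needed for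
an entry of the input or for its length, for a constant `κ` of the program's choice. -/
def HasApproxAlgorithm (d : ℕ) (D : Curve d → Curve d → ℝ) (α : ℝ)
    (R : ℝ → ℝ → Prop) (T : ℝ → ℝ → ℝ) : Prop :=
  ∃ (p : WordRAM.Prog) (K κ : ℕ),
    ∀ (P Q : GridCurve d), P ≠ [] → Q ≠ [] →
      ∀ (n c : ℝ), n = max P.length Q.length →
        Curve.IsPackedness c P.toCurve Q.toCurve → R n c →
        ∀ w : ℕ, (∀ x ∈ GridCurve.encodePair P Q,
            (x + (GridCurve.encodePair P Q).length) ^ κ ≤ 2 ^ w) →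
          ∃ (t : ℕ) (s : WordRAM.State w),
            WordRAM.Runs p (WordRAM.State.init w (GridCurve.encodePair P Q)) t s ∧
            (t : ℝ) ≤ K * T n c ∧
            s.reg 1 ≠ 0 ∧
            D P.toCurve Q.toCurve ≤ ((s.reg 0).toNat : ℝ) / ((s.reg 1).toNat : ℝ) ∧
            ((s.reg 0).toNat : ℝ) / ((s.reg 1).toNat : ℝ) ≤ α * D P.toCurve Q.toCurve

/-! The proof reduces CNF-SAT to telling Fréchet distance at most `100` from at least `101`; a
`1.001`-approximation does this because `1.001 * 100 < 101`.

Write `ℓ` for `level`, `K = 2 ^ (r ℓ)` for the number of locations and `S = 2 ^ (p ℓ)` for the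
number of vectors per location, with `N ≤ (r + 2 p) ℓ`. The digits of an assignment split into a
location `k`, a middle part `i` and a low part `j`. At location `k` the first curve has, for each
`i`, a gadget with one bit per clause: does the part `(k, i)` of the assignment leave the clause
unsatisfied? The second curve has such gadgets for the parts `j`. The formula is satisfiable iff for
some `k, i, j` no clause has both bits set.

Geometrically, the second curve makes `K + 1` dips into a low region and the first curve only `K`. A
dip of the second curve can be passed either together with a dip of the first curve, which is within
reach of the second curve's dips at locations `k` and `k + 1`, or by running through a gadget of the
first curve in lockstep with a gadget of the second. Lockstep is possible at distance `100` exactly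
when the two vectors have no common set bit. With a compatible pair, the second curve gains one dip
at that location, and from there on dip `k` of the first curve is matched with dip `k + 1` of the
second (`coupled_of_compatible`, `near_frechet_of_compatible`). If every pair conflicts, the states
in which the second curve has not overtaken the first are a barrier in the free space diagram at
every width below `101` (`NotOvertaken.left`, `NotOvertaken.right`, `far_frechet_of_conflicts`): in
a conflicting gadget the traversal gets stuck, and the last dip is never passed. Couplings give
upper bounds and barriers lower bounds for both distances at once.

Only one location at a time is near a small ball, so the packedness `c` is `S` and the length `n` is
`K S`, up to factors polynomial in `M` (`packedness_bounds`). Hence `c n` is about `K S ^ 2`, that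
is `2 ^ N`, and time `(c n) ^ (1 - δ)` is exponentially better than `2 ^ N`. Writing the curves
takes time about `K S`, which is `2 ^ N` to the power `(p + r) / (r + 2 p) < 1`. The exponent of `c`
relative to `n` is about `p / (p + r)`, a rational that `exists_tuning` places inside the prescribed
interval; the summand of `ℓ` that grows with `Nat.size M` leaves room for the factors polynomial in
`M`. A word RAM program performs the construction and ends in exactly the initial state of the
approximation algorithm (`wp_build`), and `not_SETHprime_of_hasApproxAlgorithm` puts everything
together. -/

/-! ## Couplings and barriers for the Fréchet distances -/

/-- A traversal of two lists, composed of pieces in which one list stays at a single element. -/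
inductive Coupled {α β : Type*} (r : α → β → Prop) : List α → List β → Prop
  | left (a : α) (bs : List β) : bs ≠ [] → (∀ b ∈ bs, r a b) → Coupled r [a] bs
  | right (as : List α) (b : β) : as ≠ [] → (∀ a ∈ as, r a b) → Coupled r as [b]
  | append {as as' : List α} {bs bs' : List β} :
      Coupled r as bs → Coupled r as' bs' → Coupled r (as ++ as') (bs ++ bs')

/-- `a` is kept along `bs`, then `b` is kept along `as`. The pair `(a, b)` itself is visited only if
one of the lists is empty, when a single piece must do because pieces are nonempty. -/
theorem Coupled.corner {α β : Type*} {r : α → β → Prop} {a : α} {as : List α} {b : β} {bs : List β}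
    (hab : r a b) (ha : ∀ y ∈ bs, r a y) (hb : ∀ x ∈ as, r x b) :
    Coupled r (a :: as) (bs ++ [b]) := by
  rcases eq_or_ne as [] with rfl | has
  · refine .left a _ (by simp) ?_
    intro y hy
    rcases List.mem_append.1 hy with h | h
    · exact ha y h
    · rw [List.mem_singleton.1 h]; exact hab
  rcases eq_or_ne bs [] with rfl | hbs
  · refine .right _ b (by simp) ?_
    intro x hx
    rcases List.mem_cons.1 hx with h | h
    · rw [h]; exact hab
    · exact hb x h
  exact .append (as := [a]) (.left a bs hbs ha) (.right as b has hb)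

theorem Coupled.map {α β α' β' : Type*} {r : α → β → Prop} {r' : α' → β' → Prop}
    {f : α → α'} {g : β → β'} (hfg : ∀ a b, r a b → r' (f a) (g b)) {as : List α} {bs : List β}
    (h : Coupled r as bs) : Coupled r' (as.map f) (bs.map g) := by
  induction h with
  | left a bs hne h =>
    refine .left (f a) (bs.map g) (by simpa using hne) ?_
    simpa using fun b hb => hfg _ _ (h b hb)
  | right as b hne h =>
    refine .right (as.map f) (g b) (by simpa using hne) ?_
    simpa using fun a ha => hfg _ _ (h a ha)
  | append _ _ ih ih' => rw [List.map_append, List.map_append]; exact .append ih ih'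

/-! ### Step paths and the reparametrizations they induce -/

/-- A sequence of indices that goes from `0` to `n - 1` in `L` steps of size at most one. -/
structure IsStepPath (n L : ℕ) (i : ℕ → ℕ) : Prop where
  zero : i 0 = 0
  last : i L + 1 = n
  step : ∀ t < L, i (t + 1) = i t ∨ i (t + 1) = i t + 1

/-- Between times `L` and `L + 1` the index moves from `n - 1`, the end of the first path, to `n`,
the start of the second; this is the extra step in the length. -/
theorem IsStepPath.append {n n' L L' : ℕ} {i i' : ℕ → ℕ} (h : IsStepPath n L i)
    (h' : IsStepPath n' L' i') :
    IsStepPath (n + n') (L + 1 + L') (fun t => if t ≤ L then i t else n + i' (t - (L + 1))) := by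
  refine ⟨by simp [h.zero], ?_, ?_⟩
  · have := h'.last
    simp only [show ¬ (L + 1 + L' ≤ L) by omega, if_false]
    rw [show L + 1 + L' - (L + 1) = L' by omega]; omega
  · intro t ht
    rcases lt_trichotomy t L with h1 | h1 | h1
    · simp only [show t + 1 ≤ L by omega, show t ≤ L by omega, if_true]; exact h.step t h1
    · subst h1
      have := h.last
      have := h'.zero
      simp; omega
    · simp only [show ¬ (t + 1 ≤ L) by omega, show ¬ (t ≤ L) by omega, if_false]
      have := h'.step (t - (L + 1)) (by omega)
      rw [show t + 1 - (L + 1) = t - (L + 1) + 1 by omega]; omega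

theorem isStepPath_id {n : ℕ} (h : n ≠ 0) : IsStepPath n (n - 1) id :=
  ⟨rfl, by simp; omega, by simp⟩

theorem isStepPath_const (L : ℕ) : IsStepPath 1 L fun _ => 0 := ⟨rfl, rfl, by simp⟩

/-- A common clock for the two lists. At the seam of an `append` both indices advance at once, so
the two paths keep equal length. -/
theorem Coupled.exists_isStepPath {α β : Type*} {r : α → β → Prop} {as : List α} {bs : List β}
    (h : Coupled r as bs) : ∃ (L : ℕ) (i j : ℕ → ℕ), IsStepPath as.length L i ∧
      IsStepPath bs.length L j ∧
      ∀ t ≤ L, ∃ a b, as[i t]? = some a ∧ bs[j t]? = some b ∧ r a b := by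
  induction h with
  | left a bs hne h =>
    have hl : bs.length ≠ 0 := by simpa using hne
    refine ⟨bs.length - 1, fun _ => 0, id, isStepPath_const _, isStepPath_id hl, fun t ht => ?_⟩
    refine ⟨a, bs[t]'(by omega), by simp, by simp, h _ (by simp)⟩
  | right as b hne h =>
    have hl : as.length ≠ 0 := by simpa using hne
    refine ⟨as.length - 1, id, fun _ => 0, isStepPath_id hl, isStepPath_const _, fun t ht => ?_⟩
    refine ⟨as[t]'(by omega), b, by simp, by simp, h _ (by simp)⟩
  | @append as as' bs bs' _ _ ih ih' =>
    obtain ⟨L, i, j, hi, hj, h⟩ := ih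
    obtain ⟨L', i', j', hi', hj', h'⟩ := ih'
    refine ⟨L + 1 + L', _, _, by simpa using hi.append hi', by simpa using hj.append hj', ?_⟩
    intro t ht
    by_cases h1 : t ≤ L
    · obtain ⟨a, b, ha, hb, hab⟩ := h t h1
      refine ⟨a, b, ?_, ?_, hab⟩
      · simp only [h1, if_true]; exact List.getElem?_append_left (List.getElem?_eq_some_iff.1 ha).1 ▸ ha
      · simp only [h1, if_true]; exact List.getElem?_append_left (List.getElem?_eq_some_iff.1 hb).1 ▸ hb
    · obtain ⟨a, b, ha, hb, hab⟩ := h' (t - (L + 1)) (by omega)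
      refine ⟨a, b, ?_, ?_, hab⟩
      · simp only [h1, if_false]; rw [List.getElem?_append_right (by omega)]; simpa using ha
      · simp only [h1, if_false]; rw [List.getElem?_append_right (by omega)]; simpa using hb

theorem IsStepPath.mono {n L : ℕ} {i : ℕ → ℕ} (h : IsStepPath n L i) {s t : ℕ} (hst : s ≤ t)
    (ht : t ≤ L) : i s ≤ i t := by
  induction t, hst using Nat.le_induction with
  | base => exact le_rfl
  | succ t hst ih =>
    have := h.step t (by omega)
    have := ih (by omega)
    omega

theorem IsStepPath.exists_eq {n L : ℕ} {i : ℕ → ℕ} (h : IsStepPath n L i) {m : ℕ} (hm : m < n) :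
    ∃ t ≤ L, i t = m := by
  have hl := h.last
  have key : ∀ t ≤ L, m ≤ i t → ∃ s ≤ L, i s = m := by
    intro t
    induction t with
    | zero => intro _ h0; exact ⟨0, by omega, by have := h.zero; omega⟩
    | succ t ih =>
      intro ht h1
      by_cases h2 : m ≤ i t
      · exact ih (by omega) h2
      · have := h.step t (by omega)
        exact ⟨t + 1, ht, by omega⟩
  exact key L le_rfl (by omega)

/-- The piecewise linear interpolation of a sequence of natural numbers. -/
noncomputable def interp (L : ℕ) (i : ℕ → ℕ) (y : ℝ) : ℝ :=
  ∑ t ∈ Finset.range L, ((i (t + 1) : ℝ) - i t) * max 0 (min 1 (y - t))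

theorem continuous_interp (L : ℕ) (i : ℕ → ℕ) : Continuous (interp L i) := by
  unfold interp; fun_prop

theorem IsStepPath.monotone_interp {n L : ℕ} {i : ℕ → ℕ} (h : IsStepPath n L i) :
    Monotone (interp L i) := by
  intro x y hxy
  refine Finset.sum_le_sum fun t ht => ?_
  have h1 : (i t : ℝ) ≤ i (t + 1) := by
    exact_mod_cast h.mono (Nat.le_succ t) (Finset.mem_range.1 ht)
  have : max 0 (min 1 (x - t)) ≤ max 0 (min 1 (y - t)) := by gcongr
  exact mul_le_mul_of_nonneg_left this (by linarith)

/-- Between `m` and `m + 1` the ramps with index below `m` are saturated and those above `m` vanish;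
the saturated ones telescope to `i m - i 0`. -/
theorem IsStepPath.interp_eq {n L : ℕ} {i : ℕ → ℕ} (h : IsStepPath n L i) {m : ℕ} (hm : m < L)
    {f : ℝ} (h0 : 0 ≤ f) (h1 : f ≤ 1) :
    interp L i (m + f) = i m + ((i (m + 1) : ℝ) - i m) * f := by
  have hsplit : interp L i (m + f) =
      ∑ t ∈ Finset.range m, ((i (t + 1) : ℝ) - i t) + ((i (m + 1) : ℝ) - i m) * f := by
    unfold interp
    rw [← Finset.sum_subset (Finset.range_subset_range.2 (show m + 1 ≤ L by omega)),
      Finset.sum_range_succ]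
    · congr 1
      · refine Finset.sum_congr rfl fun t ht => ?_
        have : (t : ℝ) + 1 ≤ m := by exact_mod_cast Finset.mem_range.1 ht
        rw [min_eq_left (by linarith), max_eq_right (by norm_num), mul_one]
      · rw [show (m : ℝ) + f - m = f by ring, min_eq_right h1, max_eq_right h0]
    · intro t _ ht
      have : (m : ℝ) + 1 ≤ t := by
        have : m + 1 ≤ t := by simpa using ht
        exact_mod_cast this
      have h2 : (m : ℝ) + f - t ≤ 0 := by linarith
      rw [max_eq_left (le_trans (min_le_right _ _) h2), mul_zero]
  rw [hsplit, Finset.sum_range_sub (fun t => (i t : ℝ)), h.zero]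
  simp

theorem interp_zero {L : ℕ} {i : ℕ → ℕ} : interp L i 0 = 0 := by
  refine Finset.sum_eq_zero fun t _ => ?_
  have : (0 : ℝ) - t ≤ 0 := by simp
  rw [max_eq_left (le_trans (min_le_right _ _) this), mul_zero]

theorem IsStepPath.interp_last {n L : ℕ} {i : ℕ → ℕ} (h : IsStepPath n L i) :
    interp L i L = i L := by
  rcases Nat.eq_zero_or_pos L with rfl | hL
  · simp [interp, h.zero]
  · obtain ⟨m, rfl⟩ : ∃ m, L = m + 1 := ⟨L - 1, by omega⟩
    have := h.interp_eq (m := m) (by omega) (f := 1) (by norm_num) le_rfl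
    push_cast at this ⊢
    rw [this]; ring

theorem IsStepPath.isContReparam {n L : ℕ} {i : ℕ → ℕ} (h : IsStepPath n L i) :
    Curve.IsContReparam n fun x => interp L i (x * L) := by
  have hc : Continuous fun x : ℝ => interp L i (x * L) :=
    (continuous_interp L i).comp (by fun_prop)
  have hm : Monotone fun x : ℝ => interp L i (x * L) := by
    intro x y hxy
    exact h.monotone_interp (mul_le_mul_of_nonneg_right hxy (by positivity))
  have e1 : interp L i (1 * L) = (n : ℝ) - 1 := by
    rw [one_mul, h.interp_last, ← h.last]; push_cast; ring
  have e0 : interp L i (0 * L) = 0 := by rw [zero_mul]; exact interp_zero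
  refine ⟨hc.continuousOn, hm.monotoneOn _, subset_antisymm ?_ ?_⟩
  · rintro _ ⟨x, hx, rfl⟩
    exact ⟨e0 ▸ hm hx.1, e1 ▸ hm hx.2⟩
  · have := intermediate_value_Icc (zero_le_one (α := ℝ)) hc.continuousOn
    rwa [e0, e1] at this

theorem IsStepPath.isDiscReparam {n L : ℕ} {i : ℕ → ℕ} (h : IsStepPath n L i) :
    Curve.IsDiscReparam n fun x => i ⌊x * L⌋₊ := by
  have hle : ∀ x ∈ Icc (0 : ℝ) 1, ⌊x * L⌋₊ ≤ L := by
    intro x hx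
    calc ⌊x * L⌋₊ ≤ ⌊(1 : ℝ) * L⌋₊ := Nat.floor_mono (by gcongr; exact hx.2)
      _ = L := by simp
  have hmono : MonotoneOn (fun x : ℝ => i ⌊x * L⌋₊) (Icc 0 1) := by
    intro x hx y hy hxy
    exact h.mono (Nat.floor_mono (by gcongr)) (hle y hy)
  refine ⟨hmono, subset_antisymm ?_ ?_⟩
  · rintro _ ⟨x, hx, rfl⟩
    have := h.mono (hle x hx) le_rfl
    have := h.last
    simp only [mem_Iio]; omega
  · intro m hm
    obtain ⟨t, ht, rfl⟩ := h.exists_eq hm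
    rcases Nat.eq_zero_or_pos L with rfl | hL
    · exact ⟨0, by simp, by simp [show t = 0 by omega]⟩
    · have hL' : (0 : ℝ) < L := by exact_mod_cast hL
      refine ⟨t / L, ⟨by positivity, ?_⟩, ?_⟩
      · rw [div_le_one hL']; exact_mod_cast ht
      · simp only [div_mul_cancel₀ _ hL'.ne', Nat.floor_natCast]

namespace Curve

variable {d : ℕ}

theorem point_natCast (P : Curve d) (m : ℕ) : P.point m = P.vertex m := by
  simp [point]

theorem point_eq_of_mem (P : Curve d) {m : ℕ} {x : ℝ} (h0 : (m : ℝ) ≤ x) (h1 : x ≤ m + 1) :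
    P.point x = AffineMap.lineMap (P.vertex m) (P.vertex (m + 1)) (x - m) := by
  -- At the right endpoint the floor is already `m + 1`, so this case goes through the value at a
  -- vertex.
  rcases h1.eq_or_lt with rfl | h1
  · rw [show (m : ℝ) + 1 = ((m + 1 : ℕ) : ℝ) by push_cast; ring, point_natCast]
    simp
  · have hf : ⌊x⌋₊ = m := (Nat.floor_eq_iff (by have : (0:ℝ) ≤ m := by positivity
                                                linarith)).2 ⟨h0, h1⟩
    have hfr : Int.fract x = x - m := by
      rw [Int.fract_eq_iff]
      exact ⟨by linarith, by linarith, m, by simp⟩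
    rw [point, hf, hfr, AffineMap.lineMap_apply_module]

theorem vertex_eq_of_getElem? {P : Curve d} {i : ℕ} {a : EuclideanSpace ℝ (Fin d)}
    (h : P[i]? = some a) : P.vertex i = a := by
  simp [vertex, List.getD_eq_getElem?_getD, h]

/-- A step either rests at a vertex or runs along one segment at unit speed; in both cases the curve
point is an affine function of `f`, in the first case a constant one. -/
theorem _root_.IsStepPath.point_interp {n L : ℕ} {i : ℕ → ℕ} (h : IsStepPath n L i) (P : Curve d)
    {m : ℕ} (hm : m < L) {f : ℝ} (h0 : 0 ≤ f) (h1 : f ≤ 1) :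
    P.point (interp L i (m + f)) =
      AffineMap.lineMap (P.vertex (i m)) (P.vertex (i (m + 1))) f := by
  rw [h.interp_eq hm h0 h1]
  rcases h.step m hm with h2 | h2
  · rw [h2, sub_self, zero_mul, add_zero, point_natCast, AffineMap.lineMap_same]; rfl
  · rw [h2]
    push_cast
    rw [point_eq_of_mem P (m := i m) (by linarith) (by linarith)]
    congr 1; ring

/-- Convexity of the norm. This is why a coupling of the vertices alone also bounds the continuous
distance. -/
theorem dist_lineMap_le {E : Type*} [SeminormedAddCommGroup E] [NormedSpace ℝ E] {a b a' b' : E}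
    {T f : ℝ} (h0 : 0 ≤ f) (h1 : f ≤ 1) (ha : dist a a' ≤ T) (hb : dist b b' ≤ T) :
    dist (AffineMap.lineMap a b f) (AffineMap.lineMap a' b' f) ≤ T := by
  rw [dist_eq_norm, AffineMap.lineMap_apply_module, AffineMap.lineMap_apply_module]
  rw [dist_eq_norm] at ha hb
  calc ‖(1 - f) • a + f • b - ((1 - f) • a' + f • b')‖
      = ‖(1 - f) • (a - a') + f • (b - b')‖ := by congr; module
    _ ≤ ‖(1 - f) • (a - a')‖ + ‖f • (b - b')‖ := norm_add_le _ _
    _ = (1 - f) * ‖a - a'‖ + f * ‖b - b'‖ := by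
        rw [norm_smul, norm_smul, Real.norm_of_nonneg h0, Real.norm_of_nonneg (by linarith)]
    _ ≤ (1 - f) * T + f * T := by gcongr
    _ = T := by ring

/-- The values over which the infimum in the continuous Fréchet distance is taken. -/
def contWidths (P Q : Curve d) : Set ℝ :=
  {D : ℝ | ∃ φ ψ : ℝ → ℝ, IsContReparam P.length φ ∧ IsContReparam Q.length ψ ∧
    ∀ t ∈ Icc (0 : ℝ) 1, dist (P.point (φ t)) (Q.point (ψ t)) ≤ D}

/-- The values over which the infimum in the discrete Fréchet distance is taken. -/
def discWidths (P Q : Curve d) : Set ℝ :=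
  {D : ℝ | ∃ φ ψ : ℝ → ℕ, IsDiscReparam P.length φ ∧ IsDiscReparam Q.length ψ ∧
    ∀ t ∈ Icc (0 : ℝ) 1, dist (P.vertex (φ t)) (Q.vertex (ψ t)) ≤ D}

theorem mem_widths_of_coupled {P Q : Curve d} {T : ℝ} (h : Coupled (fun a b => dist a b ≤ T) P Q) :
    T ∈ contWidths P Q ∧ T ∈ discWidths P Q := by
  obtain ⟨L, i, j, hi, hj, hd⟩ := h.exists_isStepPath
  have hv : ∀ t ≤ L, dist (P.vertex (i t)) (Q.vertex (j t)) ≤ T := by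
    intro t ht
    obtain ⟨a, b, ha, hb, hab⟩ := hd t ht
    rwa [vertex_eq_of_getElem? ha, vertex_eq_of_getElem? hb]
  constructor
  · refine ⟨_, _, hi.isContReparam, hj.isContReparam, fun x hx => ?_⟩
    have hx0 : 0 ≤ x * L := mul_nonneg hx.1 (by positivity)
    have hxL : x * L ≤ L := mul_le_of_le_one_left (by positivity) hx.2
    rcases hxL.eq_or_lt with he | hlt
    · simp only [he]
      rw [hi.interp_last, hj.interp_last, point_natCast, point_natCast]
      exact hv L le_rfl
    · have hm : ⌊x * L⌋₊ < L := (Nat.floor_lt hx0).2 hlt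
      have h0 := Nat.floor_le hx0
      have h1 := Nat.lt_floor_add_one (x * L)
      have he : x * L = ⌊x * L⌋₊ + (x * L - ⌊x * L⌋₊) := by ring
      rw [he, hi.point_interp P hm (by linarith) (by linarith),
        hj.point_interp Q hm (by linarith) (by linarith)]
      exact dist_lineMap_le (by linarith) (by linarith) (hv _ hm.le) (hv _ hm)
  · refine ⟨_, _, hi.isDiscReparam, hj.isDiscReparam, fun x hx => hv _ ?_⟩
    calc ⌊x * L⌋₊ ≤ ⌊(1 : ℝ) * L⌋₊ := Nat.floor_mono (by gcongr; exact hx.2)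
      _ = L := by simp

theorem coupled_true {α β : Type*} {r : α → β → Prop} {as : List α} {bs : List β} (ha : as ≠ [])
    (hb : bs ≠ []) (h : ∀ a ∈ as, ∀ b ∈ bs, r a b) : Coupled r as bs := by
  obtain ⟨a, as, rfl⟩ := List.exists_cons_of_ne_nil ha
  obtain ⟨bs, b, rfl⟩ : ∃ bs' b, bs = bs' ++ [b] :=
    ⟨bs.dropLast, bs.getLast hb, (List.dropLast_append_getLast hb).symm⟩
  exact .corner (h _ (by simp) _ (by simp)) (fun y hy => h _ (by simp) _ (by simp [hy]))
    (fun x hx => h _ (by simp [hx]) _ (by simp))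

/-- The infimum of the empty set of reals is `0`, so a lower bound on a distance requires that some
traversal exists. -/
theorem widths_nonempty {P Q : Curve d} (hP : P ≠ []) (hQ : Q ≠ []) :
    (contWidths P Q).Nonempty ∧ (discWidths P Q).Nonempty := by
  obtain ⟨B, hB⟩ : ∃ B : ℝ, ∀ a ∈ P, ∀ b ∈ Q, dist a b ≤ B := by
    have hf : (Set.image2 dist {a | a ∈ P} {b | b ∈ Q}).Finite :=
      (List.finite_toSet P).image2 _ (List.finite_toSet Q)
    obtain ⟨B, hB⟩ := hf.bddAbove
    exact ⟨B, fun a ha b hb => hB ⟨a, ha, b, hb, rfl⟩⟩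
  have := mem_widths_of_coupled (coupled_true (r := fun a b => dist a b ≤ B) hP hQ hB)
  exact ⟨⟨B, this.1⟩, ⟨B, this.2⟩⟩

theorem bddBelow_widths (P Q : Curve d) :
    BddBelow (contWidths P Q) ∧ BddBelow (discWidths P Q) := by
  constructor <;> refine ⟨0, ?_⟩
  all_goals
    rintro D ⟨φ, ψ, -, -, h⟩
    exact dist_nonneg.trans (h 0 (by simp))

theorem frechet_le_of_coupled {P Q : Curve d} {T : ℝ}
    (h : Coupled (fun a b => dist a b ≤ T) P Q) :
    frechetDist P Q ≤ T ∧ discreteFrechetDist P Q ≤ T :=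
  ⟨csInf_le (bddBelow_widths P Q).1 (mem_widths_of_coupled h).1,
    csInf_le (bddBelow_widths P Q).2 (mem_widths_of_coupled h).2⟩

/-! ### Lower bounds from barriers in the free space diagram -/

/-- A set of cells of the free space diagram that contains the first cell, not the last one, and
cannot be left through the free part of the boundary of a cell in a monotone way. Cell `(i, j)`
belongs to the segments that start at the vertices with index `i` and `j`. -/
structure IsBarrier (P Q : Curve d) (T : ℝ) (S : ℕ → ℕ → Prop) : Prop where
  start : S 0 0
  left : ∀ i j, i + 2 < P.length → j + 1 < Q.length → S i j →
    (∃ x ∈ Icc (0 : ℝ) 1, dist (P.vertex (i + 1))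
      (AffineMap.lineMap (Q.vertex j) (Q.vertex (j + 1)) x) < T) → S (i + 1) j
  right : ∀ i j, i + 1 < P.length → j + 2 < Q.length → S i j →
    (∃ x ∈ Icc (0 : ℝ) 1, dist (AffineMap.lineMap (P.vertex i) (P.vertex (i + 1)) x)
      (Q.vertex (j + 1)) < T) → S i (j + 1)
  not_last : ∀ i j, i + 2 = P.length → j + 2 = Q.length → ¬ S i j

/-- If the value `a` is attained at a time after `t`, monotonicity squeezes `φ t` to `a`, and `t`
itself serves. -/
theorem exists_eq_max {α : Type*} [LinearOrder α] {φ : ℝ → α} {s : Set α}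
    (hφ : MonotoneOn φ (Icc 0 1)) (hs : φ '' Icc 0 1 = s) {a : α} (ha : a ∈ s) {t : ℝ}
    (ht : t ∈ Icc (0 : ℝ) 1) (hat : a ≤ φ t) :
    ∃ u ∈ Icc (0 : ℝ) 1, u ≤ t ∧ φ u = a := by
  rw [← hs] at ha
  obtain ⟨u, hu, rfl⟩ := ha
  rcases le_total u t with h | h
  · exact ⟨u, hu, h, rfl⟩
  · exact ⟨t, ht, le_rfl, le_antisymm (hφ ht hu h) hat⟩

/-- By induction on `i + j`, every cell that the traversal visits belongs to `S`. The later of the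
times at which the curves stand at their vertices `i` and `j` is a moment of entry into the cell
from a neighbour, through a point that is free because `D < T`. At time `1` the traversal is in the
last cell, a contradiction. -/
theorem IsBarrier.not_mem_contWidths {P Q : Curve d} {T D : ℝ} {S : ℕ → ℕ → Prop}
    (hS : IsBarrier P Q T S) (hP : 2 ≤ P.length) (hQ : 2 ≤ Q.length) (hD : D < T) :
    D ∉ contWidths P Q := by
  rintro ⟨φ, ψ, ⟨-, hφ, hφi⟩, ⟨-, hψ, hψi⟩, h⟩
  have hrange : ∀ (n : ℕ) (m : ℕ), m + 1 ≤ n → (m : ℝ) ∈ Icc (0 : ℝ) ((n : ℝ) - 1) := by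
    intro n m hm
    have : (m : ℝ) + 1 ≤ n := by exact_mod_cast hm
    exact ⟨by positivity, by linarith⟩
  have key : ∀ N i j, i + j = N → i + 2 ≤ P.length → j + 2 ≤ Q.length → ∀ t ∈ Icc (0 : ℝ) 1,
      φ t ∈ Icc (i : ℝ) (i + 1) → ψ t ∈ Icc (j : ℝ) (j + 1) → S i j := by
    intro N
    induction N with
    | zero =>
      intro i j hij _ _ _ _ _ _
      obtain ⟨rfl, rfl⟩ : i = 0 ∧ j = 0 := by omega
      exact hS.start
    | succ N ih =>
      intro i j hij hi hj t ht hφt hψt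
      obtain ⟨u, hu, hut, hφu⟩ := exists_eq_max hφ hφi (hrange _ i (by omega)) ht hφt.1
      obtain ⟨v, hv, hvt, hψv⟩ := exists_eq_max hψ hψi (hrange _ j (by omega)) ht hψt.1
      have crossP : ∀ τ ∈ Icc (0 : ℝ) 1, i ≠ 0 → φ τ = i → ψ τ ∈ Icc (j : ℝ) (j + 1) → S i j := by
        intro τ hτ h0 hφτ hψτ
        obtain ⟨i, rfl⟩ : ∃ i', i = i' + 1 := ⟨i - 1, by omega⟩
        refine hS.left i j (by omega) (by omega) (ih i j (by omega) (by omega) hj τ hτ ?_ hψτ) ?_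
        · rw [hφτ]; push_cast; constructor <;> linarith
        · refine ⟨ψ τ - j, ⟨by linarith [hψτ.1], by linarith [hψτ.2]⟩, ?_⟩
          have := h τ hτ
          rw [hφτ, point_natCast, point_eq_of_mem Q hψτ.1 hψτ.2] at this
          exact this.trans_lt hD
      have crossQ : ∀ τ ∈ Icc (0 : ℝ) 1, j ≠ 0 → ψ τ = j → φ τ ∈ Icc (i : ℝ) (i + 1) → S i j := by
        intro τ hτ h0 hψτ hφτ
        obtain ⟨j, rfl⟩ : ∃ j', j = j' + 1 := ⟨j - 1, by omega⟩
        refine hS.right i j (by omega) (by omega) (ih i j (by omega) hi (by omega) τ hτ hφτ ?_) ?_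
        · rw [hψτ]; push_cast; constructor <;> linarith
        · refine ⟨φ τ - i, ⟨by linarith [hφτ.1], by linarith [hφτ.2]⟩, ?_⟩
          have := h τ hτ
          rw [hψτ, point_natCast, point_eq_of_mem P hφτ.1 hφτ.2] at this
          exact this.trans_lt hD
      -- The later time decides which side of the cell is crossed, unless that coordinate is `0` and
      -- there is no side to cross; then the other curve's time is used.
      rcases le_total u v with huv | huv
      · have h1 : φ v ∈ Icc (i : ℝ) (i + 1) :=
          ⟨hφu ▸ hφ hu hv huv, (hφ hv ht hvt).trans hφt.2⟩
        rcases Nat.eq_zero_or_pos j with rfl | hj0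
        · have hψu : ψ u ∈ Icc ((0 : ℕ) : ℝ) ((0 : ℕ) + 1) := by
            refine ⟨?_, ?_⟩
            · have : ψ u ∈ ψ '' Icc 0 1 := ⟨u, hu, rfl⟩
              rw [hψi] at this; simpa using this.1
            · exact (hψ hu hv huv).trans (by rw [hψv]; simp)
          exact crossP u hu (by omega) hφu hψu
        · exact crossQ v hv (by omega) hψv h1
      · have h1 : ψ u ∈ Icc (j : ℝ) (j + 1) :=
          ⟨hψv ▸ hψ hv hu huv, (hψ hu ht hut).trans hψt.2⟩
        rcases Nat.eq_zero_or_pos i with rfl | hi0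
        · have hφv : φ v ∈ Icc ((0 : ℕ) : ℝ) ((0 : ℕ) + 1) := by
            refine ⟨?_, ?_⟩
            · have : φ v ∈ φ '' Icc 0 1 := ⟨v, hv, rfl⟩
              rw [hφi] at this; simpa using this.1
            · exact (hφ hv hu huv).trans (by rw [hφu]; simp)
          exact crossQ v hv (by omega) hψv hφv
        · exact crossP u hu (by omega) hφu h1
  have last : ∀ (n : ℕ) (χ : ℝ → ℝ), 2 ≤ n → MonotoneOn χ (Icc 0 1) →
      χ '' Icc 0 1 = Icc 0 ((n : ℝ) - 1) → χ 1 ∈ Icc ((n - 2 : ℕ) : ℝ) ((n - 2 : ℕ) + 1) := by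
    intro n χ hn hm hi
    have hn' : (2 : ℝ) ≤ n := by exact_mod_cast hn
    have h1 : (n : ℝ) - 1 ∈ χ '' Icc 0 1 := by rw [hi]; exact ⟨by linarith, le_rfl⟩
    obtain ⟨u, hu, hχu⟩ := h1
    have h2 : χ 1 ∈ χ '' Icc 0 1 := ⟨1, by simp, rfl⟩
    rw [hi] at h2
    have h3 := hm hu (by simp : (1 : ℝ) ∈ Icc (0 : ℝ) 1) hu.2
    rw [Nat.cast_sub hn]
    constructor <;> push_cast <;> linarith [h2.2]
  exact hS.not_last (P.length - 2) (Q.length - 2) (by omega) (by omega)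
    (key _ _ _ rfl (by omega) (by omega) 1 (by simp) (last _ φ hP hφ hφi) (last _ ψ hQ hψ hψi))

/-- A visited pair of vertices is a corner of up to four cells. By induction on the sum of the two
indices all of them belong to `S`: a visited pair is a free point on the sides between these cells.
-/
theorem IsBarrier.not_mem_discWidths {P Q : Curve d} {T D : ℝ} {S : ℕ → ℕ → Prop}
    (hS : IsBarrier P Q T S) (hP : 2 ≤ P.length) (hQ : 2 ≤ Q.length) (hD : D < T) :
    D ∉ discWidths P Q := by
  rintro ⟨φ, ψ, ⟨hφ, hφi⟩, ⟨hψ, hψi⟩, h⟩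
  have crossP : ∀ i j m, i + 2 < P.length → j + 1 < Q.length → (m = j ∨ m = j + 1) →
      dist (P.vertex (i + 1)) (Q.vertex m) < T → S i j → S (i + 1) j := by
    intro i j m hi hj hm hd hs
    refine hS.left i j hi hj hs ?_
    rcases hm with rfl | rfl
    · exact ⟨0, by simp, by simpa using hd⟩
    · exact ⟨1, by simp, by simpa using hd⟩
  have crossQ : ∀ i j m, i + 1 < P.length → j + 2 < Q.length → (m = i ∨ m = i + 1) →
      dist (P.vertex m) (Q.vertex (j + 1)) < T → S i j → S i (j + 1) := by
    intro i j m hi hj hm hd hs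
    refine hS.right i j hi hj hs ?_
    rcases hm with rfl | rfl
    · exact ⟨0, by simp, by simpa using hd⟩
    · exact ⟨1, by simp, by simpa using hd⟩
  have key : ∀ N, ∀ t ∈ Icc (0 : ℝ) 1, φ t + ψ t = N → ∀ a b, (a = φ t ∨ a + 1 = φ t) →
      (b = ψ t ∨ b + 1 = ψ t) → a + 2 ≤ P.length → b + 2 ≤ Q.length → S a b := by
    intro N
    induction N using Nat.strong_induction_on with
    | _ N ih =>
    intro t ht hN a b ha hb haP hbQ
    have hφt : φ t ∈ Iio P.length := hφi ▸ ⟨t, ht, rfl⟩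
    have hψt : ψ t ∈ Iio Q.length := hψi ▸ ⟨t, ht, rfl⟩
    simp only [mem_Iio] at hφt hψt
    by_cases h00 : φ t = 0 ∧ ψ t = 0
    · obtain ⟨rfl, rfl⟩ : a = 0 ∧ b = 0 := by omega
      exact hS.start
    -- The preceding pair: among a time with first index `φ t - 1` and a time with second index `ψ t
    -- - 1`, the later one has both indices within one of those at `t`.
    obtain ⟨s, hs, hsφ, hsψ, hlt⟩ : ∃ s ∈ Icc (0 : ℝ) 1, (φ s = φ t ∨ φ s + 1 = φ t) ∧
        (ψ s = ψ t ∨ ψ s + 1 = ψ t) ∧ φ s + ψ s < φ t + ψ t := by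
      have predφ : φ t ≠ 0 → ∃ u ∈ Icc (0 : ℝ) 1, u ≤ t ∧ φ u + 1 = φ t := by
        intro h0
        obtain ⟨u, hu, hut, h1⟩ := exists_eq_max hφ hφi (a := φ t - 1)
          (by simp only [mem_Iio]; omega) ht (by omega)
        exact ⟨u, hu, hut, by omega⟩
      have predψ : ψ t ≠ 0 → ∃ u ∈ Icc (0 : ℝ) 1, u ≤ t ∧ ψ u + 1 = ψ t := by
        intro h0
        obtain ⟨u, hu, hut, h1⟩ := exists_eq_max hψ hψi (a := ψ t - 1)
          (by simp only [mem_Iio]; omega) ht (by omega)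
        exact ⟨u, hu, hut, by omega⟩
      by_cases h1 : φ t = 0
      · obtain ⟨u, hu, hut, hu1⟩ := predψ (by omega)
        have := hφ hu ht hut
        exact ⟨u, hu, by omega, by omega, by omega⟩
      by_cases h2 : ψ t = 0
      · obtain ⟨u, hu, hut, hu1⟩ := predφ h1
        have := hψ hu ht hut
        exact ⟨u, hu, by omega, by omega, by omega⟩
      obtain ⟨u, hu, hut, hu1⟩ := predφ h1
      obtain ⟨v, hv, hvt, hv1⟩ := predψ h2
      rcases le_total u v with huv | huv
      · have := hφ hu hv huv
        have := hφ hv ht hvt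
        exact ⟨v, hv, by omega, by omega, by omega⟩
      · have := hψ hv hu huv
        have := hψ hu ht hut
        exact ⟨u, hu, by omega, by omega, by omega⟩
    have IH := ih (φ s + ψ s) (by omega) s hs rfl
    have hd : dist (P.vertex (φ t)) (Q.vertex (ψ t)) < T := (h t ht).trans_lt hD
    -- the cell before the crossings that belong to this step
    obtain ⟨a₀, b₀, h₀, ha₀, hb₀, ha₀P, hb₀Q⟩ : ∃ a₀ b₀, S a₀ b₀ ∧ (a₀ = a ∨ a₀ + 1 = a ∧ a = φ t) ∧
        (b₀ = b ∨ b₀ + 1 = b ∧ b = ψ t) ∧ a₀ + 2 ≤ P.length ∧ b₀ + 2 ≤ Q.length := by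
      by_cases h1 : a = φ s ∨ a + 1 = φ s <;> by_cases h2 : b = ψ s ∨ b + 1 = ψ s
      · exact ⟨a, b, IH a b h1 h2 haP hbQ, .inl rfl, .inl rfl, haP, hbQ⟩
      · refine ⟨a, b - 1, IH a (b - 1) h1 (by omega) haP (by omega), .inl rfl, .inr (by omega), haP,
          by omega⟩
      · refine ⟨a - 1, b, IH (a - 1) b (by omega) h2 (by omega) hbQ, .inr (by omega), .inl rfl,
          by omega, hbQ⟩
      · refine ⟨a - 1, b - 1, IH (a - 1) (b - 1) (by omega) (by omega) (by omega) (by omega),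
          .inr (by omega), .inr (by omega), by omega, by omega⟩
    have h₁ : S a b₀ := by
      rcases ha₀ with rfl | ⟨rfl, h1⟩
      · exact h₀
      · exact crossP a₀ b₀ (ψ t) (by omega) (by omega) (by omega) (h1 ▸ hd) h₀
    rcases hb₀ with rfl | ⟨rfl, h1⟩
    · exact h₁
    · exact crossQ a b₀ (φ t) (by omega) (by omega) (by omega) (h1 ▸ hd) h₁
  have last : ∀ (n : ℕ) (χ : ℝ → ℕ), 2 ≤ n → MonotoneOn χ (Icc 0 1) →
      χ '' Icc 0 1 = Iio n → χ 1 = n - 1 := by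
    intro n χ hn hm hi
    have h1 : n - 1 ∈ χ '' Icc 0 1 := by rw [hi]; simp; omega
    obtain ⟨u, hu, hχu⟩ := h1
    have h2 : χ 1 ∈ χ '' Icc 0 1 := ⟨1, by simp, rfl⟩
    rw [hi, mem_Iio] at h2
    have h3 := hm hu (by simp : (1 : ℝ) ∈ Icc (0 : ℝ) 1) hu.2
    omega
  have e1 := last _ φ hP hφ hφi
  have e2 := last _ ψ hQ hψ hψi
  exact hS.not_last (P.length - 2) (Q.length - 2) (by omega) (by omega)
    (key _ 1 (by simp) rfl _ _ (by omega) (by omega) (by omega) (by omega))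

theorem IsBarrier.le_frechet {P Q : Curve d} {T : ℝ} {S : ℕ → ℕ → Prop}
    (hS : IsBarrier P Q T S) (hP : 2 ≤ P.length) (hQ : 2 ≤ Q.length) :
    T ≤ frechetDist P Q ∧ T ≤ discreteFrechetDist P Q := by
  have hP' : P ≠ [] := by rintro rfl; simp at hP
  have hQ' : Q ≠ [] := by rintro rfl; simp at hQ
  have hn := widths_nonempty hP' hQ'
  exact ⟨le_csInf hn.1 fun D hD => not_lt.1 fun h => hS.not_mem_contWidths hP hQ h hD,
    le_csInf hn.2 fun D hD => not_lt.1 fun h => hS.not_mem_discWidths hP hQ h hD⟩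

end Curve

/-! ## Points of the integer grid -/

/-- The point of `ℝ^d` whose first two coordinates are given and whose other ones vanish. -/
noncomputable def gridPoint (d : ℕ) (q : ℕ × ℕ) : EuclideanSpace ℝ (Fin d) :=
  WithLp.toLp 2 fun i => if (i : ℕ) = 0 then (q.1 : ℝ) else if (i : ℕ) = 1 then (q.2 : ℝ) else 0

/-- An inequality suffices for upper bounds on distances and needs no bound on `d`: for `d < 2` some
coordinates are missing. -/
theorem dist_gridPoint_sq_le {d : ℕ} (p q : ℕ × ℕ) :
    dist (gridPoint d p) (gridPoint d q) ^ 2 ≤ ((p.1 : ℝ) - q.1) ^ 2 + ((p.2 : ℝ) - q.2) ^ 2 := by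
  rw [EuclideanSpace.dist_eq, Real.sq_sqrt (Finset.sum_nonneg fun i _ => sq_nonneg _)]
  have h : ∀ i : Fin d, dist ((gridPoint d p).ofLp i) ((gridPoint d q).ofLp i) ^ 2 =
      (if (i : ℕ) = 0 then ((p.1 : ℝ) - q.1) ^ 2 else 0) +
      (if (i : ℕ) = 1 then ((p.2 : ℝ) - q.2) ^ 2 else 0) := by
    intro i
    simp only [gridPoint, Real.dist_eq, sq_abs]
    by_cases h0 : (i : ℕ) = 0
    · simp [h0]
    · by_cases h1 : (i : ℕ) = 1 <;> simp [h0, h1]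
  rw [Finset.sum_congr rfl fun i _ => h i, Finset.sum_add_distrib]
  have key : ∀ (m : ℕ) (c : ℝ), 0 ≤ c → ∑ i : Fin d, (if (i : ℕ) = m then c else 0) ≤ c := by
    intro m c hc
    rw [Finset.sum_ite, Finset.sum_const_zero, add_zero, Finset.sum_const, nsmul_eq_mul]
    have : (Finset.univ.filter fun i : Fin d => (i : ℕ) = m).card ≤ 1 :=
      Finset.card_le_one.2 fun a ha b hb => by
        simp only [Finset.mem_filter, Finset.mem_univ, true_and] at ha hb
        exact Fin.ext (ha.trans hb.symm)
    have : ((Finset.univ.filter fun i : Fin d => (i : ℕ) = m).card : ℝ) ≤ 1 := by exact_mod_cast this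
    nlinarith
  exact add_le_add (key 0 _ (sq_nonneg _)) (key 1 _ (sq_nonneg _))

/-- Two points of the grid have distance at most `100`. -/
def Near (p q : ℕ × ℕ) : Prop :=
  ((p.1 : ℤ) - q.1) * ((p.1 : ℤ) - q.1) + ((p.2 : ℤ) - q.2) * ((p.2 : ℤ) - q.2) ≤ 10000

theorem Near.dist_le {d : ℕ} {p q : ℕ × ℕ} (h : Near p q) :
    dist (gridPoint d p) (gridPoint d q) ≤ 100 := by
  have h1 : (((p.1 : ℤ) - q.1) * ((p.1 : ℤ) - q.1) + ((p.2 : ℤ) - q.2) * ((p.2 : ℤ) - q.2) : ℝ) ≤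
      10000 := by unfold Near at h; exact_mod_cast h
  push_cast at h1
  have h2 := dist_gridPoint_sq_le (d := d) p q
  nlinarith [dist_nonneg (x := gridPoint d p) (y := gridPoint d q)]

/-- A line with a rational unit normal shows that `p` has distance at least `101` from the segment
between `a` and `b`. -/
def Far (p a b : ℕ × ℕ) : Prop :=
  ∃ n₁ n₂ r : ℤ, 0 < r ∧ n₁ * n₁ + n₂ * n₂ = r * r ∧
    101 * r ≤ n₁ * ((a.1 : ℤ) - p.1) + n₂ * ((a.2 : ℤ) - p.2) ∧
    101 * r ≤ n₁ * ((b.1 : ℤ) - p.1) + n₂ * ((b.2 : ℤ) - p.2)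

/-- The component along the unit normal is affine on the segment and at least `101` at both ends;
Cauchy–Schwarz bounds the distance from below by it. Pythagorean triples such as `(5, 12, 13)` keep
every certificate integral. -/
theorem Far.le_dist {d : ℕ} (hd : 2 ≤ d) {p a b : ℕ × ℕ} (h : Far p a b) {x : ℝ}
    (hx : x ∈ Icc (0 : ℝ) 1) :
    101 ≤ dist (gridPoint d p) (AffineMap.lineMap (gridPoint d a) (gridPoint d b) x) := by
  obtain ⟨n₁, n₂, r, hr, hn, ha, hb⟩ := h
  have hr' : (0 : ℝ) < r := by exact_mod_cast hr
  have hn' : (n₁ : ℝ) * n₁ + n₂ * n₂ = r * r := by exact_mod_cast hn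
  have ha' : (101 : ℝ) * r ≤ n₁ * ((a.1 : ℝ) - p.1) + n₂ * ((a.2 : ℝ) - p.2) := by exact_mod_cast ha
  have hb' : (101 : ℝ) * r ≤ n₁ * ((b.1 : ℝ) - p.1) + n₂ * ((b.2 : ℝ) - p.2) := by exact_mod_cast hb
  obtain ⟨d, rfl⟩ : ∃ e, d = e + 2 := ⟨d - 2, by omega⟩
  rw [dist_comm, EuclideanSpace.dist_eq]
  refine Real.le_sqrt_of_sq_le ?_
  rw [Fin.sum_univ_succ, Fin.sum_univ_succ]
  have hrest : 0 ≤ ∑ i : Fin d, dist ((AffineMap.lineMap (gridPoint (d + 2) a)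
      (gridPoint (d + 2) b) x).ofLp i.succ.succ) ((gridPoint (d + 2) p).ofLp i.succ.succ) ^ 2 :=
    Finset.sum_nonneg fun i _ => sq_nonneg _
  have e0 : dist ((AffineMap.lineMap (gridPoint (d + 2) a)
      (gridPoint (d + 2) b) x).ofLp 0) ((gridPoint (d + 2) p).ofLp 0) ^ 2 =
      ((1 - x) * (a.1 - p.1) + x * (b.1 - p.1)) ^ 2 := by
    rw [AffineMap.lineMap_apply_module, Real.dist_eq, sq_abs]
    simp [gridPoint]; ring
  have e1 : dist ((AffineMap.lineMap (gridPoint (d + 2) a)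
      (gridPoint (d + 2) b) x).ofLp (Fin.succ 0)) ((gridPoint (d + 2) p).ofLp (Fin.succ 0)) ^ 2 =
      ((1 - x) * (a.2 - p.2) + x * (b.2 - p.2)) ^ 2 := by
    rw [AffineMap.lineMap_apply_module, Real.dist_eq, sq_abs]
    simp [gridPoint]; ring
  rw [e0, e1]
  set u := (1 - x) * ((a.1 : ℝ) - p.1) + x * (b.1 - p.1) with hu
  set v := (1 - x) * ((a.2 : ℝ) - p.2) + x * (b.2 - p.2) with hv
  have huv : 101 * r ≤ n₁ * u + n₂ * v := by
    have := mul_le_mul_of_nonneg_left ha' (show 0 ≤ 1 - x by linarith [hx.2])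
    have := mul_le_mul_of_nonneg_left hb' hx.1
    have e : n₁ * u + n₂ * v = (1 - x) * (n₁ * ((a.1 : ℝ) - p.1) + n₂ * ((a.2 : ℝ) - p.2)) +
        x * (n₁ * ((b.1 : ℝ) - p.1) + n₂ * ((b.2 : ℝ) - p.2)) := by rw [hu, hv]; ring
    rw [e]; linarith
  have hcs : (n₁ * u + n₂ * v) ^ 2 ≤ (r * r) * (u ^ 2 + v ^ 2) := by
    rw [← hn']; linarith [sq_nonneg (n₁ * v - n₂ * u)]
  have hsq : (101 * (r : ℝ)) ^ 2 ≤ (n₁ * u + n₂ * v) ^ 2 := by gcongr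
  have : (101 : ℝ) ^ 2 ≤ u ^ 2 + v ^ 2 := by
    have h0 : (r : ℝ) * r * 101 ^ 2 ≤ r * r * (u ^ 2 + v ^ 2) := by
      have := hsq.trans hcs
      linarith
    exact le_of_mul_le_mul_left h0 (by positivity)
  linarith

/-! ## The curves of the reduction, symbolically -/

/-- The vertices of the first curve: at location `k` there is, for each vector `i`, a vertex
`base`, a vertex `enter`, four vertices for each coordinate `c`, and a vertex `leave`; then follows
a dip `top, half, dip, half', top'`. -/
inductive PSym
  | base (k i : ℕ) | enter (k i : ℕ)
  | right (k i c : ℕ) | mid (k i c : ℕ) | left (k i c : ℕ) | mid' (k i c : ℕ)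
  | leave (k i : ℕ)
  | top (k : ℕ) | half (k : ℕ) | dip (k : ℕ) | half' (k : ℕ) | top' (k : ℕ)

/-- The vertices of the second curve: at location `k` there is a dip that descends from `top` via
`half` to `first`, visits for each vector `j` a vertex `sep` and four vertices for each
coordinate `c`, and ascends from `last`. -/
inductive QSym
  | top (k : ℕ) | half (k : ℕ) | first (k : ℕ)
  | sep (k j : ℕ)
  | right (k j c : ℕ) | mid (k j c : ℕ) | left (k j c : ℕ) | mid' (k j c : ℕ)
  | last (k : ℕ) | half' (k : ℕ) | top' (k : ℕ)

/-- The position of a vertex of the first curve, where `a k i c` is coordinate `c` of vector `i` at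
location `k`. -/
def PSym.pos (a : ℕ → ℕ → ℕ → Bool) : PSym → ℕ × ℕ
  | .base k _ => (140 * k + 30, 135)
  -- From `enter` the vertex `first` of the second curve is within reach, but `last` is not; for
  -- `leave` it is the other way round.
  | .enter k _ => (140 * k + 10, 95)
  -- Against height `13 + 2 * (!b)` of the second curve the gap is `102` if both bits are set and at
  -- most `100` otherwise.
  | .right k i c => (140 * k + 57, 113 + 2 * (a k i c).toNat)
  | .mid k _ _ => (140 * k + 30, 113)
  | .left k _ _ => (140 * k + 3, 113)
  | .mid' k _ _ => (140 * k + 30, 113)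
  | .leave k _ => (140 * k + 50, 95)
  | .top k => (140 * k + 100, 135)
  | .half k => (140 * k + 100, 95)
  -- The bottoms of the second curve at locations `k` and `k + 1` have abscissas from `3` to `57`
  -- and from `143` to `197` relative to `140 * k`, all within `97` of `100`.
  | .dip k => (140 * k + 100, 8)
  | .half' k => (140 * k + 100, 95)
  | .top' k => (140 * k + 100, 135)

/-- The position of a vertex of the second curve, where `b k j c` is coordinate `c` of vector `j`
at location `k`. -/
def QSym.pos (b : ℕ → ℕ → ℕ → Bool) : QSym → ℕ × ℕ
  | .top k => (140 * k + 30, 175)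
  | .half k => (140 * k + 30, 85)
  | .first k => (140 * k + 5, 0)
  | .sep k _ => (140 * k + 30, 5)
  | .right k j c => (140 * k + 57, 13 + 2 * (!b k j c).toNat)
  | .mid k _ _ => (140 * k + 30, 13)
  | .left k _ _ => (140 * k + 3, 15)
  | .mid' k _ _ => (140 * k + 30, 13)
  | .last k => (140 * k + 55, 0)
  | .half' k => (140 * k + 30, 85)
  | .top' k => (140 * k + 30, 175)

section lists

variable (K S M : ℕ)

def pVec (k i : ℕ) : List PSym :=
  [.base k i, .enter k i] ++
    (List.range M).flatMap (fun c => [.right k i c, .mid k i c, .left k i c, .mid' k i c]) ++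
    [.leave k i]

def pBlock (k : ℕ) : List PSym :=
  (List.range S).flatMap (pVec M k) ++ [.top k, .half k, .dip k, .half' k, .top' k]

def pSyms : List PSym := (List.range K).flatMap (pBlock S M)

def qVec (k j : ℕ) : List QSym :=
  [.sep k j] ++
    (List.range M).flatMap (fun c => [.right k j c, .mid k j c, .left k j c, .mid' k j c])

def qBlock (k : ℕ) : List QSym :=
  [.top k, .half k, .first k] ++ (List.range S).flatMap (qVec M k) ++ [.last k, .half' k, .top' k]

/-- The additional block is a dip without vectors. It gives the second curve one dip more than the
first curve has, which is the obstruction that a compatible pair of vectors removes. -/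
def qSyms : List QSym := (List.range K).flatMap (qBlock S M) ++ qBlock 0 M K

/-- Consecutive vertices of the first curve. -/
inductive NextP : PSym → PSym → Prop
  | base (k i) : NextP (.base k i) (.enter k i)
  | enter (k i) : k < K → i < S → NextP (.enter k i) (.right k i 0)
  | right (k i c) : c < M → NextP (.right k i c) (.mid k i c)
  | mid (k i c) : c < M → NextP (.mid k i c) (.left k i c)
  | left (k i c) : c < M → NextP (.left k i c) (.mid' k i c)
  | mid' (k i c) : c + 1 < M → NextP (.mid' k i c) (.right k i (c + 1))
  | mid'_leave (k i c) : c + 1 = M → NextP (.mid' k i c) (.leave k i)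
  | leave (k i) : NextP (.leave k i) (.base k (i + 1))
  | leave_top (k i) : NextP (.leave k i) (.top k)
  | top (k) : NextP (.top k) (.half k)
  | half (k) : NextP (.half k) (.dip k)
  | dip (k) : NextP (.dip k) (.half' k)
  | half' (k) : NextP (.half' k) (.top' k)
  | top' (k) : NextP (.top' k) (.base (k + 1) 0)

/-- Consecutive vertices of the second curve. -/
inductive NextQ : QSym → QSym → Prop
  | top (k) : NextQ (.top k) (.half k)
  | half (k) : NextQ (.half k) (.first k)
  | first (k) : NextQ (.first k) (.sep k 0)
  | first_last (k) : NextQ (.first k) (.last k)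
  | sep (k j) : j < S → NextQ (.sep k j) (.right k j 0)
  | right (k j c) : j < S → c < M → NextQ (.right k j c) (.mid k j c)
  | mid (k j c) : c < M → NextQ (.mid k j c) (.left k j c)
  | left (k j c) : c < M → NextQ (.left k j c) (.mid' k j c)
  | mid' (k j c) : j < S → c + 1 < M → NextQ (.mid' k j c) (.right k j (c + 1))
  | mid'_sep (k j c) : j < S → c + 1 = M → NextQ (.mid' k j c) (.sep k (j + 1))
  | mid'_last (k j c) : j < S → c + 1 = M → NextQ (.mid' k j c) (.last k)
  | last (k) : NextQ (.last k) (.half' k)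
  | half' (k) : NextQ (.half' k) (.top' k)
  | top' (k) : NextQ (.top' k) (.top (k + 1))

end lists

/-! ### Consecutive vertices of the two curves -/

theorem isChain_flatMap_range {α : Type*} {r : α → α → Prop} {f : ℕ → List α} {x y : ℕ → α} {n : ℕ}
    (hf : ∀ k < n, (f k).IsChain r ∧ (f k).head? = some (x k) ∧ (f k).getLast? = some (y k))
    (hr : ∀ k, k + 1 < n → r (y k) (x (k + 1))) :
    ((List.range n).flatMap f).IsChain r ∧
      (0 < n → ((List.range n).flatMap f).head? = some (x 0) ∧
        ((List.range n).flatMap f).getLast? = some (y (n - 1))) := by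
  induction n with
  | zero => simp
  | succ n ih =>
    obtain ⟨h1, h2⟩ := ih (fun k hk => hf k (by omega)) (fun k hk => hr k (by omega))
    obtain ⟨h3, h4, h5⟩ := hf n (by omega)
    rw [List.range_succ, List.flatMap_append, List.flatMap_singleton]
    rcases Nat.eq_zero_or_pos n with rfl | hn
    · simpa using ⟨h3, h4, h5⟩
    · obtain ⟨h6, h7⟩ := h2 hn
      refine ⟨h1.append h3 ?_, fun _ => ⟨by rw [List.head?_append, h6]; rfl, ?_⟩⟩
      · intro u hu w hw
        rw [h7] at hu; rw [h4] at hw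
        cases hu; cases hw
        have := hr (n - 1) (by omega)
        rwa [Nat.sub_add_cancel hn] at this
      · rw [List.getLast?_append, h5]; rfl

theorem pVec_chain {K S M : ℕ} (hM : 0 < M) {k i : ℕ} (hk : k < K) (hi : i < S) :
    (pVec M k i).IsChain (NextP K S M) ∧ (pVec M k i).head? = some (.base k i) ∧
      (pVec M k i).getLast? = some (.leave k i) := by
  obtain ⟨h1, h2⟩ := isChain_flatMap_range (r := NextP K S M) (n := M)
    (f := fun c => [.right k i c, .mid k i c, .left k i c, .mid' k i c])
    (x := fun c => .right k i c) (y := fun c => .mid' k i c)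
    (fun c hc => ⟨by simpa using ⟨.right k i c hc, .mid k i c hc, .left k i c hc⟩, rfl, rfl⟩)
    (fun c hc => .mid' k i c hc)
  obtain ⟨h3, h4⟩ := h2 hM
  refine ⟨?_, by simp [pVec], by rw [pVec, List.getLast?_append]; rfl⟩
  refine List.IsChain.append (List.IsChain.append (by simpa using .base k i) h1 ?_) (by simp) ?_
  · rw [h3]; simpa using .enter k i hk hi
  · rw [List.getLast?_append, h4]; simpa using .mid'_leave k i (M - 1) (by omega)

/-- The barrier argument looks at cells, that is, at pairs of consecutive vertices; once these are
known to be related by `NextP`, positions in the list can be forgotten. -/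
theorem pSyms_chain {K S M : ℕ} (hK : 0 < K) (hS : 0 < S) (hM : 0 < M) :
    (pSyms K S M).IsChain (NextP K S M) ∧ (pSyms K S M).head? = some (.base 0 0) := by
  have h := isChain_flatMap_range (r := NextP K S M) (n := K) (f := pBlock S M)
    (x := fun k => .base k 0) (y := fun k => .top' k) ?_ (fun k _ => .top' k)
  · exact ⟨h.1, (h.2 hK).1⟩
  · intro k hk
    obtain ⟨h1, h2⟩ := isChain_flatMap_range (r := NextP K S M) (n := S) (f := pVec M k)
      (x := fun i => .base k i) (y := fun i => .leave k i) (fun i hi => pVec_chain hM hk hi)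
      (fun i _ => .leave k i)
    obtain ⟨h3, h4⟩ := h2 hS
    refine ⟨h1.append ?_ ?_, ?_, ?_⟩
    · simpa using ⟨.top k, .half k, .dip k, .half' k⟩
    · rw [h4]; simpa using .leave_top k (S - 1)
    · rw [pBlock, List.head?_append, h3]; rfl
    · rw [pBlock, List.getLast?_append]; rfl

theorem qVec_chain {S M : ℕ} (hM : 0 < M) {k j : ℕ} (hj : j < S) :
    (qVec M k j).IsChain (NextQ S M) ∧ (qVec M k j).head? = some (.sep k j) ∧
      (qVec M k j).getLast? = some (.mid' k j (M - 1)) := by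
  obtain ⟨h1, h2⟩ := isChain_flatMap_range (r := NextQ S M) (n := M)
    (f := fun c => [.right k j c, .mid k j c, .left k j c, .mid' k j c])
    (x := fun c => .right k j c) (y := fun c => .mid' k j c)
    (fun c hc => ⟨by simpa using ⟨.right k j c hj hc, .mid k j c hc, .left k j c hc⟩, rfl, rfl⟩)
    (fun c hc => .mid' k j c hj hc)
  obtain ⟨h3, h4⟩ := h2 hM
  refine ⟨?_, by simp [qVec], by rw [qVec, List.getLast?_append, h4]; rfl⟩
  refine List.IsChain.append (by simp) h1 ?_
  rw [h3]; simpa using .sep k j hj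

theorem qBlock_chain {S M : ℕ} (hM : 0 < M) (S' : ℕ) (hS' : S' ≤ S) (k : ℕ) :
    (qBlock S' M k).IsChain (NextQ S M) ∧ (qBlock S' M k).head? = some (.top k) ∧
      (qBlock S' M k).getLast? = some (.top' k) := by
  refine ⟨?_, by simp [qBlock], by rw [qBlock, List.getLast?_append]; rfl⟩
  obtain ⟨h1, h2⟩ := isChain_flatMap_range (r := NextQ S M) (n := S') (f := qVec M k)
    (x := fun j => .sep k j) (y := fun j => .mid' k j (M - 1))
    (fun j hj => qVec_chain hM (by omega)) (fun j hj => .mid'_sep k j _ (by omega) (by omega))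
  have h0 : List.IsChain (NextQ S M) [.top k, .half k, .first k] := by
    simpa using ⟨.top k, .half k⟩
  have h5 : List.IsChain (NextQ S M) [.last k, .half' k, .top' k] := by
    simpa using ⟨.last k, .half' k⟩
  -- The additional dip has no vectors, so `first` is followed by `last` at once.
  rcases Nat.eq_zero_or_pos S' with rfl | hS0
  · simpa [qBlock] using
      ⟨NextQ.top k, NextQ.half k, NextQ.first_last k, NextQ.last k, NextQ.half' k⟩
  obtain ⟨h3, h4⟩ := h2 hS0
  refine List.IsChain.append (List.IsChain.append h0 h1 ?_) h5 ?_
  · rw [h3]; simpa using .first k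
  · rw [List.getLast?_append, h4]; simpa using .mid'_last k (S' - 1) (M - 1) (by omega) (by omega)

theorem qSyms_chain {K S M : ℕ} (hK : 0 < K) (hM : 0 < M) :
    (qSyms K S M).IsChain (NextQ S M) ∧ (qSyms K S M).head? = some (.top 0) := by
  obtain ⟨h1, h2⟩ := isChain_flatMap_range (r := NextQ S M) (n := K) (f := qBlock S M)
    (x := fun k => .top k) (y := fun k => .top' k) (fun k _ => qBlock_chain hM S le_rfl k)
    (fun k _ => .top' k)
  obtain ⟨h3, h4⟩ := h2 hK
  obtain ⟨h5, h6, h7⟩ := qBlock_chain hM 0 (Nat.zero_le S) K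
  refine ⟨h1.append h5 ?_, by rw [qSyms, List.head?_append, h3]; rfl⟩
  rw [h4, h6]
  have := NextQ.top' (S := S) (M := M) (K - 1)
  rw [Nat.sub_add_cancel hK] at this
  simpa using this

/-! ## The barrier of the reduction -/

/-- The number of times the first curve has entered or left a dip. -/
def PSym.phase : PSym → ℕ
  | .base k _ | .enter k _ | .right k _ _ | .mid k _ _ | .left k _ _ | .mid' k _ _ | .leave k _
  | .top k => 2 * k
  | .half k | .dip k => 2 * k + 1
  | .half' k | .top' k => 2 * k + 2

/-- The number of times the second curve has entered or left a dip. -/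
def QSym.phase : QSym → ℕ
  -- The phase of the second curve rises only at the extreme vertices `first` and `top'`, which few
  -- segments of the first curve can reach. The first curve is credited earlier, at `half` and
  -- `half'`.
  | .top k | .half k => 2 * k
  | .first k | .sep k _ | .right k _ _ | .mid k _ _ | .left k _ _ | .mid' k _ _ | .last k
  | .half' k => 2 * k + 1
  | .top' k => 2 * k + 2

/-- The vertex lies at the bottom of the dip at location `k`, before its last vertex. -/
def QSym.InDip (k : ℕ) : QSym → Prop
  | .first k' | .sep k' _ | .right k' _ _ | .mid k' _ _ | .left k' _ _ | .mid' k' _ _ => k' = k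
  | _ => False

/-- Location, vector, and progress inside the vector gadget. -/
def PSym.coord : PSym → Option (ℕ × ℕ × ℕ)
  | .right k i c | .mid k i c => some (k, i, 2 * c + 1)
  | .left k i c | .mid' k i c => some (k, i, 2 * c + 2)
  | _ => none

/-- Location, vector, and progress inside the vector gadget. -/
def QSym.coord : QSym → Option (ℕ × ℕ × ℕ)
  | .sep k j => some (k, j, 1)
  | .right k j c => some (k, j, 2 * c + 1)
  | .mid k j c | .left k j c => some (k, j, 2 * c + 2)
  | .mid' k j c => some (k, j, 2 * c + 3)
  | _ => none

section barrier

variable (M : ℕ) (a b : ℕ → ℕ → ℕ → Bool)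

/-- Both curves are inside vector gadgets that have a conflict, with the second curve ahead. -/
def InGadgets (p : PSym) (q : QSym) : Prop :=
  ∃ k i j m n c, p.coord = some (k, i, m) ∧ q.coord = some (k, j, n) ∧ c < M ∧ a k i c ∧ b k j c ∧
    m ≤ n ∧ (2 * c + 1 ≤ m → m + 2 ≤ n) ∧ n ≤ 2 * M + 1

/-- The states of a traversal in which the second curve has not overtaken the first one. -/
def NotOvertaken (p : PSym) (q : QSym) : Prop :=
  q.phase ≤ p.phase ∨ (∃ k i, (p = .base k i ∨ p = .enter k i) ∧ q.InDip k) ∨ InGadgets M a b p q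

variable {M a b} {K S : ℕ}

theorem NextP.phase_le {p p' : PSym} (h : NextP K S M p p') : p.phase ≤ p'.phase := by
  cases h <;> simp [PSym.phase] <;> omega

theorem toNat_cases (x : Bool) : (x = true ∧ x.toNat = 1 ∧ (!x).toNat = 0) ∨
    (x = false ∧ x.toNat = 0 ∧ (!x).toNat = 1) := by
  cases x <;> simp

/-- With the first curve at `right`, the normal `(-5, -12) / 13` rules out the segments at `left`,
and those leaving `first` are too low; what remains has odd progress. If both bits are set, the
segments meeting `right k j c` stay at height at most `13`, against `115`. -/
theorem cross_right {q q' : QSym} (hq : NextQ S M q q') {k i c : ℕ} (hd : q.InDip k) (hc : c < M)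
    (hfar : ¬ Far (PSym.pos a (.right k i c)) (q.pos b) (q'.pos b)) :
    ∃ j n, q.coord = some (k, j, n) ∧ j < S ∧ n % 2 = 1 ∧ n ≤ 2 * M + 1 ∧
      (a k i c = true → b k j c = true → n ≠ 2 * c + 1) := by
  have hx := toNat_cases (a k i c)
  cases hq with
  | top | half | last | half' | top' => simp [QSym.InDip] at hd
  | first k' =>
    cases hd
    refine absurd ⟨0, -1, 1, by norm_num, by norm_num, ?_, ?_⟩ hfar <;> simp [PSym.pos, QSym.pos] <;>
      omega
  | first_last k' =>
    cases hd
    refine absurd ⟨0, -1, 1, by norm_num, by norm_num, ?_, ?_⟩ hfar <;> simp [PSym.pos, QSym.pos] <;>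
      omega
  | sep k' j hj =>
    cases hd
    refine ⟨j, 1, rfl, hj, by norm_num, by omega, fun h1 h2 h3 => hfar ?_⟩
    obtain rfl : c = 0 := by omega
    refine ⟨0, -1, 1, by norm_num, by norm_num, ?_, ?_⟩ <;> simp [PSym.pos, QSym.pos, h1, h2]
  | right k' j c' hj hc' =>
    cases hd
    refine ⟨j, 2 * c' + 1, rfl, hj, by omega, by omega, fun h1 h2 h3 => hfar ?_⟩
    obtain rfl : c = c' := by omega
    refine ⟨0, -1, 1, by norm_num, by norm_num, ?_, ?_⟩ <;> simp [PSym.pos, QSym.pos, h1, h2]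
  | mid k' j c' hc' =>
    cases hd
    refine absurd ⟨-5, -12, 13, by norm_num, by norm_num, ?_, ?_⟩ hfar <;>
      simp [PSym.pos, QSym.pos] <;> omega
  | left k' j c' hc' =>
    cases hd
    refine absurd ⟨-5, -12, 13, by norm_num, by norm_num, ?_, ?_⟩ hfar <;>
      simp [PSym.pos, QSym.pos] <;> omega
  | mid' k' j c' hj hc' =>
    cases hd
    refine ⟨j, 2 * c' + 3, rfl, hj, by omega, by omega, fun h1 h2 h3 => hfar ?_⟩
    obtain rfl : c = c' + 1 := by omega
    refine ⟨0, -1, 1, by norm_num, by norm_num, ?_, ?_⟩ <;> simp [PSym.pos, QSym.pos, h1, h2]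
  | mid'_sep k' j c' hj hc' =>
    cases hd
    exact ⟨j, 2 * c' + 3, rfl, hj, by omega, by omega, by omega⟩
  | mid'_last k' j c' hj hc' =>
    cases hd
    exact ⟨j, 2 * c' + 3, rfl, hj, by omega, by omega, by omega⟩

theorem QSym.inDip_of_coord {q : QSym} {k j n : ℕ} (h : q.coord = some (k, j, n)) : q.InDip k := by
  cases q <;> simp_all [QSym.coord, QSym.InDip]

/-- The counterpart at `left`: segments with abscissa at least `30` are cut off by the normal `(5,
-12) / 13`, and the segments meeting `left` have even progress. The alternating parity prevents the
first curve from gaining on the second. -/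
theorem cross_left {q q' : QSym} (hq : NextQ S M q q') {k i c j n : ℕ}
    (hd : q.coord = some (k, j, n))
    (hfar : ¬ Far (PSym.pos a (.left k i c)) (q.pos b) (q'.pos b)) : n % 2 = 0 := by
  cases hq with
  | top | half | last | half' | top' | first | first_last => simp [QSym.coord] at hd
  | sep k' j hj =>
    cases hd
    have := toNat_cases (b k j 0)
    refine absurd ⟨5, -12, 13, by norm_num, by norm_num, ?_, ?_⟩ hfar <;>
      simp [PSym.pos, QSym.pos] <;> omega
  | right k' j c' hj hc' =>
    cases hd
    have := toNat_cases (b k j c')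
    refine absurd ⟨5, -12, 13, by norm_num, by norm_num, ?_, ?_⟩ hfar <;>
      simp [PSym.pos, QSym.pos] <;> omega
  | mid k' j c' hc' => cases hd; omega
  | left k' j c' hc' => cases hd; omega
  | mid' k' j c' hj hc' =>
    cases hd
    have := toNat_cases (b k j (c' + 1))
    refine absurd ⟨5, -12, 13, by norm_num, by norm_num, ?_, ?_⟩ hfar <;>
      simp [PSym.pos, QSym.pos] <;> omega
  | mid'_sep k' j c' hj hc' =>
    cases hd
    refine absurd ⟨5, -12, 13, by norm_num, by norm_num, ?_, ?_⟩ hfar <;>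
      simp [PSym.pos, QSym.pos]
  | mid'_last k' j c' hj hc' =>
    cases hd
    refine absurd ⟨5, -12, 13, by norm_num, by norm_num, ?_, ?_⟩ hfar <;>
      simp [PSym.pos, QSym.pos]

/-- When `m` grows by one, parity forces `n` to agree with the new `m` modulo `2`, so the lead
persists. At the conflict `n = 2 * c + 1` is excluded, so the lead becomes at least two, and parity
preserves this as well. Leaving the gadget at `m = 2 * M` would then need `n ≥ 2 * M + 2`. -/
theorem InGadgets.left {p p' : PSym} {q q' : QSym} (hp : NextP K S M p p') (hq : NextQ S M q q')
    (h : InGadgets M a b p q) (hfar : ¬ Far (p'.pos a) (q.pos b) (q'.pos b)) :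
    InGadgets M a b p' q := by
  obtain ⟨k, i, j, m, n, c, hm, hn, hc, ha, hb, h1, h2, h3⟩ := h
  cases hp with
  | base | enter | leave | leave_top | top | half | dip | half' | top' => simp [PSym.coord] at hm
  | right => cases hm; exact ⟨k, i, j, _, n, c, rfl, hn, hc, ha, hb, h1, h2, h3⟩
  | left => cases hm; exact ⟨k, i, j, _, n, c, rfl, hn, hc, ha, hb, h1, h2, h3⟩
  | mid k' i' c' hc' =>
    cases hm
    have := cross_left hq hn hfar
    exact ⟨k, i, j, 2 * c' + 2, n, c, rfl, hn, hc, ha, hb, by omega, by omega, h3⟩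
  | mid' k' i' c' hc' =>
    cases hm
    obtain ⟨j', n', e, -, hodd, -, hne⟩ := cross_right hq (QSym.inDip_of_coord hn) hc' hfar
    rw [hn] at e
    cases e
    refine ⟨k, i, j, 2 * (c' + 1) + 1, n, c, rfl, hn, hc, ha, hb, by omega, fun h => ?_, h3⟩
    rcases eq_or_ne c (c' + 1) with rfl | hcc
    · have := hne ha hb; omega
    · omega
  | mid'_leave k' i' c' hc' => cases hm; omega

/-- Progress of the second curve only increases its lead. It could leave its gadget only through the
next `sep` or through `last`, at heights `5` and `0`, out of reach of the gadget of the first curve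
at height at least `113`. -/
theorem InGadgets.right {p p' : PSym} {q q' : QSym} (hp : NextP K S M p p') (hq : NextQ S M q q')
    (h : InGadgets M a b p q) (hfar : ¬ Far (q'.pos b) (p.pos a) (p'.pos a)) :
    InGadgets M a b p q' := by
  obtain ⟨k, i, j, m, n, c, hm, hn, hc, ha, hb, h1, h2, h3⟩ := h
  have bottom : n = 2 * M + 1 → q'.pos b = (140 * k + 30, 5) ∨ q'.pos b = (140 * k + 55, 0) →
      False := by
    intro hn' hpos
    refine hfar ⟨0, 1, 1, by norm_num, by norm_num, ?_, ?_⟩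
    · cases p <;> simp [PSym.coord] at hm <;> rcases hpos with e | e <;> rw [e] <;>
        simp [PSym.pos] <;> omega
    · cases hp with
      | base | enter | leave | leave_top | top | half | dip | half' | top' => simp [PSym.coord] at hm
      -- Here `m = 2 * M`, and the lead of two contradicts `n ≤ 2 * M + 1`.
      | mid'_leave k' i' c' hc' => cases hm; omega
      | right | left | mid | mid' => rcases hpos with e | e <;> rw [e] <;> simp [PSym.pos] <;> omega
  cases hq with
  | top | half | last | half' | top' | first | first_last => simp [QSym.coord] at hn
  | sep k' j' hj =>
    cases hn; exact ⟨k, i, j, m, _, c, hm, rfl, hc, ha, hb, h1, h2, h3⟩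
  | right k' j' c' hj hc' =>
    cases hn
    exact ⟨k, i, j, m, 2 * c' + 2, c, hm, rfl, hc, ha, hb, by omega, by omega, by omega⟩
  | mid k' j' c' hc' =>
    cases hn; exact ⟨k, i, j, m, _, c, hm, rfl, hc, ha, hb, h1, h2, h3⟩
  | left k' j' c' hc' =>
    cases hn
    exact ⟨k, i, j, m, 2 * c' + 3, c, hm, rfl, hc, ha, hb, by omega, by omega, by omega⟩
  | mid' k' j' c' hj hc' =>
    cases hn
    exact ⟨k, i, j, m, 2 * (c' + 1) + 1, c, hm, rfl, hc, ha, hb, by omega, by omega, by omega⟩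
  | mid'_sep k' j' c' hj hc' => cases hn; exact (bottom (by omega) (.inl rfl)).elim
  | mid'_last k' j' c' hj hc' => cases hn; exact (bottom (by omega) (.inr rfl)).elim

/-- A conflict is needed only at the moment when the first curve enters a gadget while the second is
in its dip. That moment fixes the pair of vectors, and neither curve can leave its gadget
afterwards. -/
theorem NotOvertaken.left (hconf : ∀ k i j, k < K → i < S → j < S → ∃ c < M, a k i c ∧ b k j c)
    (hM : 0 < M) {p p' : PSym} {q q' : QSym} (hp : NextP K S M p p') (hq : NextQ S M q q')
    (h : NotOvertaken M a b p q) (hfar : ¬ Far (p'.pos a) (q.pos b) (q'.pos b)) :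
    NotOvertaken M a b p' q := by
  rcases h with h | ⟨k, i, h, hd⟩ | h
  · exact .inl (h.trans hp.phase_le)
  · right
    rcases h with rfl | rfl
    · cases hp; exact .inl ⟨k, i, .inr rfl, hd⟩
    · right
      cases hp with
      | enter _ _ hk hi =>
        obtain ⟨j, n, hn, hj, hodd, hle, hne⟩ := cross_right hq hd hM hfar
        obtain ⟨c, hc, ha, hb⟩ := hconf k i j hk hi hj
        refine ⟨k, i, j, 1, n, c, rfl, hn, hc, ha, hb, by omega, fun h => ?_, hle⟩
        obtain rfl : c = 0 := by omega
        have := hne ha hb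
        omega
  · exact .inr (.inr (h.left hp hq hfar))

/-- The phase of the second curve rises only at `first` and `top'`. At equal phase, `first` can be
reached only from segments that start at `base` or `enter`, which is the second alternative of the
barrier; `top'` cannot be reached while the first curve is still in its dip. -/
theorem NotOvertaken.right {p p' : PSym} {q q' : QSym} (hp : NextP K S M p p')
    (hq : NextQ S M q q') (h : NotOvertaken M a b p q)
    (hfar : ¬ Far (q'.pos b) (p.pos a) (p'.pos a)) : NotOvertaken M a b p q' := by
  rcases h with h | ⟨k, i, h, hd⟩ | h
  · by_cases h' : q'.phase ≤ p.phase
    · exact .inl h'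
    right
    cases hq with
    | top | first | first_last | sep | right | mid | left | mid' | mid'_sep | mid'_last | last =>
      exact absurd h h'
    | top' k => simp [QSym.phase] at h h'; omega
    | half k =>
      simp only [QSym.phase] at h h'
      cases hp with
      | base k' i =>
        simp only [PSym.phase] at h h'
        obtain rfl : k = k' := by omega
        exact .inl ⟨k, i, .inl rfl, rfl⟩
      | enter k' i =>
        simp only [PSym.phase] at h h'
        obtain rfl : k = k' := by omega
        exact .inl ⟨k, i, .inr rfl, rfl⟩
      | half | dip => simp only [PSym.phase] at h h'; omega
      | right | mid | left | mid' =>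
        refine absurd ⟨0, 1, 1, by norm_num, by norm_num, ?_, ?_⟩ hfar <;>
          simp [PSym.phase, PSym.pos, QSym.pos] at h h' ⊢ <;> omega
      | mid'_leave | leave | leave_top | top =>
        refine absurd ⟨5, 12, 13, by norm_num, by norm_num, ?_, ?_⟩ hfar <;>
          simp [PSym.phase, PSym.pos, QSym.pos] at h h' ⊢ <;> omega
      | half' =>
        refine absurd ⟨-5, 12, 13, by norm_num, by norm_num, ?_, ?_⟩ hfar <;>
          simp [PSym.phase, PSym.pos, QSym.pos] at h h' ⊢ <;> omega
      | top' =>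
        refine absurd ⟨0, 1, 1, by norm_num, by norm_num, ?_, ?_⟩ hfar <;>
          simp [PSym.phase, PSym.pos, QSym.pos] at h h' ⊢
    | half' k =>
      simp only [QSym.phase] at h h'
      cases hp with
      | half | dip =>
        refine absurd ⟨3, -4, 5, by norm_num, by norm_num, ?_, ?_⟩ hfar <;>
          simp [PSym.phase, PSym.pos, QSym.pos] at h h' ⊢ <;> omega
      | base | enter | right | mid | left | mid' | mid'_leave | leave | leave_top | top | half'
      | top' => simp only [PSym.phase] at h h'; omega
  · right; left
    refine ⟨k, i, h, ?_⟩
    -- The second curve cannot finish its dip yet: the certificate covers `base`, `enter` and the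
    -- first `right`, hence both segments concerned.
    have last : q'.pos b = (140 * k + 55, 0) → False := by
      intro hpos
      have hx := toNat_cases (a k i 0)
      refine hfar ⟨-5, 12, 13, by norm_num, by norm_num, ?_, ?_⟩ <;> rw [hpos] <;>
        rcases h with rfl | rfl <;> cases hp <;> simp [PSym.pos] <;> omega
    cases hq with
    | top | half | last | half' | top' => simp [QSym.InDip] at hd
    | first | sep | right | mid | left | mid' | mid'_sep => exact hd
    | first_last => cases hd; exact (last rfl).elim
    | mid'_last => cases hd; exact (last rfl).elim
  · exact .inr (.inr (h.right hp hq hfar))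

end barrier

theorem vertex_map {α : Type*} {d : ℕ} {l : List α} {f : α → EuclideanSpace ℝ (Fin d)} {i : ℕ}
    (hi : i < l.length) : Curve.vertex (l.map f) i = f l[i] := by
  simp [Curve.vertex, List.getD_eq_getElem?_getD, hi]

theorem far_frechet_of_conflicts {d K S M : ℕ} (hd : 2 ≤ d) (hK : 0 < K) (hS : 0 < S) (hM : 0 < M)
    {a b : ℕ → ℕ → ℕ → Bool}
    (hconf : ∀ k i j, k < K → i < S → j < S → ∃ c < M, a k i c ∧ b k j c) :
    101 ≤ Curve.frechetDist ((pSyms K S M).map fun p => gridPoint d (p.pos a))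
        ((qSyms K S M).map fun q => gridPoint d (q.pos b)) ∧
      101 ≤ Curve.discreteFrechetDist ((pSyms K S M).map fun p => gridPoint d (p.pos a))
        ((qSyms K S M).map fun q => gridPoint d (q.pos b)) := by
  obtain ⟨hPc, hPh⟩ := pSyms_chain hK hS hM
  obtain ⟨hQc, hQh⟩ := qSyms_chain (S := S) hK hM
  rw [List.isChain_iff_getElem] at hPc hQc
  obtain ⟨K', rfl⟩ : ∃ K', K = K' + 1 := ⟨K - 1, by omega⟩
  obtain ⟨ps, hps⟩ : ∃ ps, pSyms (K' + 1) S M = ps ++ [.half' K', .top' K'] := by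
    simp only [pSyms, List.range_succ, List.flatMap_append, List.flatMap_singleton]
    exact ⟨(List.range K').flatMap (pBlock S M) ++
      ((List.range S).flatMap (pVec M K') ++ [.top K', .half K', .dip K']), by simp [pBlock]⟩
  obtain ⟨qs, hqs⟩ : ∃ qs, qSyms (K' + 1) S M = qs ++ [.half' (K' + 1), .top' (K' + 1)] := by
    exact ⟨(List.range (K' + 1)).flatMap (qBlock S M) ++
      [.top (K' + 1), .half (K' + 1), .first (K' + 1), .last (K' + 1)], by simp [qSyms, qBlock]⟩
  have hPl : (pSyms (K' + 1) S M).length = ps.length + 2 := by rw [hps]; simp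
  have hQl : (qSyms (K' + 1) S M).length = qs.length + 2 := by rw [hqs]; simp
  refine Curve.IsBarrier.le_frechet (S := fun i j => ∀ p ∈ (pSyms (K' + 1) S M)[i]?,
    ∀ q ∈ (qSyms (K' + 1) S M)[j]?, NotOvertaken M a b p q) ⟨?_, ?_, ?_, ?_⟩ (by simp [hPl])
    (by simp [hQl])
  · intro p hp q hq
    rw [← List.head?_eq_getElem?, hPh] at hp
    rw [← List.head?_eq_getElem?, hQh] at hq
    cases hp; cases hq
    exact .inl le_rfl
  · intro i j hi hj h ⟨x, hx, hlt⟩ p hp q hq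
    rw [List.length_map] at hi hj
    rw [List.getElem?_eq_getElem (by omega)] at hp hq
    cases hp; cases hq
    have h0 := h _ (List.getElem?_eq_getElem (by omega)) _ (List.getElem?_eq_getElem (by omega))
    refine h0.left hconf hM (hPc i (by omega)) (hQc j hj) fun hfar => ?_
    rw [vertex_map (by omega), vertex_map (by omega), vertex_map hj] at hlt
    exact absurd (hfar.le_dist hd hx) (not_le.2 hlt)
  · intro i j hi hj h ⟨x, hx, hlt⟩ p hp q hq
    rw [List.length_map] at hi hj
    rw [List.getElem?_eq_getElem (by omega)] at hp hq
    cases hp; cases hq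
    have h0 := h _ (List.getElem?_eq_getElem (by omega)) _ (List.getElem?_eq_getElem (by omega))
    refine h0.right (hPc i hi) (hQc j (by omega)) fun hfar => ?_
    rw [vertex_map (by omega), vertex_map (by omega), vertex_map (by omega), dist_comm] at hlt
    exact absurd (hfar.le_dist hd hx) (not_le.2 hlt)
  -- In the last cell the first curve has phase `2 * K`, but the second has phase `2 * K + 1`
  -- because of its additional dip.
  · intro i j hi hj h
    rw [List.length_map] at hi hj
    have := h (.half' K') (by rw [hps, show i = ps.length by omega]; simp) (.half' (K' + 1))
      (by rw [hqs, show j = qs.length by omega]; simp)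
    simp [NotOvertaken, InGadgets, PSym.coord, QSym.InDip, PSym.phase, QSym.phase] at this
    omega

/-! ## The traversal for compatible vectors -/

theorem near_of_le {p q : ℕ × ℕ} (x y : ℕ) (h : x * x + y * y ≤ 10000)
    (h₁ : p.1 ≤ q.1 + x) (h₂ : q.1 ≤ p.1 + x) (h₃ : p.2 ≤ q.2 + y) (h₄ : q.2 ≤ p.2 + y) :
    Near p q := by
  have hx : ((p.1 : ℤ) - q.1) * ((p.1 : ℤ) - q.1) ≤ x * x := by
    have := abs_le_of_sq_le_sq' (a := (p.1 : ℤ) - q.1) (b := x)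
    nlinarith
  have hy : ((p.2 : ℤ) - q.2) * ((p.2 : ℤ) - q.2) ≤ y * y := by nlinarith
  have : (x * x + y * y : ℤ) ≤ 10000 := by exact_mod_cast h
  unfold Near
  linarith

section traversal

variable {K S M : ℕ} {a b : ℕ → ℕ → ℕ → Bool}

/-- Vertices of the two curves with distance at most `100`. -/
def NearSym (a b : ℕ → ℕ → ℕ → Bool) (p : PSym) (q : QSym) : Prop := Near (p.pos a) (q.pos b)

theorem bit_le (x : Bool) : x.toNat ≤ 1 := x.toNat_le

theorem nearSym_top {k i : ℕ} {p : PSym} (hp : p ∈ pVec M k i) :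
    NearSym a b p (.top k) ∧ NearSym a b p (.top' k) := by
  have : NearSym a b p (.top k) := by
    simp only [pVec, List.mem_append, List.mem_cons, List.mem_flatMap, List.not_mem_nil,
      or_false] at hp
    rcases hp with ((rfl | rfl) | ⟨c, -, rfl | rfl | rfl | rfl⟩) | rfl <;>
      refine near_of_le 27 80 (by norm_num) ?_ ?_ ?_ ?_ <;> simp [PSym.pos, QSym.pos] <;>
      have := bit_le (a k i c) <;> omega
  exact ⟨this, this⟩

theorem nearSym_enter {k i j : ℕ} {q : QSym} (hq : q ∈ qVec M k j) :
    NearSym a b (.enter k i) q ∧ NearSym a b (.leave k i) q := by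
  simp only [qVec, List.mem_append, List.mem_cons, List.mem_flatMap, List.not_mem_nil,
    or_false] at hq
  constructor
  all_goals
    rcases hq with rfl | ⟨c, -, rfl | rfl | rfl | rfl⟩
    · refine near_of_le 20 90 (by norm_num) ?_ ?_ ?_ ?_ <;> simp [PSym.pos, QSym.pos]
    all_goals
      have := bit_le (!b k j c)
      refine near_of_le 47 82 (by norm_num) ?_ ?_ ?_ ?_ <;> simp [PSym.pos, QSym.pos] <;> omega

theorem nearSym_dip {k j : ℕ} {q : QSym} (hq : q ∈ qVec M k j) : NearSym a b (.dip k) q := by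
  simp only [qVec, List.mem_append, List.mem_cons, List.mem_flatMap, List.not_mem_nil,
    or_false] at hq
  rcases hq with rfl | ⟨c, -, rfl | rfl | rfl | rfl⟩
  · refine near_of_le 97 8 (by norm_num) ?_ ?_ ?_ ?_ <;> simp [PSym.pos, QSym.pos]
  all_goals
    have := bit_le (!b k j c)
    refine near_of_le 97 8 (by norm_num) ?_ ?_ ?_ ?_ <;> simp [PSym.pos, QSym.pos] <;> omega

theorem nearSym_dip_succ {k j : ℕ} {q : QSym} (hq : q ∈ qVec M (k + 1) j) :
    NearSym a b (.dip k) q := by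
  simp only [qVec, List.mem_append, List.mem_cons, List.mem_flatMap, List.not_mem_nil,
    or_false] at hq
  rcases hq with rfl | ⟨c, -, rfl | rfl | rfl | rfl⟩
  · refine near_of_le 97 8 (by norm_num) ?_ ?_ ?_ ?_ <;> simp [PSym.pos, QSym.pos] <;> omega
  all_goals
    have := bit_le (!b (k + 1) j c)
    refine near_of_le 97 8 (by norm_num) ?_ ?_ ?_ ?_ <;> simp [PSym.pos, QSym.pos] <;> omega

theorem Coupled.append_flatMap {α β : Type*} {r : α → β → Prop} {as : List α} {bs : List β}
    {f : ℕ → List α} {g : ℕ → List β} (h : Coupled r as bs) {n : ℕ}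
    (hfg : ∀ c < n, Coupled r (f c) (g c)) :
    Coupled r (as ++ (List.range n).flatMap f) (bs ++ (List.range n).flatMap g) := by
  induction n with
  | zero => simpa using h
  | succ n ih =>
    simp only [List.range_succ, List.flatMap_append, List.flatMap_singleton, ← List.append_assoc]
    exact .append (ih fun c hc => hfg c (by omega)) (hfg n (by omega))

theorem Coupled.flatMap_append {α β : Type*} {r : α → β → Prop} {as : List α} {bs : List β}
    {f : ℕ → List α} {g : ℕ → List β} (h : Coupled r as bs) {n : ℕ}
    (hfg : ∀ c < n, Coupled r (f c) (g c)) :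
    Coupled r ((List.range n).flatMap f ++ as) ((List.range n).flatMap g ++ bs) := by
  induction n generalizing as bs with
  | zero => simpa using h
  | succ n ih =>
    simp only [List.range_succ, List.flatMap_append, List.flatMap_singleton, List.append_assoc]
    exact ih (.append (hfg n (by omega)) h) fun c hc => hfg c (by omega)

theorem Coupled.pair {α β : Type*} {r : α → β → Prop} {a : α} {b : β} (h : r a b) :
    Coupled r [a] [b] := .left a [b] (by simp) (by simpa using h)

/-- The traversal with the first curve ahead. -/
theorem coupled_block (k : ℕ) : Coupled (NearSym a b) (pBlock S M k) (qBlock S M k) := by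
  have h₁ : Coupled (NearSym a b) ((List.range S).flatMap (pVec M k) ++ [.top k]) [.top k] := by
    refine .right _ _ (by simp) fun p hp => ?_
    simp only [List.mem_append, List.mem_flatMap, List.mem_singleton] at hp
    rcases hp with ⟨i, -, hp⟩ | rfl
    · exact (nearSym_top hp).1
    · refine near_of_le 70 40 (by norm_num) ?_ ?_ ?_ ?_ <;> simp [PSym.pos, QSym.pos]
  have h₂ : Coupled (NearSym a b) [.half k] [.half k] := by
    refine .pair (near_of_le 70 10 (by norm_num) ?_ ?_ ?_ ?_) <;> simp [PSym.pos, QSym.pos]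
  have h₃ : Coupled (NearSym a b) [.dip k]
      (.first k :: ((List.range S).flatMap (qVec M k) ++ [.last k])) := by
    refine .left _ _ (by simp) fun q hq => ?_
    simp only [List.mem_cons, List.mem_append, List.mem_flatMap, List.not_mem_nil, or_false] at hq
    rcases hq with rfl | ⟨j, -, hq⟩ | rfl
    · refine near_of_le 97 8 (by norm_num) ?_ ?_ ?_ ?_ <;> simp [PSym.pos, QSym.pos]
    · exact nearSym_dip hq
    · refine near_of_le 97 8 (by norm_num) ?_ ?_ ?_ ?_ <;> simp [PSym.pos, QSym.pos]
  have h₄ : Coupled (NearSym a b) [.half' k] [.half' k] := by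
    refine .pair (near_of_le 70 10 (by norm_num) ?_ ?_ ?_ ?_) <;> simp [PSym.pos, QSym.pos]
  have h₅ : Coupled (NearSym a b) [.top' k] [.top' k] := by
    refine .pair (near_of_le 70 40 (by norm_num) ?_ ?_ ?_ ?_) <;> simp [PSym.pos, QSym.pos]
  simpa [pBlock, qBlock] using h₁.append (h₂.append (h₃.append (h₄.append h₅)))

/-- The traversal with the second curve ahead. -/
theorem coupled_shifted_block (k S' : ℕ) {ps : List PSym}
    (hps : ∀ p ∈ ps, NearSym a b p (.top' (k + 1))) :
    Coupled (NearSym a b) ([.top k, .half k, .dip k, .half' k, .top' k] ++ ps)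
      (qBlock S' M (k + 1)) := by
  have h₁ : Coupled (NearSym a b) [.top k] [.top (k + 1)] := by
    refine .pair (near_of_le 70 40 (by norm_num) ?_ ?_ ?_ ?_) <;> simp [PSym.pos, QSym.pos] <;>
      omega
  have h₂ : Coupled (NearSym a b) [.half k] [.half (k + 1)] := by
    refine .pair (near_of_le 70 10 (by norm_num) ?_ ?_ ?_ ?_) <;> simp [PSym.pos, QSym.pos] <;>
      omega
  have h₃ : Coupled (NearSym a b) [.dip k]
      (.first (k + 1) :: ((List.range S').flatMap (qVec M (k + 1)) ++ [.last (k + 1)])) := by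
    refine .left _ _ (by simp) fun q hq => ?_
    simp only [List.mem_cons, List.mem_append, List.mem_flatMap, List.not_mem_nil, or_false] at hq
    rcases hq with rfl | ⟨j, -, hq⟩ | rfl
    · refine near_of_le 97 8 (by norm_num) ?_ ?_ ?_ ?_ <;> simp [PSym.pos, QSym.pos] <;> omega
    · exact nearSym_dip_succ hq
    · refine near_of_le 97 8 (by norm_num) ?_ ?_ ?_ ?_ <;> simp [PSym.pos, QSym.pos] <;> omega
  have h₄ : Coupled (NearSym a b) [.half' k] [.half' (k + 1)] := by
    refine .pair (near_of_le 70 10 (by norm_num) ?_ ?_ ?_ ?_) <;> simp [PSym.pos, QSym.pos] <;>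
      omega
  have h₅ : Coupled (NearSym a b) (.top' k :: ps) [.top' (k + 1)] := by
    refine .right _ _ (by simp) fun p hp => ?_
    rcases List.mem_cons.1 hp with rfl | hp
    · refine near_of_le 70 40 (by norm_num) ?_ ?_ ?_ ?_ <;> simp [PSym.pos, QSym.pos] <;> omega
    · exact hps p hp
  simpa [qBlock] using h₁.append (h₂.append (h₃.append (h₄.append h₅)))

/-- Once the second curve is one dip ahead, dip `k` of the first curve is traversed with dip `k + 1`
of the second, and the vectors of the first curve pass while the second waits at `top'`. The dip
without vectors at the end completes the last match. -/
theorem coupled_shifted (k m : ℕ) : Coupled (NearSym a b)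
    ([.top k, .half k, .dip k, .half' k, .top' k] ++
      (List.range' (k + 1) m).flatMap (pBlock S M))
    ((List.range' (k + 1) m).flatMap (qBlock S M) ++ qBlock 0 M (k + 1 + m)) := by
  induction m generalizing k with
  | zero =>
    simpa using coupled_shifted_block (a := a) (b := b) (M := M) k 0 (ps := []) (by simp)
  | succ m ih =>
    have h := coupled_shifted_block (a := a) (b := b) (M := M) k S
      (ps := (List.range S).flatMap (pVec M (k + 1))) (by
        intro p hp
        obtain ⟨i, -, hp⟩ := List.mem_flatMap.1 hp
        exact (nearSym_top hp).2)
    have := h.append (ih (k + 1))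
    rw [show k + 1 + (m + 1) = k + 1 + 1 + m by omega]
    simpa [List.range'_succ, pBlock] using this

/-- The traversal in which the second curve overtakes the first one. -/
theorem coupled_gadget {k i j : ℕ} (hi : i < S) (hj : j < S)
    (hcomp : ∀ c < M, ¬ (a k i c = true ∧ b k j c = true)) :
    Coupled (NearSym a b) ((List.range S).flatMap (pVec M k)) (qBlock S M k) := by
  obtain ⟨s, t, hst⟩ := List.append_of_mem (List.mem_range.2 hi)
  obtain ⟨s', t', hst'⟩ := List.append_of_mem (List.mem_range.2 hj)
  have h₁ : Coupled (NearSym a b) (s.flatMap (pVec M k) ++ [.base k i]) [.top k] := by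
    refine .right _ _ (by simp) fun p hp => ?_
    simp only [List.mem_append, List.mem_flatMap, List.mem_singleton] at hp
    rcases hp with ⟨i, -, hp⟩ | rfl
    · exact (nearSym_top hp).1
    · exact (nearSym_top (M := M) (i := i) (by simp [pVec])).1
  -- The first curve waits at `enter` while the second descends and passes the vectors before `j`;
  -- then the two gadgets run in lockstep, and `leave` covers the remaining vectors and the ascent.
  have h₂ : Coupled (NearSym a b) [.enter k i]
      (.half k :: .first k :: (s'.flatMap (qVec M k) ++ [.sep k j])) := by
    refine .left _ _ (by simp) fun q hq => ?_
    simp only [List.mem_cons, List.mem_append, List.mem_flatMap, List.not_mem_nil, or_false] at hq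
    rcases hq with rfl | rfl | ⟨j, -, hq⟩ | rfl
    · refine near_of_le 20 10 (by norm_num) ?_ ?_ ?_ ?_ <;> simp [PSym.pos, QSym.pos]
    · refine near_of_le 5 95 (by norm_num) ?_ ?_ ?_ ?_ <;> simp [PSym.pos, QSym.pos]
    · exact (nearSym_enter hq).1
    · exact (nearSym_enter (M := M) (j := j) (by simp [qVec])).1
  have h₃ : ∀ c < M, Coupled (NearSym a b) [.right k i c, .mid k i c, .left k i c, .mid' k i c]
      [.right k j c, .mid k j c, .left k j c, .mid' k j c] := by
    intro c hc
    refine .append (as := [_]) (bs := [_]) (.pair ?_) (.append (as := [_]) (bs := [_]) (.pair ?_)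
      (.append (as := [_]) (bs := [_]) (.pair ?_) (.pair ?_)))
    · have h := hcomp c hc
      have h1 := toNat_cases (a k i c)
      have h2 := toNat_cases (b k j c)
      refine near_of_le 0 100 (by norm_num) ?_ ?_ ?_ ?_ <;> simp [PSym.pos, QSym.pos]
      · rcases h1 with h1 | h1 <;> rcases h2 with h2 | h2 <;> first
        | omega
        | exact absurd ⟨h1.1, h2.1⟩ h
      · omega
    all_goals refine near_of_le 0 100 (by norm_num) ?_ ?_ ?_ ?_ <;> simp [PSym.pos, QSym.pos]
  have h₄ : Coupled (NearSym a b) (.leave k i :: t.flatMap (pVec M k))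
      ((t'.flatMap (qVec M k) ++ [.last k, .half' k]) ++ [.top' k]) := by
    refine .corner ?_ ?_ ?_
    · exact (nearSym_top (M := M) (i := i) (by simp [pVec])).2
    · intro q hq
      simp only [List.mem_cons, List.mem_append, List.mem_flatMap, List.not_mem_nil, or_false] at hq
      rcases hq with ⟨j, -, hq⟩ | rfl | rfl
      · exact (nearSym_enter hq).2
      · refine near_of_le 5 95 (by norm_num) ?_ ?_ ?_ ?_ <;> simp [PSym.pos, QSym.pos]
      · refine near_of_le 20 10 (by norm_num) ?_ ?_ ?_ ?_ <;> simp [PSym.pos, QSym.pos]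
    · intro p hp
      obtain ⟨i, -, hp⟩ := List.mem_flatMap.1 hp
      exact (nearSym_top hp).2
  have h := ((h₁.append h₂).append_flatMap h₃).append h₄
  have e : qBlock S M k = [.top k, .half k, .first k] ++ (s' ++ j :: t').flatMap (qVec M k) ++
      [.last k, .half' k, .top' k] := by rw [qBlock, hst']
  rw [e, hst]
  simpa [pVec, qVec] using h

theorem coupled_of_compatible {k i j : ℕ} (hk : k < K) (hi : i < S) (hj : j < S)
    (hcomp : ∀ c < M, ¬ (a k i c = true ∧ b k j c = true)) :
    Coupled (NearSym a b) (pSyms K S M) (qSyms K S M) := by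
  have h := ((coupled_gadget hi hj hcomp).append (coupled_shifted (S := S) (M := M) k (K - (k + 1))))
  have h' := Coupled.flatMap_append h (n := k) fun c _ => coupled_block (S := S) (M := M) c
  have hr : List.range K = List.range k ++ k :: List.range' (k + 1) (K - (k + 1)) := by
    have := List.range'_append_1 (s := 0) (m := k) (n := K - (k + 1) + 1)
    rw [List.range'_succ, Nat.zero_add, show k + (K - (k + 1) + 1) = K by omega] at this
    rw [List.range_eq_range', List.range_eq_range', this]
  rw [pSyms, qSyms, hr]
  rw [show k + 1 + (K - (k + 1)) = K by omega] at h'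
  simpa [pBlock] using h'

end traversal

theorem near_frechet_of_compatible {d K S M : ℕ} {a b : ℕ → ℕ → ℕ → Bool} {k i j : ℕ}
    (hk : k < K) (hi : i < S) (hj : j < S)
    (hcomp : ∀ c < M, ¬ (a k i c = true ∧ b k j c = true)) :
    Curve.frechetDist ((pSyms K S M).map fun p => gridPoint d (p.pos a))
        ((qSyms K S M).map fun q => gridPoint d (q.pos b)) ≤ 100 ∧
      Curve.discreteFrechetDist ((pSyms K S M).map fun p => gridPoint d (p.pos a))
        ((qSyms K S M).map fun q => gridPoint d (q.pos b)) ≤ 100 := by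
  have hdist : ∀ p q, NearSym a b p q →
      dist (gridPoint d (p.pos a)) (gridPoint d (q.pos b)) ≤ 100 := fun p q h => Near.dist_le h
  have h := (coupled_of_compatible hk hi hj hcomp).map
    (r' := fun x y : EuclideanSpace ℝ (Fin d) => dist x y ≤ 100) hdist
  exact Curve.frechet_le_of_coupled h

/-! ## Packedness -/

namespace Curve

variable {d : ℕ}

theorem lengthIn_nonneg (P : Curve d) (q : EuclideanSpace ℝ (Fin d)) (r : ℝ) :
    0 ≤ P.lengthIn q r :=
  Finset.sum_nonneg fun _ _ => mul_nonneg dist_nonneg measureReal_nonneg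

/-- Each packedness inequality is a closed lower bound on `c`, so the infimum of the admissible
constants is itself admissible. -/
theorem exists_isPackedness {P Q : Curve d} {c₀ : ℝ} (hP : P.IsPacked c₀) (hQ : Q.IsPacked c₀) :
    ∃ c, IsPackedness c P Q := by
  have hne : {c : ℝ | P.IsPacked c ∧ Q.IsPacked c}.Nonempty := ⟨c₀, hP, hQ⟩
  refine ⟨sInf {c : ℝ | P.IsPacked c ∧ Q.IsPacked c}, ⟨?_, ?_⟩, fun c hc => csInf_le ⟨0, ?_⟩ hc⟩
  · intro q r hr
    rw [← div_le_iff₀ hr]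
    exact le_csInf hne fun c hc => (div_le_iff₀ hr).2 (hc.1 q r hr)
  · intro q r hr
    rw [← div_le_iff₀ hr]
    exact le_csInf hne fun c hc => (div_le_iff₀ hr).2 (hc.2 q r hr)
  · intro c hc
    have := (lengthIn_nonneg P 0 1).trans (hc.1 0 1 one_pos)
    linarith

/-- Two points in the ball are at most `2 * r` apart, so the parameters of the segment's part in the
ball have diameter at most `2 * r / dist a b`. -/
theorem dist_mul_volume_le {a b q : EuclideanSpace ℝ (Fin d)} {r : ℝ} (hr : 0 < r) :
    dist a b * volume.real {x : ℝ | x ∈ Icc (0 : ℝ) 1 ∧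
      AffineMap.lineMap a b x ∈ Metric.closedBall q r} ≤ min (dist a b) (2 * r) := by
  set A := {x : ℝ | x ∈ Icc (0 : ℝ) 1 ∧ AffineMap.lineMap a b x ∈ Metric.closedBall q r} with hA
  have hsub : A ⊆ Icc 0 1 := fun x hx => hx.1
  refine le_min ?_ ?_
  · have h1 : volume.real A ≤ volume.real (Icc (0 : ℝ) 1) := measureReal_mono hsub (by simp)
    have h2 : volume.real (Icc (0 : ℝ) 1) = 1 := by simp
    exact mul_le_of_le_one_right dist_nonneg (h1.trans h2.le)
  · rcases (dist_nonneg (x := a) (y := b)).eq_or_lt with h0 | h0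
    · rw [← h0, zero_mul]; positivity
    · have hdiam : volume A ≤ ENNReal.ofReal (2 * r / dist a b) := by
        refine (Real.volume_le_diam A).trans (Metric.ediam_le fun x hx y hy => ?_)
        rw [edist_dist]
        refine ENNReal.ofReal_le_ofReal ?_
        rw [le_div_iff₀ h0, ← dist_lineMap_lineMap]
        have h1 := Metric.mem_closedBall.1 hx.2
        have h2 := Metric.mem_closedBall.1 hy.2
        linarith [dist_triangle_right (AffineMap.lineMap a b x : EuclideanSpace ℝ (Fin d))
          (AffineMap.lineMap a b y) q]
      have h3 : volume.real A ≤ 2 * r / dist a b :=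
        ENNReal.toReal_le_of_le_ofReal (by positivity) hdiam
      calc dist a b * volume.real A ≤ dist a b * (2 * r / dist a b) := by gcongr
        _ = 2 * r := by field_simp

/-- The locations `k` with `140 * k` in an interval of length `2 * B` number at most `B / 70 + 1`,
and each accounts for `m` indices. -/
theorem card_filter_div_le (n : ℕ) {m : ℕ} (hm : 0 < m) (A B : ℝ) (hB : 0 ≤ B) :
    (((Finset.range n).filter fun i => |140 * ((i / m : ℕ) : ℝ) - A| ≤ B).card : ℝ) ≤
      m * (B / 70 + 1) := by
  set T := (Finset.range n).filter fun k : ℕ => |140 * (k : ℝ) - A| ≤ B with hT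
  have hTc : (T.card : ℝ) ≤ B / 70 + 1 := by
    rcases T.eq_empty_or_nonempty with h | h
    · rw [h]; simp; positivity
    · have hsub : T ⊆ Finset.Icc (T.min' h) (T.max' h) := fun k hk =>
        Finset.mem_Icc.2 ⟨T.min'_le k hk, T.le_max' k hk⟩
      have h1 := Finset.card_le_card hsub
      rw [Nat.card_Icc] at h1
      have h2 := (Finset.mem_filter.1 (T.min'_mem h)).2
      have h3 := (Finset.mem_filter.1 (T.max'_mem h)).2
      rw [abs_le] at h2 h3
      have h4 : T.card ≤ T.max' h - T.min' h + 1 := by have := T.min'_le_max' h; omega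
      have h5 : (T.card : ℝ) ≤ (T.max' h : ℝ) - T.min' h + 1 := by
        have : ((T.max' h - T.min' h : ℕ) : ℝ) = (T.max' h : ℝ) - T.min' h :=
          Nat.cast_sub (T.min'_le_max' h)
        rw [← this]; exact_mod_cast h4
      linarith
  have hsub : ((Finset.range n).filter fun i => |140 * ((i / m : ℕ) : ℝ) - A| ≤ B) ⊆
      T.biUnion fun k => Finset.Ico (k * m) (k * m + m) := by
    intro i hi
    rw [Finset.mem_filter, Finset.mem_range] at hi
    rw [Finset.mem_biUnion]
    refine ⟨i / m, Finset.mem_filter.2 ⟨Finset.mem_range.2 ?_, hi.2⟩, Finset.mem_Ico.2 ⟨?_, ?_⟩⟩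
    · exact (Nat.div_le_self i m).trans_lt hi.1
    · exact Nat.div_mul_le_self i m
    · exact Nat.lt_div_mul_add hm
  have h1 : ((Finset.range n).filter fun i => |140 * ((i / m : ℕ) : ℝ) - A| ≤ B).card ≤
      T.card * m :=
    (Finset.card_le_card hsub).trans (Finset.card_biUnion_le_card_mul _ _ _ fun k _ => by simp)
  calc _ ≤ ((T.card * m : ℕ) : ℝ) := by exact_mod_cast h1
    _ = m * T.card := by push_cast; ring
    _ ≤ m * (B / 70 + 1) := by gcongr

/-- A curve that passes with `m` vertices per location through boxes of size `140 × 175` is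
`16 m`-packed. -/
theorem isPacked_of_boxes (hd : 2 ≤ d) {P : List (ℕ × ℕ)} {m : ℕ} (hm : 0 < m)
    (h : ∀ i (hi : i < P.length), 140 * (i / m) ≤ P[i].1 ∧ P[i].1 ≤ 140 * (i / m) + 140 ∧
      P[i].2 ≤ 175) : IsPacked (16 * m) (P.map (gridPoint d)) := by
  intro q r hr
  set i₀ : Fin d := ⟨0, by omega⟩
  have hterm : ∀ i ∈ Finset.range ((P.map (gridPoint d)).length - 1),
      dist (Curve.vertex (P.map (gridPoint d)) i) (Curve.vertex (P.map (gridPoint d)) (i + 1)) *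
        volume.real {x : ℝ | x ∈ Icc (0 : ℝ) 1 ∧
          AffineMap.lineMap (Curve.vertex (P.map (gridPoint d)) i)
            (Curve.vertex (P.map (gridPoint d)) (i + 1)) x ∈ Metric.closedBall q r} ≤
      -- Two consecutive vertices span abscissas of width at most `280` and heights of at most
      -- `175`, so a segment has length at most `400`, and it misses the ball if its location is
      -- farther away than `r + 280`.
      if |140 * ((i / m : ℕ) : ℝ) - q.ofLp i₀| ≤ r + 280 then min 400 (2 * r) else 0 := by
    intro i hi
    rw [Finset.mem_range, List.length_map] at hi
    have hi1 : i < P.length := by omega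
    have hi2 : i + 1 < P.length := by omega
    rw [vertex_map hi1, vertex_map hi2]
    have hdiv : i / m ≤ (i + 1) / m ∧ (i + 1) / m ≤ i / m + 1 := by
      refine ⟨Nat.div_le_div_right (Nat.le_succ i), ?_⟩
      rw [← Nat.add_div_right i hm]
      exact Nat.div_le_div_right (by omega)
    obtain ⟨a1, a2, a3⟩ := h i hi1
    obtain ⟨b1, b2, b3⟩ := h (i + 1) hi2
    have hb1 : 140 * (i / m) ≤ P[i + 1].1 := by omega
    have hb2 : P[i + 1].1 ≤ 140 * (i / m) + 280 := by omega
    have ra1 : 140 * ((i / m : ℕ) : ℝ) ≤ P[i].1 := by exact_mod_cast a1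
    have ra2 : (P[i].1 : ℝ) ≤ 140 * ((i / m : ℕ) : ℝ) + 140 := by exact_mod_cast a2
    have ra3 : (P[i].2 : ℝ) ≤ 175 := by exact_mod_cast a3
    have rb1 : 140 * ((i / m : ℕ) : ℝ) ≤ P[i + 1].1 := by exact_mod_cast hb1
    have rb2 : (P[i + 1].1 : ℝ) ≤ 140 * ((i / m : ℕ) : ℝ) + 280 := by exact_mod_cast hb2
    have rb3 : (P[i + 1].2 : ℝ) ≤ 175 := by exact_mod_cast b3
    have hdist : dist (gridPoint d P[i]) (gridPoint d P[i + 1]) ≤ 400 := by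
      have h1 := dist_gridPoint_sq_le (d := d) P[i] P[i + 1]
      have h2 : ((P[i].1 : ℝ) - P[i + 1].1) ^ 2 ≤ 280 ^ 2 := by
        apply sq_le_sq'  <;> linarith
      have h3 : ((P[i].2 : ℝ) - P[i + 1].2) ^ 2 ≤ 175 ^ 2 := by
        have : (0 : ℝ) ≤ P[i].2 := by positivity
        have : (0 : ℝ) ≤ P[i + 1].2 := by positivity
        apply sq_le_sq' <;> linarith
      exact le_of_sq_le_sq (by linarith) (by norm_num)
    split_ifs with hcond
    · refine (dist_mul_volume_le hr).trans (min_le_min_right _ hdist)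
    · have : {x : ℝ | x ∈ Icc (0 : ℝ) 1 ∧ AffineMap.lineMap (gridPoint d P[i])
          (gridPoint d P[i + 1]) x ∈ Metric.closedBall q r} = ∅ := by
        rw [eq_empty_iff_forall_notMem]
        rintro x ⟨hx, hball⟩
        apply hcond
        have h1 : |(AffineMap.lineMap (gridPoint d P[i]) (gridPoint d P[i + 1]) x).ofLp i₀ -
            q.ofLp i₀| ≤ r := by
          have h2 := Metric.mem_closedBall.1 hball
          rw [dist_eq_norm] at h2
          exact (PiLp.norm_apply_le (_ - q) i₀).trans h2
        have e : (AffineMap.lineMap (gridPoint d P[i]) (gridPoint d P[i + 1]) x).ofLp i₀ =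
            (1 - x) * P[i].1 + x * P[i + 1].1 := by
          rw [AffineMap.lineMap_apply_module]
          simp [gridPoint, i₀]
        rw [e, abs_le] at h1
        have h3 : 140 * ((i / m : ℕ) : ℝ) ≤ (1 - x) * P[i].1 + x * P[i + 1].1 := by
          nlinarith [hx.1, hx.2]
        have h4 : (1 - x) * P[i].1 + x * P[i + 1].1 ≤ 140 * ((i / m : ℕ) : ℝ) + 280 := by
          nlinarith [hx.1, hx.2]
        rw [abs_le]
        constructor <;> linarith [h1.1, h1.2]
      rw [this]; simp
  refine (Finset.sum_le_sum hterm).trans ?_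
  rw [← Finset.sum_filter, Finset.sum_const, nsmul_eq_mul]
  have hc := card_filter_div_le ((P.map (gridPoint d)).length - 1) hm (q.ofLp i₀) (r + 280)
    (by positivity)
  -- The number of locations is `r / 70 + 5`. The constant `400` is used against the part linear in
  -- `r` and `2 * r` against the constant part: `400 / 70 + 10 < 16`.
  have h1 : min 400 (2 * r) * (r / 70) ≤ 400 * (r / 70) :=
    mul_le_mul_of_nonneg_right (min_le_left _ _) (by positivity)
  have h2 : min 400 (2 * r) * 5 ≤ 2 * r * 5 :=
    mul_le_mul_of_nonneg_right (min_le_right _ _) (by positivity)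
  have hmin : 0 ≤ min 400 (2 * r) := le_min (by norm_num) (by positivity)
  calc _ ≤ m * ((r + 280) / 70 + 1) * min 400 (2 * r) := by gcongr
    _ = m * (min 400 (2 * r) * (r / 70) + min 400 (2 * r) * 5) := by ring
    _ ≤ m * (16 * r) := by gcongr; linarith
    _ = 16 * m * r := by ring

end Curve

/-! ### Lengths and packedness of the constructed curves -/

theorem getElem?_flatMap_range {α : Type*} {f : ℕ → List α} {m : ℕ} {n : ℕ}
    (hf : ∀ k < n, (f k).length = m) {k j : ℕ} (hk : k < n) (hj : j < m) :
    ((List.range n).flatMap f)[k * m + j]? = (f k)[j]? := by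
  induction n with
  | zero => omega
  | succ n ih =>
    have hl : ((List.range n).flatMap f).length = n * m := by
      rw [List.length_flatMap, List.map_congr_left (g := fun _ => m)
        (fun k hk => hf k (by have := List.mem_range.1 hk; omega))]
      simp
    rw [List.range_succ, List.flatMap_append, List.flatMap_singleton]
    rcases Nat.lt_succ_iff_lt_or_eq.1 hk with h | rfl
    · rw [List.getElem?_append_left, ih (fun k hk => hf k (by omega)) h]
      rw [hl]
      calc k * m + j < k * m + m := by omega
        _ = (k + 1) * m := by ring
        _ ≤ n * m := Nat.mul_le_mul_right m h
    · rw [List.getElem?_append_right (by rw [hl]; omega), hl]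
      congr 1; omega

section curves

variable {K S M : ℕ} {a b : ℕ → ℕ → ℕ → Bool}

theorem length_flatMap_range {α : Type*} {f : ℕ → List α} {m n : ℕ}
    (hf : ∀ k < n, (f k).length = m) : ((List.range n).flatMap f).length = n * m := by
  rw [List.length_flatMap, List.map_congr_left (g := fun _ => m)
    (fun k hk => hf k (List.mem_range.1 hk))]
  simp

theorem length_pVec (k i : ℕ) : (pVec M k i).length = 4 * M + 3 := by
  rw [pVec, List.length_append, List.length_append, length_flatMap_range (m := 4) (by simp)]
  simp; ring

theorem length_pBlock (k : ℕ) : (pBlock S M k).length = S * (4 * M + 3) + 5 := by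
  rw [pBlock, List.length_append, length_flatMap_range fun i _ => length_pVec k i]
  simp

theorem length_pSyms : (pSyms K S M).length = K * (S * (4 * M + 3) + 5) :=
  length_flatMap_range fun k _ => length_pBlock k

theorem length_qVec (k j : ℕ) : (qVec M k j).length = 4 * M + 1 := by
  rw [qVec, List.length_append, length_flatMap_range (m := 4) (by simp)]
  simp; ring

theorem length_qBlock (k : ℕ) : (qBlock S M k).length = S * (4 * M + 1) + 6 := by
  rw [qBlock, List.length_append, List.length_append,
    length_flatMap_range fun i _ => length_qVec k i]
  simp; ring

theorem length_qSyms : (qSyms K S M).length = K * (S * (4 * M + 1) + 6) + 6 := by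
  rw [qSyms, List.length_append, length_flatMap_range fun k _ => length_qBlock k, length_qBlock]
  simp

theorem getElem_flatMap_range {α : Type*} {f : ℕ → List α} {m n : ℕ} (hm : 0 < m)
    (hf : ∀ k < n, (f k).length = m) {i : ℕ} (hi : i < ((List.range n).flatMap f).length) :
    ((List.range n).flatMap f)[i] ∈ f (i / m) := by
  have hi' := hi
  rw [length_flatMap_range hf] at hi'
  have h1 : i / m < n := (Nat.div_lt_iff_lt_mul hm).2 hi'
  have h := getElem?_flatMap_range hf h1 (Nat.mod_lt i hm)
  rw [Nat.div_add_mod', List.getElem?_eq_getElem hi] at h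
  exact List.mem_of_getElem? h.symm

theorem pos_of_mem_pBlock {k : ℕ} {p : PSym} (hp : p ∈ pBlock S M k) :
    140 * k ≤ (p.pos a).1 ∧ (p.pos a).1 ≤ 140 * k + 140 ∧ (p.pos a).2 ≤ 175 := by
  simp only [pBlock, pVec, List.mem_append, List.mem_cons, List.mem_flatMap, List.not_mem_nil,
    or_false] at hp
  rcases hp with ⟨i, -, ((rfl | rfl) | ⟨c, -, rfl | rfl | rfl | rfl⟩) | rfl⟩ |
    rfl | rfl | rfl | rfl | rfl
  case inl.inl.inr.inl => have := bit_le (a k i c); simp [PSym.pos]; omega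
  all_goals simp [PSym.pos]

theorem pos_of_mem_qBlock {k : ℕ} {q : QSym} (hq : q ∈ qBlock S M k) :
    140 * k ≤ (q.pos b).1 ∧ (q.pos b).1 ≤ 140 * k + 140 ∧ (q.pos b).2 ≤ 175 := by
  simp only [qBlock, qVec, List.mem_append, List.mem_cons, List.mem_flatMap, List.not_mem_nil,
    or_false] at hq
  rcases hq with ((rfl | rfl | rfl) | ⟨j, -, rfl | ⟨c, -, rfl | rfl | rfl | rfl⟩⟩) |
    rfl | rfl | rfl
  case inl.inr.inr.inl => have := bit_le (!b k j c); simp [QSym.pos]; omega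
  all_goals simp [QSym.pos]

/-- `S * (4 * M + 3) + 6` dominates the block lengths of both curves, which gives the pair a common
constant. -/
theorem isPacked_pSyms {d : ℕ} (hd : 2 ≤ d) :
    Curve.IsPacked (16 * (S * (4 * M + 3) + 6 : ℕ))
      ((pSyms K S M).map fun p => gridPoint d (p.pos a)) := by
  have h := Curve.isPacked_of_boxes hd (P := (pSyms K S M).map (PSym.pos a))
    (m := S * (4 * M + 3) + 5) (by omega) ?_
  · rw [List.map_map] at h
    intro q r hr
    refine (h q r hr).trans ?_
    gcongr
    omega
  · intro i hi
    rw [List.length_map] at hi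
    rw [List.getElem_map]
    exact pos_of_mem_pBlock
      (getElem_flatMap_range (by omega) (fun k _ => length_pBlock (S := S) (M := M) k) hi)

theorem isPacked_qSyms {d : ℕ} (hd : 2 ≤ d) :
    Curve.IsPacked (16 * (S * (4 * M + 3) + 6 : ℕ))
      ((qSyms K S M).map fun q => gridPoint d (q.pos b)) := by
  have h := Curve.isPacked_of_boxes hd (P := (qSyms K S M).map (QSym.pos b))
    (m := S * (4 * M + 1) + 6) (by omega) ?_
  · rw [List.map_map] at h
    intro q r hr
    refine (h q r hr).trans ?_
    gcongr
    omega
  · intro i hi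
    rw [List.length_map] at hi
    rw [List.getElem_map]
    have hm : 0 < S * (4 * M + 1) + 6 := by omega
    have hl : ((List.range K).flatMap (qBlock S M)).length = K * (S * (4 * M + 1) + 6) :=
      length_flatMap_range fun k _ => length_qBlock k
    by_cases hiK : i < K * (S * (4 * M + 1) + 6)
    · have e : (qSyms K S M)[i] = ((List.range K).flatMap (qBlock S M))[i]'(by omega) :=
        List.getElem_append_left _
      rw [e]
      exact pos_of_mem_qBlock
        (getElem_flatMap_range hm (fun k _ => length_qBlock (S := S) (M := M) k) _)
    · have hi' := hi
      rw [length_qSyms] at hi'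
      have e : (qSyms K S M)[i] = (qBlock 0 M K)[i - K * (S * (4 * M + 1) + 6)]'(by
          rw [length_qBlock]; omega) := by
        simp only [qSyms]
        rw [List.getElem_append_right (by omega)]
        simp only [hl]
      have hdiv : i / (S * (4 * M + 1) + 6) = K := by
        rw [Nat.div_eq_iff hm]
        omega
      rw [e, hdiv]
      exact pos_of_mem_qBlock (List.getElem_mem _)

/-- Location `0` contains `S` copies of the segment from `base` to `enter`, each of length at least
`40` and inside the ball of radius `400` around the origin. -/
theorem le_of_isPacked_pSyms {d : ℕ} (hd : 2 ≤ d) (hK : 0 < K) {c : ℝ}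
    (h : Curve.IsPacked c ((pSyms K S M).map fun p => gridPoint d (p.pos a))) :
    (S : ℝ) ≤ 10 * c := by
  have h1 := h (gridPoint d (0, 0)) 400 (by norm_num)
  suffices hS : (S : ℝ) * 40 ≤ Curve.lengthIn ((pSyms K S M).map fun p => gridPoint d (p.pos a))
      (gridPoint d (0, 0)) 400 by linarith
  have hv : ∀ i < S, (pSyms K S M)[i * (4 * M + 3)]? = some (.base 0 i) ∧
      (pSyms K S M)[i * (4 * M + 3) + 1]? = some (.enter 0 i) := by
    intro i hi
    have key : ∀ j < 4 * M + 3, (pSyms K S M)[i * (4 * M + 3) + j]? = (pVec M 0 i)[j]? := by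
      intro j hj
      have hlt : i * (4 * M + 3) + j < S * (4 * M + 3) := by
        calc i * (4 * M + 3) + j < i * (4 * M + 3) + (4 * M + 3) := by omega
          _ = (i + 1) * (4 * M + 3) := by ring
          _ ≤ S * (4 * M + 3) := Nat.mul_le_mul_right _ hi
      have h2 := getElem?_flatMap_range (f := pBlock S M) (fun k _ => length_pBlock k) hK
        (j := i * (4 * M + 3) + j) (by omega)
      rw [Nat.zero_mul, Nat.zero_add] at h2
      rw [pSyms, h2, pBlock, List.getElem?_append_left (by
        rw [length_flatMap_range fun i _ => length_pVec 0 i]; exact hlt)]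
      exact getElem?_flatMap_range (fun i _ => length_pVec 0 i) hi hj
    exact ⟨by simpa [pVec] using key 0 (by omega), by simpa [pVec] using key 1 (by omega)⟩
  have hball : ∀ x y : ℕ, x ≤ 200 → y ≤ 200 →
      gridPoint d (x, y) ∈ Metric.closedBall (gridPoint d (0, 0)) 400 := by
    intro x y hx hy
    have h2 := dist_gridPoint_sq_le (d := d) (x, y) (0, 0)
    have hx' : (x : ℝ) ≤ 200 := by exact_mod_cast hx
    have hy' : (y : ℝ) ≤ 200 := by exact_mod_cast hy
    have hx0 : (0 : ℝ) ≤ x := by positivity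
    have hy0 : (0 : ℝ) ≤ y := by positivity
    refine Metric.mem_closedBall.2 (le_of_sq_le_sq ?_ (by norm_num))
    simp only [Nat.cast_zero, sub_zero] at h2
    nlinarith
  set P := (pSyms K S M).map fun p => gridPoint d (p.pos a) with hP
  have hvert : ∀ i < S, Curve.vertex P (i * (4 * M + 3)) = gridPoint d (30, 135) ∧
      Curve.vertex P (i * (4 * M + 3) + 1) = gridPoint d (10, 95) := by
    intro i hi
    obtain ⟨e1, e2⟩ := hv i hi
    exact ⟨Curve.vertex_eq_of_getElem? (by rw [hP, List.getElem?_map, e1]; simp [PSym.pos]),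
      Curve.vertex_eq_of_getElem? (by rw [hP, List.getElem?_map, e2]; simp [PSym.pos])⟩
  have hdist : (40 : ℝ) ≤ dist (gridPoint d (30, 135)) (gridPoint d (10, 95)) := by
    rw [dist_eq_norm]
    refine le_trans ?_ (PiLp.norm_apply_le (gridPoint d (30, 135) - gridPoint d (10, 95)) ⟨1, by omega⟩)
    simp [gridPoint]; norm_num
  unfold Curve.lengthIn
  rw [show (S : ℝ) * 40 = ∑ i ∈ Finset.range S, (40 : ℝ) by simp]
  have hinj : Set.InjOn (fun i => i * (4 * M + 3)) (Finset.range S) := by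
    intro x _ y _ hxy
    exact Nat.eq_of_mul_eq_mul_right (by omega) hxy
  have hsub : (Finset.range S).image (fun i => i * (4 * M + 3)) ⊆ Finset.range (P.length - 1) := by
    intro j hj
    obtain ⟨i, hi, rfl⟩ := Finset.mem_image.1 hj
    have := (List.getElem?_eq_some_iff.1 (hv i (Finset.mem_range.1 hi)).2).1
    rw [Finset.mem_range, hP, List.length_map]
    omega
  refine le_trans ?_ (Finset.sum_le_sum_of_subset_of_nonneg hsub
    fun _ _ _ => mul_nonneg dist_nonneg measureReal_nonneg)
  rw [Finset.sum_image hinj]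
  refine Finset.sum_le_sum fun i hi => ?_
  obtain ⟨e1, e2⟩ := hvert i (Finset.mem_range.1 hi)
  rw [e1, e2]
  have hset : {x : ℝ | x ∈ Icc (0 : ℝ) 1 ∧ AffineMap.lineMap (gridPoint d (30, 135))
      (gridPoint d (10, 95)) x ∈ Metric.closedBall (gridPoint d (0, 0)) 400} = Icc 0 1 := by
    refine Set.ext fun x => ⟨fun hx => hx.1, fun hx => ⟨hx, ?_⟩⟩
    exact (convex_closedBall _ _).lineMap_mem (hball _ _ (by norm_num) (by norm_num))
      (hball _ _ (by norm_num) (by norm_num)) hx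
  rw [hset]
  simpa using hdist

end curves

/-! ## Weakest preconditions for word RAM programs -/

namespace WordRAM

/-- A machine state with registers and memory cells that hold natural numbers. -/
structure NState where
  reg : ℕ → ℕ
  mem : ℕ → ℕ

namespace NState

/-- The state of a machine with word length `w` that represents a state with natural numbers. -/
def emb (w : ℕ) (s : NState) : State w where
  reg r := BitVec.ofNat w (s.reg r)
  mem a := BitVec.ofNat w (s.mem a.toNat)

def setReg (s : NState) (r x : ℕ) : NState := { s with reg := Function.update s.reg r x }

def setMem (s : NState) (a x : ℕ) : NState := { s with mem := Function.update s.mem a x }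

@[simp] theorem reg_setReg (s : NState) (r x r' : ℕ) :
    (s.setReg r x).reg r' = if r' = r then x else s.reg r' := by
  simp [setReg, Function.update_apply]

@[simp] theorem mem_setReg (s : NState) (r x : ℕ) : (s.setReg r x).mem = s.mem := rfl

@[simp] theorem reg_setMem (s : NState) (a x : ℕ) : (s.setMem a x).reg = s.reg := rfl

theorem mem_setMem (s : NState) (a x : ℕ) : (s.setMem a x).mem = Function.update s.mem a x := rfl

variable {w : ℕ}

theorem emb_setReg (s : NState) (r x : ℕ) :
    (s.setReg r x).emb w =
      { s.emb w with reg := Function.update (s.emb w).reg r (BitVec.ofNat w x) } := by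
  simp only [emb, setReg]
  congr 1
  funext r'
  by_cases h : r' = r
  · subst h; simp
  · simp [h]

theorem emb_setMem (s : NState) {a : ℕ} (x : ℕ) (ha : a < 2 ^ w) :
    (s.setMem a x).emb w = { s.emb w with
      mem := Function.update (s.emb w).mem (BitVec.ofNat w a) (BitVec.ofNat w x) } := by
  simp only [emb, setMem]
  congr 1
  funext a'
  have : a' = BitVec.ofNat w a ↔ a'.toNat = a := by
    constructor
    · rintro rfl; simp [Nat.mod_eq_of_lt ha]
    · rintro rfl; simp
  by_cases h : a'.toNat = a
  · rw [this.2 h]; simp [Nat.mod_eq_of_lt ha]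
  · rw [Function.update_of_ne h, Function.update_of_ne (fun h' => h (this.1 h'))]

end NState

/-- The operations on natural numbers, with truncated subtraction. -/
def BinOp.natEval : BinOp → ℕ → ℕ → ℕ
  | .add, x, y => x + y
  | .sub, x, y => x - y
  | .mul, x, y => x * y
  | .div, x, y => x / y
  | .mod, x, y => x % y
  | .and, x, y => x &&& y
  | .or, x, y => x ||| y
  | .xor, x, y => x ^^^ y
  | .shl, x, y => x <<< y
  | .shr, x, y => x >>> y
  | .lt, x, y => if x < y then 1 else 0
  | .eq, x, y => if x = y then 1 else 0

/-- A condition under which the operation on words agrees with the one on numbers. -/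
def BinOp.Safe (w : ℕ) : BinOp → ℕ → ℕ → Prop
  -- These operations commute with reduction modulo `2 ^ w`, so no bound on the operands is
  -- required.
  | .add, _, _ | .mul, _, _ | .and, _, _ | .or, _, _ | .xor, _, _ => True
  | .sub, x, y => y ≤ x ∧ x < 2 ^ w
  | .shl, _, y => y < 2 ^ w
  | .div, x, y | .mod, x, y | .shr, x, y | .lt, x, y | .eq, x, y => x < 2 ^ w ∧ y < 2 ^ w

theorem BinOp.eval_ofNat {w : ℕ} (o : BinOp) {x y : ℕ} (h : o.Safe w x y) :
    o.eval (BitVec.ofNat w x) (BitVec.ofNat w y) = BitVec.ofNat w (o.natEval x y) := by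
  cases o <;> simp only [BinOp.Safe] at h <;> simp only [BinOp.eval, BinOp.natEval]
  case add => rw [BitVec.ofNat_add]
  case mul => rw [BitVec.ofNat_mul]
  case and => rw [BitVec.ofNat_and]
  case or => rw [BitVec.ofNat_or]
  case xor => rw [BitVec.ofNat_xor]
  case sub =>
    apply BitVec.eq_of_toNat_eq
    have hx := h.2
    have hy := h.1.trans_lt h.2
    have : x - y < 2 ^ w := by omega
    simp only [BitVec.toNat_sub, BitVec.toNat_ofNat, Nat.mod_eq_of_lt hx, Nat.mod_eq_of_lt hy,
      Nat.mod_eq_of_lt this]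
    rw [show 2 ^ w - y + x = x - y + 2 ^ w by omega, Nat.add_mod_right, Nat.mod_eq_of_lt this]
  case div =>
    apply BitVec.eq_of_toNat_eq
    have : x / y < 2 ^ w := (Nat.div_le_self x y).trans_lt h.1
    simp [Nat.mod_eq_of_lt h.1, Nat.mod_eq_of_lt h.2, Nat.mod_eq_of_lt this]
  case mod =>
    apply BitVec.eq_of_toNat_eq
    have : x % y < 2 ^ w := (Nat.mod_le x y).trans_lt h.1
    simp [Nat.mod_eq_of_lt h.1, Nat.mod_eq_of_lt h.2, Nat.mod_eq_of_lt this]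
  case shl =>
    apply BitVec.eq_of_toNat_eq
    simp only [BitVec.toNat_shiftLeft, BitVec.toNat_ofNat, Nat.mod_eq_of_lt h, Nat.shiftLeft_eq]
    exact Nat.mod_mul_mod x _ _
  case shr =>
    apply BitVec.eq_of_toNat_eq
    have : x >>> y < 2 ^ w := by
      rw [Nat.shiftRight_eq_div_pow]; exact (Nat.div_le_self _ _).trans_lt h.1
    simp [Nat.mod_eq_of_lt h.1, Nat.mod_eq_of_lt h.2, Nat.mod_eq_of_lt this]
  case lt =>
    have : BitVec.ofNat w x < BitVec.ofNat w y ↔ x < y := by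
      simp [BitVec.lt_def, Nat.mod_eq_of_lt h.1, Nat.mod_eq_of_lt h.2]
    simp only [this]
    split_ifs <;> rfl
  case eq =>
    have : BitVec.ofNat w x = BitVec.ofNat w y ↔ x = y := by
      rw [← BitVec.toNat_inj]
      simp [Nat.mod_eq_of_lt h.1, Nat.mod_eq_of_lt h.2]
    simp only [this]
    split_ifs <;> rfl

/-- A sufficient condition for the program to halt, with a running time and a final state that
satisfy `Q`. -/
def wp (w : ℕ) : Prog → (ℕ → NState → Prop) → NState → Prop
  | .skip, Q, s => Q 1 s
  | .const r k, Q, s => Q 1 (s.setReg r k)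
  | .op o r a b, Q, s =>
      o.Safe w (s.reg a) (s.reg b) ∧ Q 1 (s.setReg r (o.natEval (s.reg a) (s.reg b)))
  | .load r a, Q, s => s.reg a < 2 ^ w ∧ Q 1 (s.setReg r (s.mem (s.reg a)))
  | .store a r, Q, s => s.reg a < 2 ^ w ∧ Q 1 (s.setMem (s.reg a) (s.reg r))
  | .seq p q, Q, s => wp w p (fun t s' => wp w q (fun t' s'' => Q (t + t') s'') s') s
  | .cond r p q, Q, s => s.reg r < 2 ^ w ∧ (s.reg r ≠ 0 → wp w p (fun t s' => Q (t + 1) s') s) ∧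
      (s.reg r = 0 → wp w q (fun t s' => Q (t + 1) s') s)
  -- Recursion on the program gives no formula for a loop, so the run itself is demanded here;
  -- `wp_loop` supplies it from an invariant.
  | .loop r p, Q, s => ∃ t s', Runs (.loop r p) (s.emb w) t (s'.emb w) ∧ Q t s'

theorem wp_seq {w : ℕ} {p q : Prog} {Q : ℕ → NState → Prop} {s : NState} :
    wp w (.seq p q) Q s ↔
      wp w p (fun t s' => wp w q (fun t' s'' => Q (t + t') s'') s') s := Iff.rfl

theorem wp_const {w r k : ℕ} {Q : ℕ → NState → Prop} {s : NState} :
    wp w (.const r k) Q s ↔ Q 1 (s.setReg r k) := Iff.rfl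

theorem wp_op {w r a b : ℕ} {o : BinOp} {Q : ℕ → NState → Prop} {s : NState} :
    wp w (.op o r a b) Q s ↔
      o.Safe w (s.reg a) (s.reg b) ∧ Q 1 (s.setReg r (o.natEval (s.reg a) (s.reg b))) := Iff.rfl

theorem wp_load {w r a : ℕ} {Q : ℕ → NState → Prop} {s : NState} :
    wp w (.load r a) Q s ↔ s.reg a < 2 ^ w ∧ Q 1 (s.setReg r (s.mem (s.reg a))) := Iff.rfl

theorem emb_reg_eq_zero {w : ℕ} {s : NState} {r : ℕ} (h : s.reg r < 2 ^ w) :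
    (s.emb w).reg r = 0 ↔ s.reg r = 0 := by
  rw [← BitVec.toNat_inj]
  simp [NState.emb, Nat.mod_eq_of_lt h]

theorem exists_runs_of_wp {w : ℕ} {p : Prog} {Q : ℕ → NState → Prop} {s : NState}
    (h : wp w p Q s) : ∃ t s', Runs p (s.emb w) t (s'.emb w) ∧ Q t s' := by
  induction p generalizing Q s with
  | skip => exact ⟨1, s, .skip _, h⟩
  | const r k => exact ⟨1, _, by rw [NState.emb_setReg]; exact .const r k _, h⟩
  | op o r a b =>
    refine ⟨1, _, ?_, h.2⟩
    rw [NState.emb_setReg, ← BinOp.eval_ofNat o h.1]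
    exact .op o r a b _
  | load r a =>
    refine ⟨1, _, ?_, h.2⟩
    have : BitVec.ofNat w (s.mem (s.reg a)) = (s.emb w).mem ((s.emb w).reg a) := by
      simp [NState.emb, Nat.mod_eq_of_lt h.1]
    rw [NState.emb_setReg, this]
    exact .load r a _
  | store a r =>
    refine ⟨1, _, ?_, h.2⟩
    rw [NState.emb_setMem _ _ h.1]
    exact .store a r _
  | seq p q ihp ihq =>
    obtain ⟨t, s', h₁, h⟩ := ihp h
    obtain ⟨t', s'', h₂, h⟩ := ihq h
    exact ⟨_, _, .seq h₁ h₂, h⟩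
  | cond r p q ihp ihq =>
    obtain ⟨h0, h1, h2⟩ := h
    by_cases hr : s.reg r = 0
    · obtain ⟨t, s', h₁, h⟩ := ihq (h2 hr)
      exact ⟨_, _, .cond_false ((emb_reg_eq_zero h0).2 hr) h₁, h⟩
    · obtain ⟨t, s', h₁, h⟩ := ihp (h1 hr)
      exact ⟨_, _, .cond_true (fun h' => hr ((emb_reg_eq_zero h0).1 h')) h₁, h⟩
  | loop r p => exact h

theorem wp_mono {w : ℕ} {p : Prog} {Q Q' : ℕ → NState → Prop} {s : NState} (h : wp w p Q s)
    (hQ : ∀ t s', Q t s' → Q' t s') : wp w p Q' s := by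
  induction p generalizing Q Q' s with
  | skip | const => exact hQ _ _ h
  | op | load | store => exact ⟨h.1, hQ _ _ h.2⟩
  | seq p q ihp ihq => exact ihp h fun t s' h => ihq h fun t' s'' h => hQ _ _ h
  | cond r p q ihp ihq =>
    exact ⟨h.1, fun hr => ihp (h.2.1 hr) fun t s' h => hQ _ _ h,
      fun hr => ihq (h.2.2 hr) fun t s' h => hQ _ _ h⟩
  | loop r p =>
    obtain ⟨t, s', h₁, h⟩ := h
    exact ⟨t, s', h₁, hQ _ _ h⟩

/-- The loop rule, with a variant. -/
theorem wp_loop {w : ℕ} {r : ℕ} {p : Prog} {Q : ℕ → NState → Prop} {s : NState} {C n : ℕ}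
    (I : ℕ → NState → Prop) (hI : I 0 s) (hlt : ∀ j s, I j s → s.reg r < 2 ^ w)
    (hn : ∀ j s, I j s → (s.reg r ≠ 0 ↔ j < n))
    (hstep : ∀ j s, j < n → I j s → wp w p (fun t s' => t ≤ C ∧ I (j + 1) s') s)
    (hQ : ∀ t s', t ≤ n * (C + 1) + 1 → I n s' → Q t s') : wp w (.loop r p) Q s := by
  have key : ∀ m j s, j + m = n → I j s →
      ∃ t s', Runs (.loop r p) (s.emb w) t (s'.emb w) ∧ t ≤ m * (C + 1) + 1 ∧ I n s' := by
    intro m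
    induction m with
    | zero =>
      intro j s hj hI
      obtain rfl : j = n := by omega
      have h0 : s.reg r = 0 := by
        by_contra h0
        have := (hn j s hI).1 h0
        omega
      exact ⟨1, s, Runs.loop_stop ((emb_reg_eq_zero (hlt j s hI)).2 h0), by omega, hI⟩
    | succ m ih =>
      intro j s hj hI
      have h0 : s.reg r ≠ 0 := (hn j s hI).2 (by omega)
      obtain ⟨t, s', h₁, ht, hI'⟩ := exists_runs_of_wp (hstep j s (by omega) hI)
      obtain ⟨t', s'', h₂, ht', hI''⟩ := ih (j + 1) s' (by omega) hI'
      refine ⟨_, s'', .loop_step (fun h' => h0 ((emb_reg_eq_zero (hlt j s hI)).1 h')) h₁ h₂, ?_,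
        hI''⟩
      have : (m + 1) * (C + 1) = m * (C + 1) + (C + 1) := by ring
      omega
  obtain ⟨t, s', h₁, ht, h⟩ := key n 0 s (by omega) hI
  exact ⟨t, s', h₁, hQ t s' ht h⟩

/-- The loop over all `i` from `0` to `reg n - 1`. The register `1` has to hold the number `1`. -/
def Prog.for (i c n : ℕ) (p : Prog) : Prog :=
  .seq (.const i 0) (.seq (.op .lt c i n)
    (.loop c (.seq p (.seq (.op .add i i 1) (.op .lt c i n)))))

/-- The invariant must survive writes to the counter and the test register, which the loop itself
makes. Each round costs three steps on top of the body: increment, comparison and test. -/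
theorem wp_for {w i c b : ℕ} {p : Prog} {Q : ℕ → NState → Prop} {s : NState} {C n : ℕ}
    (I : ℕ → NState → Prop) (hn : n < 2 ^ w) (hic : i ≠ c) (hib : i ≠ b)
    (hI : I 0 s)
    (hfix : ∀ j s, I j s → s.reg b = n ∧ s.reg 1 = 1)
    (hset : ∀ j s, I j s → ∀ x, I j (s.setReg i x) ∧ I j (s.setReg c x))
    (hstep : ∀ j s, j < n → s.reg i = j → I j s →
      wp w p (fun t s' => t ≤ C ∧ s'.reg i = j ∧ I (j + 1) s') s)
    (hQ : ∀ t s', t ≤ n * (C + 3) + 3 → I n s' → Q t s') : wp w (Prog.for i c b p) Q s := by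
  have hw : 1 < 2 ^ w ∨ n = 0 := by omega
  have h0 := hset 0 _ (hset 0 _ hI 0).1 (if 0 < n then 1 else 0)
  have hb := (hfix 0 _ hI).1
  refine ⟨⟨by simp, by simp [hib.symm, hb, hn]⟩, ?_⟩
  refine wp_loop (C := C + 2) (n := n)
    (fun j s => s.reg i = j ∧ s.reg c = (if j < n then 1 else 0) ∧ I j s) ?_ ?_ ?_ ?_ ?_
  · simp only [BinOp.natEval, NState.reg_setReg, hib.symm, hb, if_true, if_false, hic]
    exact ⟨trivial, trivial, h0.2⟩
  · rintro j s ⟨-, h, -⟩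
    rw [h]; split_ifs <;> omega
  · rintro j s ⟨-, h, -⟩
    rw [h]; split_ifs <;> simp_all
  · rintro j s hj ⟨h1, h2, h3⟩
    change wp w p _ s
    refine wp_mono (hstep j s hj h1 h3) ?_
    rintro t s' ⟨ht, h4, h5⟩
    obtain ⟨h6, h7⟩ := hfix _ _ h5
    have h8 := hset _ _ (hset _ _ h5 (j + 1)).1 (if j + 1 < n then 1 else 0)
    refine ⟨trivial, ⟨by simp [BinOp.natEval, h4, h7]; omega, by simp [hib.symm, h6, hn]⟩,
      by omega, ?_⟩
    simp only [BinOp.natEval, NState.reg_setReg, hib.symm, h6, h7, h4, if_true, if_false, hic]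
    exact ⟨trivial, trivial, h8.2⟩
  · rintro t s' ht ⟨-, -, h⟩
    exact hQ _ _ (by rw [show n * (C + 3) = n * (C + 2 + 1) by ring]; omega) h

end WordRAM

/-! ## Programs that write a list of vertices -/

namespace WordRAM

variable {w d H T T' θ : ℕ} {F : ℕ → ℕ} {s s' : NState} {p q : Prog} {l l' out : List ℕ}

/-- The memory with the list `out` at address `0` and a second block `F` at address `H`. -/
def memOf (H : ℕ) (F : ℕ → ℕ) (out : List ℕ) (a : ℕ) : ℕ :=
  if a < H then out.getD a 0 else F (a - H)

/-- The registers below `θ`, and those that no program below uses, agree. -/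
def Agree (θ : ℕ) (s s' : NState) : Prop := ∀ r, r < θ ∨ 40 ≤ r → s'.reg r = s.reg r

theorem Agree.refl (θ : ℕ) (s : NState) : Agree θ s s := fun _ _ => rfl

theorem Agree.trans {s'' : NState} (h : Agree θ s s') (h' : Agree θ s' s'') : Agree θ s s'' :=
  fun r hr => (h' r hr).trans (h r hr)

theorem Agree.mono {θ' : ℕ} (h : Agree θ' s s') (hθ : θ ≤ θ') : Agree θ s s' :=
  fun r hr => h r (hr.imp_left fun hr => hr.trans_le hθ)

theorem Agree.setReg (h : Agree θ s s') {r : ℕ} (hr : θ ≤ r ∧ r < 40) (x : ℕ) :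
    Agree θ s (s'.setReg r x) := fun r' hr' => by
  rw [NState.reg_setReg, if_neg (by omega), h r' hr']

/-- The list `out` has been written; the register `39` points to its end. -/
def Writing (H : ℕ) (F : ℕ → ℕ) (out : List ℕ) (s : NState) : Prop :=
  s.mem = memOf H F out ∧ s.reg 39 = out.length

theorem Writing.setReg (h : Writing H F out s) {r : ℕ} (hr : r ≠ 39) (x : ℕ) :
    Writing H F out (s.setReg r x) := ⟨h.1, by simpa [hr.symm] using h.2⟩

/-- Started in the state `s`, the program appends `l` to the list written so far, if there is
room for it. -/
def Emits (w H : ℕ) (F : ℕ → ℕ) (θ : ℕ) (p : Prog) (l : List ℕ) (T : ℕ) (s : NState) : Prop :=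
  ∀ out, Writing H F out s → out.length + l.length ≤ H →
    wp w p (fun t s' => t ≤ T ∧ Writing H F (out ++ l) s' ∧ Agree θ s s') s

theorem Emits.mono {θ' : ℕ} (h : Emits w H F θ' p l T s) (hθ : θ ≤ θ') (hT : T ≤ T') :
    Emits w H F θ p l T' s := fun out h₁ h₂ =>
  wp_mono (h out h₁ h₂) fun _ _ h => ⟨h.1.trans hT, h.2.1, h.2.2.mono hθ⟩

theorem Emits.skip : Emits w H F θ .skip [] 1 s := fun out h₁ _ =>
  ⟨le_rfl, by simpa using h₁, .refl _ _⟩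

theorem Emits.seq (h : Emits w H F θ p l T s)
    (h' : ∀ s', Agree θ s s' → Emits w H F θ q l' T' s') :
    Emits w H F θ (.seq p q) (l ++ l') (T + T') s := by
  intro out h₁ h₂
  rw [List.length_append] at h₂
  refine wp_mono (p := p) (h out h₁ (by omega)) ?_
  rintro t s₁ ⟨ht, h₃, h₄⟩
  refine wp_mono (h' s₁ h₄ _ h₃ (by rw [List.length_append]; omega)) ?_
  rintro t' s₂ ⟨ht', h₅, h₆⟩
  exact ⟨by omega, by rwa [← List.append_assoc], h₄.trans h₆⟩

theorem Emits.op_seq {o : BinOp} {r a b : ℕ} (hs : o.Safe w (s.reg a) (s.reg b))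
    (hr : θ ≤ r ∧ r < 39)
    (h : Emits w H F θ q l T (s.setReg r (o.natEval (s.reg a) (s.reg b)))) :
    Emits w H F θ (.seq (.op o r a b) q) l (T + 1) s := by
  intro out h₁ h₂
  refine ⟨hs, wp_mono (h out (h₁.setReg (by omega) _) h₂) ?_⟩
  rintro t s₁ ⟨ht, h₃, h₄⟩
  exact ⟨by omega, h₃, ((Agree.refl θ s).setReg ⟨hr.1, by omega⟩ _).trans h₄⟩

theorem Emits.const_seq {r k : ℕ} (hr : θ ≤ r ∧ r < 39) (h : Emits w H F θ q l T (s.setReg r k)) :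
    Emits w H F θ (.seq (.const r k) q) l (T + 1) s := by
  intro out h₁ h₂
  refine wp_mono (p := q) (h out (h₁.setReg (by omega) _) h₂) ?_
  rintro t s₁ ⟨ht, h₃, h₄⟩
  exact ⟨by omega, h₃, ((Agree.refl θ s).setReg ⟨hr.1, by omega⟩ _).trans h₄⟩

theorem length_flatMap_range_mono {α : Type*} (f : ℕ → List α) {j n : ℕ} (hj : j ≤ n) :
    ((List.range j).flatMap f).length ≤ ((List.range n).flatMap f).length := by
  obtain ⟨m, rfl⟩ := Nat.exists_eq_add_of_le hj
  rw [List.range_add, List.flatMap_append, List.length_append]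
  omega

/-- The bound `θ` acts like a stack level: the loop bound and the constant `1` live below it, the
counter and the test register at or above it, and the body works at level `i + 1`, so that it
preserves the counter. -/
theorem Emits.for {i c b n : ℕ} {f : ℕ → List ℕ} (hn : n < 2 ^ w) (hb : s.reg b = n)
    (h1 : s.reg 1 = 1) (hi : θ ≤ i) (hc : θ ≤ c) (hic : i ≠ c) (hi40 : i < 39) (hc40 : c < 39)
    (hbθ : b < θ) (h1θ : 1 < θ)
    (hbody : ∀ j s', j < n → s'.reg i = j → Agree θ s s' → Emits w H F (i + 1) p (f j) T s') :
    Emits w H F θ (Prog.for i c b p) ((List.range n).flatMap f) (n * (T + 3) + 3) s := by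
  intro out h₁ h₂
  refine wp_for (C := T) (n := n)
    (fun j s' => Writing H F (out ++ (List.range j).flatMap f) s' ∧ Agree θ s s')
    hn hic (by omega) ⟨by simpa using h₁, .refl _ _⟩ ?_ ?_ ?_ ?_
  · rintro j s' ⟨-, h⟩
    exact ⟨by rw [h b (.inl hbθ), hb], by rw [h 1 (.inl h1θ), h1]⟩
  · rintro j s' ⟨h, h'⟩ x
    exact ⟨⟨h.setReg (by omega) _, h'.setReg (by omega) _⟩,
      ⟨h.setReg (by omega) _, h'.setReg (by omega) _⟩⟩
  · rintro j s' hj hj' ⟨h, h'⟩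
    have h3 := length_flatMap_range_mono f (Nat.succ_le_of_lt hj)
    have h4 : (List.range (j + 1)).flatMap f = (List.range j).flatMap f ++ f j := by
      simp [List.range_succ]
    rw [Nat.succ_eq_add_one, h4, List.length_append] at h3
    refine wp_mono (hbody j s' hj hj' h' _ h (by rw [List.length_append]; omega)) ?_
    rintro t s'' ⟨ht, h5, h6⟩
    refine ⟨ht, by rw [h6 i (.inl (by omega)), hj'], by rwa [h4, ← List.append_assoc], ?_⟩
    exact h'.trans (h6.mono (by omega))
  · rintro t s' ht ⟨h, h'⟩
    exact ⟨ht, h, h'⟩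

/-- The coordinates of a vertex of a planar curve in dimension `d`. -/
def coords (d : ℕ) (q : ℕ × ℕ) : List ℕ := q.1 :: q.2 :: List.replicate (d - 2) 0

theorem length_coords (hd : 2 ≤ d) (q : ℕ × ℕ) : (coords d q).length = d := by
  simp [coords]; omega

/-- Two writes suffice for a vertex in any dimension, because the cells after `out` and below `H`
already hold the zeros of the remaining coordinates. -/
theorem memOf_coords (q : ℕ × ℕ) (h : out.length + 2 ≤ H) :
    Function.update (Function.update (memOf H F out) out.length q.1) (out.length + 1) q.2 =
      memOf H F (out ++ coords d q) := by
  funext a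
  simp only [memOf, Function.update_apply]
  rcases lt_trichotomy a out.length with h' | rfl | h'
  · rw [if_neg (by omega), if_neg (by omega), List.getD_append _ _ _ _ h']
  · rw [if_neg (by omega), if_pos rfl, if_pos (by omega), List.getD_append_right _ _ _ _ le_rfl]
    simp [coords]
  · rw [List.getD_append_right _ _ _ _ h'.le]
    obtain ⟨b, rfl⟩ := Nat.exists_eq_add_of_lt h'
    rw [show out.length + b + 1 - out.length = b + 1 by omega,
      List.getD_eq_default out _ (by omega)]
    cases b with
    | zero => simp [coords]; omega
    | succ b =>
      rw [if_neg (by omega), if_neg (by omega)]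
      congr 1
      simp only [coords, List.getD_eq_getElem?_getD, List.getElem?_cons_succ, List.getElem?_replicate]
      split_ifs <;> rfl

/-- Append the vertex `(reg 16 + x, reg 27 + reg 27 + y)`. -/
def emitShifted (x y : ℕ) : Prog :=
  .seq (.const 26 x) (.seq (.op .add 26 16 26) (.seq (.store 39 26) (.seq (.op .add 39 39 1)
    (.seq (.const 26 y) (.seq (.op .add 26 26 27) (.seq (.op .add 26 26 27) (.seq (.store 39 26)
      -- Register `9` holds `d - 1`; with the increment after the first coordinate the pointer
      -- advances by `d`.
      (.op .add 39 39 9))))))))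

theorem emits_emitShifted (hd : 2 ≤ d) (hH : H ≤ 2 ^ w) (h1 : s.reg 1 = 1)
    (h9 : s.reg 9 = d - 1) (x y : ℕ) :
    Emits w H F 26 (emitShifted x y) (coords d (s.reg 16 + x, y + s.reg 27 + s.reg 27)) 9 s := by
  intro out ⟨h₁, h₂⟩ h₃
  rw [length_coords hd] at h₃
  simp only [emitShifted, wp, BinOp.Safe, BinOp.natEval, NState.reg_setReg, NState.reg_setMem, h₂,
    h1, h9, true_and]
  simp only [Nat.reduceEqDiff, if_true, if_false, h₂, NState.reg_setReg,
    NState.reg_setMem, Writing, NState.mem_setReg, NState.mem_setMem, h₁]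
  refine ⟨by omega, by omega, by norm_num, ⟨?_, ?_⟩, ?_⟩
  · exact memOf_coords (_, _) (by omega)
  · rw [List.length_append, length_coords hd]; omega
  · intro r hr
    simp only [NState.reg_setReg, NState.reg_setMem]
    simp only [show r ≠ 39 by omega, show r ≠ 26 by omega, if_false]

/-- Append the vertices in the list, shifted by `reg 16` in the first coordinate. -/
def emitList : List (ℕ × ℕ) → Prog
  | [] => .skip
  | q :: l => .seq (.seq (.const 27 0) (emitShifted q.1 q.2)) (emitList l)

theorem emits_emitList (hd : 2 ≤ d) (hH : H ≤ 2 ^ w) (h1 : s.reg 1 = 1)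
    (h9 : s.reg 9 = d - 1) (l : List (ℕ × ℕ)) :
    Emits w H F 26 (emitList l) (l.flatMap fun q => coords d (s.reg 16 + q.1, q.2))
      (10 * l.length + 1) s := by
  induction l generalizing s with
  | nil => exact Emits.skip
  | cons q l ih =>
    refine Emits.mono (T := (9 + 1) + (10 * l.length + 1)) (θ' := 26) ?_ le_rfl
      (by simp; omega)
    refine Emits.seq (Emits.const_seq (by omega) ?_) fun s' hs' => ?_
    · have := emits_emitShifted (F := F) hd hH (s := s.setReg 27 0) (by simp [h1]) (by simp [h9])
        q.1 q.2
      simpa using this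
    · have := ih (s := s') (by rw [hs' 1 (by omega), h1]) (by rw [hs' 9 (by omega), h9])
      rwa [hs' 16 (by omega)] at this

end WordRAM

namespace WordRAM

variable {w d H T T' θ : ℕ} {F : ℕ → ℕ} {s s' : NState} {p q : Prog} {l l' out : List ℕ}

/-! ## The program that writes the curves -/

/-- The variables `lo, …, lo + cnt - 1`, with the values given by the binary digits of `X`, do not
satisfy the clause `c` of the encoded formula `F` in `N` variables. -/
def Unsat (F : ℕ → ℕ) (N lo cnt X c : ℕ) : Prop :=
  -- A literal has two adjacent cells, for the positive and then the negative occurrence.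
  -- Subtracting the digit from the second address selects the occurrence that the digit would
  -- satisfy.
  ∀ j < cnt, F (2 + 2 * (c * N + (lo + j)) + 1 - (X.testBit (lo + j)).toNat) = 0

/-- The body of the test of a clause. -/
def testLiteral : Prog :=
  .seq (.op .add 28 5 24) (.seq (.op .shr 27 19 28) (.seq (.op .and 27 27 1)
    (.seq (.op .mul 29 20 2) (.seq (.op .add 28 29 28) (.seq (.op .add 28 28 28)
    (.seq (.op .add 28 4 28) (.seq (.op .add 28 28 1) (.seq (.op .sub 28 28 27)
    (.seq (.load 29 28) (.seq (.const 27 0) (.seq (.op .eq 29 29 27)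
    (.op .and 23 23 29))))))))))))

open Classical in
theorem wp_testLiteral {N c lo X j : ℕ} {P : Prop} (h1 : s.reg 1 = 1) (h2 : s.reg 2 = N)
    (h4 : s.reg 4 = H + 2) (h5 : s.reg 5 = lo) (h19 : s.reg 19 = X) (h20 : s.reg 20 = c)
    (h24 : s.reg 24 = j) (h23 : s.reg 23 = if P then 1 else 0) (hX : X < 2 ^ w)
    (hF : ∀ a, F a < 2 ^ w) (hw : H + 2 + 2 * (c * N + (lo + j)) + 1 < 2 ^ w)
    (hmem : s.mem = memOf H F out) :
    wp w testLiteral (fun t s' => t ≤ 13 ∧ s'.mem = s.mem ∧ s'.reg 39 = s.reg 39 ∧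
      (∀ r, r < 23 ∨ r = 24 ∨ 40 ≤ r → s'.reg r = s.reg r) ∧
      s'.reg 23 = if P ∧ F (2 + 2 * (c * N + (lo + j)) + 1 - (X.testBit (lo + j)).toNat) = 0
        then 1 else 0) s := by
  have hb := toNat_cases (X.testBit (lo + j))
  have hbit : (X >>> (lo + j)) &&& 1 = (X.testBit (lo + j)).toNat := by
    rw [Nat.toNat_testBit, Nat.and_one_is_mod, Nat.shiftRight_eq_div_pow]
  simp only [testLiteral, wp, BinOp.Safe, BinOp.natEval, NState.reg_setReg, Nat.reduceEqDiff,
    if_true, if_false, h1, h2, h4, h5, h19, h20, h24, h23, hbit, true_and, NState.mem_setReg,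
    hmem]
  set u := c * N + (lo + j) with hu
  set e := (X.testBit (lo + j)).toNat with he
  have haddr : H + 2 + (u + u) + 1 - e = H + (2 + 2 * u + 1 - e) := by omega
  have hval : memOf H F out (H + 2 + (u + u) + 1 - e) = F (2 + 2 * u + 1 - e) := by
    rw [haddr, memOf, if_neg (by omega), Nat.add_sub_cancel_left]
  rw [hval]
  refine ⟨⟨hX, by omega⟩, ⟨by omega, by omega⟩, by omega, ⟨hF _, by omega⟩, by norm_num, ?_, ?_⟩
  · intro r hr
    simp only [show r ≠ 23 by omega, show r ≠ 27 by omega, show r ≠ 28 by omega,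
      show r ≠ 29 by omega, if_false]
  · by_cases h : P <;> by_cases h' : F (2 + 2 * u + 1 - e) = 0 <;> simp [h, h']

/-- Test whether the clause `reg 20` is not satisfied. -/
def testClause : Prog := .seq (.const 23 1) (Prog.for 24 25 6 testLiteral)

open Classical in
theorem wp_testClause {N c lo cnt X : ℕ} (h1 : s.reg 1 = 1) (h2 : s.reg 2 = N)
    (h4 : s.reg 4 = H + 2) (h5 : s.reg 5 = lo) (h6 : s.reg 6 = cnt) (h19 : s.reg 19 = X)
    (h20 : s.reg 20 = c) (hX : X < 2 ^ w)
    (hF : ∀ a, F a < 2 ^ w) (hw : H + 2 + 2 * (c * N + (lo + cnt)) + 1 < 2 ^ w)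
    (hmem : s.mem = memOf H F out) :
    wp w testClause (fun t s' => t ≤ 16 * cnt + 4 ∧ s'.mem = s.mem ∧ s'.reg 39 = s.reg 39 ∧
      Agree 23 s s' ∧ s'.reg 23 = if Unsat F N lo cnt X c then 1 else 0) s := by
  rw [testClause, wp_seq, wp_const]
  refine wp_for (C := 13) (n := cnt) (fun j s' => s'.mem = s.mem ∧ s'.reg 39 = s.reg 39 ∧
    Agree 23 s s' ∧ s'.reg 23 = if Unsat F N lo j X c then 1 else 0) (by omega) (by norm_num)
    (by norm_num) ?_ ?_ ?_ ?_ ?_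
  · exact ⟨rfl, by simp, (Agree.refl _ _).setReg (by norm_num) _, by simp [Unsat]⟩
  · rintro j s' ⟨-, -, h, -⟩
    exact ⟨by rw [h 6 (by omega), h6], by rw [h 1 (by omega), h1]⟩
  · rintro j s' ⟨h, h', h'', h3⟩ x
    exact ⟨⟨h, by simpa using h', h''.setReg (by norm_num) _, by simpa using h3⟩,
      ⟨h, by simpa using h', h''.setReg (by norm_num) _, by simpa using h3⟩⟩
  · rintro j s' hj hj' ⟨h, h', h'', h3⟩
    have h0 : ∀ r < 23, s'.reg r = s.reg r := fun r hr => h'' r (.inl hr)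
    refine wp_mono (wp_testLiteral (out := out) (F := F) (H := H) (X := X) (N := N) (c := c)
      (lo := lo) (j := j) (P := Unsat F N lo j X c)
      (by rw [h0 _ (by norm_num), h1]) (by rw [h0 _ (by norm_num), h2])
      (by rw [h0 _ (by norm_num), h4]) (by rw [h0 _ (by norm_num), h5])
      (by rw [h0 _ (by norm_num), h19]) (by rw [h0 _ (by norm_num), h20]) hj' h3 hX hF (by omega)
      (by rw [h, hmem])) ?_
    rintro t s'' ⟨ht, h4, h5, h6, h7⟩
    refine ⟨ht, by rw [h6 _ (by omega), hj'], by rw [h4, h], by rw [h5, h'], fun r hr => ?_, ?_⟩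
    · rw [h6 r (by omega), h'' r hr]
    · rw [h7]
      refine if_congr ?_ rfl rfl
      rw [Unsat, Unsat, Nat.forall_lt_succ_right]
  · rintro t s' ht ⟨h, h', h'', h3⟩
    exact ⟨by omega, h, h', h'', h3⟩

/-- The data by which the programs for the two curves differ: fixed vertices of a location and
of a vector, and the heights in the part for a clause. -/
structure Layout where
  pre : List (ℕ × ℕ)
  vpre : List (ℕ × ℕ)
  right : ℕ
  mid : ℕ
  left : ℕ
  vpost : List (ℕ × ℕ)
  post : List (ℕ × ℕ)

namespace Layout

variable (L : Layout)

/-- The vertices for a clause, depending on a digit. -/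
def clauseList (b : ℕ) : List (ℕ × ℕ) :=
  [(57, L.right + b + b), (30, L.mid), (3, L.left), (30, L.mid)]

def emitClause : Prog :=
  .seq testClause (.seq (.op .eq 27 23 8) (.seq (emitShifted 57 L.right)
    (emitList [(30, L.mid), (3, L.left), (30, L.mid)])))

def emitVector : Prog :=
  .seq (emitList L.vpre) (.seq (Prog.for 20 21 3 L.emitClause) (emitList L.vpost))

def emitLocation : Prog :=
  .seq (emitList L.pre) (.seq (Prog.for 17 18 12 (.seq (.op .mul 19 14 12)
    (.seq (.op .add 19 19 17) (.seq (.op .mul 19 19 7) L.emitVector)))) (emitList L.post))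

def emitLocations : Prog :=
  Prog.for 14 15 13 (.seq (.const 16 140) (.seq (.op .mul 16 16 14) L.emitLocation))

/-- The part of the curve for a vector, translated by `x`. -/
def vectorList (M x : ℕ) (bit : ℕ → ℕ) : List (ℕ × ℕ) :=
  (L.vpre ++ ((List.range M).flatMap fun c => L.clauseList (bit c)) ++ L.vpost).map
    fun q => (x + q.1, q.2)

def locationList (S M x : ℕ) (bit : ℕ → ℕ → ℕ) : List (ℕ × ℕ) :=
  L.pre.map (fun q => (x + q.1, q.2)) ++
    ((List.range S).flatMap fun i => L.vectorList M x (bit i)) ++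
      L.post.map fun q => (x + q.1, q.2)

def locationsList (K S M : ℕ) (bit : ℕ → ℕ → ℕ → ℕ) : List (ℕ × ℕ) :=
  (List.range K).flatMap fun k => L.locationList S M (140 * k) (bit k)

end Layout

/-- The parameters of a run of the program that writes a curve. -/
structure Setting where
  N : ℕ
  M : ℕ
  lo : ℕ
  cnt : ℕ
  -- The digits tested for vector `i` at location `k` are those of `(k * S + i) * step`; the value
  -- `step = S` moves them past the low variables.
  step : ℕ
  flag : ℕ
  S : ℕ
  K : ℕ

/-- The registers hold the parameters, and the numbers that occur are words. -/
structure Setting.Holds (E : Setting) (w d H : ℕ) (F : ℕ → ℕ) (s : NState) : Prop where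
  r1 : s.reg 1 = 1
  r2 : s.reg 2 = E.N
  r3 : s.reg 3 = E.M
  r4 : s.reg 4 = H + 2
  r5 : s.reg 5 = E.lo
  r6 : s.reg 6 = E.cnt
  r7 : s.reg 7 = E.step
  r8 : s.reg 8 = E.flag
  r9 : s.reg 9 = d - 1
  r12 : s.reg 12 = E.S
  r13 : s.reg 13 = E.K
  hd : 2 ≤ d
  hN : E.lo + E.cnt ≤ E.N
  hflag : E.flag < 2
  hS : E.S < 2 ^ w
  hK : E.K < 2 ^ w
  hX : E.K * E.S * E.step < 2 ^ w
  hH : H ≤ 2 ^ w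
  hF : ∀ a, F a < 2 ^ w
  haddr : H + 2 + 2 * (E.M * E.N) + 1 < 2 ^ w

theorem Setting.Holds.of_agree {E : Setting} (h : E.Holds w d H F s) (h' : Agree θ s s')
    (hθ : 14 ≤ θ) : E.Holds w d H F s' := by
  have h0 : ∀ r < 14, s'.reg r = s.reg r := fun r hr => h' r (.inl (by omega))
  constructor
  all_goals first
    | (rw [h0 _ (by norm_num)]; first
        | exact h.r1 | exact h.r2 | exact h.r3 | exact h.r4 | exact h.r5 | exact h.r6
        | exact h.r7 | exact h.r8 | exact h.r9 | exact h.r12 | exact h.r13)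
    | exact h.hd | exact h.hN | exact h.hflag | exact h.hS | exact h.hK | exact h.hX
    | exact h.hH | exact h.hF | exact h.haddr

/-- The digit that encodes whether the clause `c` is satisfied. -/
noncomputable def Setting.bit (E : Setting) (F : ℕ → ℕ) (k i c : ℕ) : ℕ :=
  open Classical in
  if (if Unsat F E.N E.lo E.cnt ((k * E.S + i) * E.step) c then 1 else 0) = E.flag then 1 else 0

namespace Layout

variable {L : Layout} {E : Setting}

theorem emits_emitList_of_holds (h : E.Holds w d H F s) (l : List (ℕ × ℕ)) {x : ℕ}
    (hx : s.reg 16 = x) :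
    Emits w H F 26 (emitList l) ((l.map fun q => (x + q.1, q.2)).flatMap (coords d))
      (10 * l.length + 1) s := by
  rw [List.flatMap_map]
  have := emits_emitList (F := F) h.hd h.hH h.r1 h.r9 l
  rwa [hx] at this

theorem emits_emitClause (h : E.Holds w d H F s) {k i c x : ℕ} (hc : c < E.M) (hk : k < E.K)
    (hi : i < E.S)
    (h19 : s.reg 19 = (k * E.S + i) * E.step) (h20 : s.reg 20 = c) (h16 : s.reg 16 = x) :
    Emits w H F 23 L.emitClause
      (((L.clauseList (E.bit F k i c)).map fun q => (x + q.1, q.2)).flatMap (coords d))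
      (16 * E.N + 60) s := by
  classical
  intro out h₁ h₂
  have hN := h.hN
  have h1 : c * E.N + E.N ≤ E.M * E.N := by nlinarith
  have hX : (k * E.S + i) * E.step < 2 ^ w := by
    refine lt_of_le_of_lt ?_ h.hX
    exact Nat.mul_le_mul_right _ (by nlinarith)
  have haddr := h.haddr
  have hflag := h.hflag
  rw [emitClause, wp_seq]
  refine wp_mono (wp_testClause h.r1 h.r2 h.r4 h.r5 h.r6 h19 h20 hX h.hF
    (by omega) h₁.1) ?_
  rintro t s₁ ⟨ht, h3, h4, h5, h6⟩
  have hw : 1 < 2 ^ w := by omega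
  have h8 : s₁.reg 8 = E.flag := by rw [h5 8 (by omega), h.r8]
  have key : Emits w H F 23 (.seq (.op .eq 27 23 8) (.seq (emitShifted 57 L.right)
    (emitList [(30, L.mid), (3, L.left), (30, L.mid)])))
      (((L.clauseList (E.bit F k i c)).map fun q => (x + q.1, q.2)).flatMap (coords d))
      (9 + (10 * 3 + 1) + 1) s₁ := by
    refine Emits.op_seq ?_ (by norm_num) ?_
    · exact ⟨by rw [h6]; split_ifs <;> omega, by rw [h8]; omega⟩
    · have hA : Agree 23 s (s₁.setReg 27 (BinOp.eq.natEval (s₁.reg 23) (s₁.reg 8))) :=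
        h5.setReg (by norm_num) _
      have hE := h.of_agree hA (by norm_num)
      have hb : BinOp.eq.natEval (s₁.reg 23) (s₁.reg 8) = E.bit F k i c := by
        rw [h6, h8, Setting.bit, BinOp.natEval]
      generalize hs₂ : s₁.setReg 27 (BinOp.eq.natEval (s₁.reg 23) (s₁.reg 8)) = s₂ at hA hE
      have h27 : s₂.reg 27 = E.bit F k i c := by rw [← hs₂, ← hb]; simp
      have h16' : s₂.reg 16 = x := by rw [hA 16 (by omega), h16]
      refine Emits.mono (θ' := 26) ?_ (by norm_num) le_rfl
      have := Emits.seq (l' := (([(30, L.mid), (3, L.left), (30, L.mid)]).map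
        fun q => (x + q.1, q.2)).flatMap (coords d))
        (emits_emitShifted (F := F) hE.hd hE.hH hE.r1 hE.r9 57 L.right) (fun s' hs' =>
          emits_emitList_of_holds (hE.of_agree hs' (by norm_num)) _
            (by rw [hs' 16 (by omega), h16']))
      rw [h27, h16'] at this
      exact this
  refine wp_mono (key out ⟨by rw [h3, h₁.1], by rw [h4, h₁.2]⟩ h₂) ?_
  rintro t' s₂ ⟨ht', h7, h8⟩
  exact ⟨by omega, h7, h5.trans h8⟩

theorem emits_emitVector (h : E.Holds w d H F s) {k i x : ℕ} (hk : k < E.K)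
    (hi : i < E.S) (hM : E.M < 2 ^ w)
    (h19 : s.reg 19 = (k * E.S + i) * E.step) (h16 : s.reg 16 = x) :
    Emits w H F 20 L.emitVector
      ((L.vectorList E.M x (E.bit F k i)).flatMap (coords d))
      (10 * L.vpre.length + 10 * L.vpost.length + E.M * (16 * E.N + 63) + 5) s := by
  have key : (L.vectorList E.M x (E.bit F k i)).flatMap (coords d) =
      (L.vpre.map fun q => (x + q.1, q.2)).flatMap (coords d) ++
      (((List.range E.M).flatMap fun c =>
        ((L.clauseList (E.bit F k i c)).map fun q => (x + q.1, q.2)).flatMap (coords d)) ++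
      (L.vpost.map fun q => (x + q.1, q.2)).flatMap (coords d)) := by
    simp only [vectorList, List.map_append, List.flatMap_append, List.map_flatMap,
      List.flatMap_assoc, List.append_assoc]
  rw [key]
  refine Emits.mono (T := (10 * L.vpre.length + 1) +
    ((E.M * (16 * E.N + 60 + 3) + 3) + (10 * L.vpost.length + 1))) (θ' := 20) ?_ le_rfl
    (le_of_eq (by ring))
  refine Emits.seq ((emits_emitList_of_holds h _ h16).mono (by norm_num) le_rfl) fun s₁ hs₁ => ?_
  have h₁ := h.of_agree hs₁ (by norm_num)
  refine Emits.seq (Emits.for hM h₁.r3 h₁.r1 (by norm_num) (by norm_num) (by norm_num)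
    (by norm_num) (by norm_num) (by norm_num) (by norm_num) fun c s' hc hs' hA => ?_)
    fun s₂ hs₂ => ?_
  · refine Emits.mono (emits_emitClause (h₁.of_agree hA (by norm_num)) hc hk hi ?_ hs' ?_)
      (by norm_num) le_rfl
    · rw [hA 19 (by omega), hs₁ 19 (by omega), h19]
    · rw [hA 16 (by omega), hs₁ 16 (by omega), h16]
  · refine (emits_emitList_of_holds (h₁.of_agree hs₂ (by norm_num)) _ ?_).mono (by norm_num) le_rfl
    rw [hs₂ 16 (by omega), hs₁ 16 (by omega), h16]

theorem emits_emitLocation (h : E.Holds w d H F s) {k x : ℕ} (hk : k < E.K)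
    (hM : E.M < 2 ^ w) (h14 : s.reg 14 = k) (h16 : s.reg 16 = x) :
    Emits w H F 17 L.emitLocation
      ((L.locationList E.S E.M x (E.bit F k)).flatMap (coords d))
      (10 * L.pre.length + 10 * L.post.length + E.S * (10 * L.vpre.length + 10 * L.vpost.length +
        E.M * (16 * E.N + 63) + 11) + 5) s := by
  have key : (L.locationList E.S E.M x (E.bit F k)).flatMap (coords d) =
      (L.pre.map fun q => (x + q.1, q.2)).flatMap (coords d) ++
      (((List.range E.S).flatMap fun i =>
        (L.vectorList E.M x (E.bit F k i)).flatMap (coords d)) ++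
      (L.post.map fun q => (x + q.1, q.2)).flatMap (coords d)) := by
    simp only [locationList, List.flatMap_append, List.flatMap_assoc, List.append_assoc]
  rw [key]
  refine Emits.mono (T := (10 * L.pre.length + 1) +
    ((E.S * ((10 * L.vpre.length + 10 * L.vpost.length + E.M * (16 * E.N + 63) + 5) + 1 + 1 + 1 + 3)
      + 3) + (10 * L.post.length + 1))) (θ' := 17) ?_ le_rfl
    (le_of_eq (by ring))
  refine Emits.seq ((emits_emitList_of_holds h _ h16).mono (by norm_num) le_rfl) fun s₁ hs₁ => ?_
  have h₁ := h.of_agree hs₁ (by norm_num)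
  refine Emits.seq (Emits.for h.hS h₁.r12 h₁.r1 (by norm_num) (by norm_num) (by norm_num)
    (by norm_num) (by norm_num) (by norm_num) (by norm_num) fun i s' hi hs' hA => ?_)
    fun s₂ hs₂ => ?_
  · have h₂ := h₁.of_agree hA (by norm_num)
    refine Emits.op_seq trivial (by norm_num) (Emits.op_seq trivial (by norm_num)
      (Emits.op_seq trivial (by norm_num) ?_))
    generalize hs₃ : NState.setReg _ 19 _ = s₃
    have hB : Agree 18 s' s₃ := by
      rw [← hs₃]
      exact (((Agree.refl _ _).setReg (by norm_num) _).setReg (by norm_num) _).setReg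
        (by norm_num) _
    have h14' : s'.reg 14 = k := by rw [hA 14 (by omega), hs₁ 14 (by omega), h14]
    refine Emits.mono (emits_emitVector (h₂.of_agree hB (by norm_num)) hk hi hM ?_ ?_)
      (by norm_num) le_rfl
    · rw [← hs₃]
      simp [BinOp.natEval, h₂.r12, h₂.r7, h14', hs']
    · rw [hB 16 (by omega), hA 16 (by omega), hs₁ 16 (by omega), h16]
  · refine (emits_emitList_of_holds (h₁.of_agree hs₂ (by norm_num)) _ ?_).mono (by norm_num) le_rfl
    rw [hs₂ 16 (by omega), hs₁ 16 (by omega), h16]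

theorem emits_emitLocations (h : E.Holds w d H F s) (hM : E.M < 2 ^ w) :
    Emits w H F 14 L.emitLocations
      ((L.locationsList E.K E.S E.M (E.bit F)).flatMap (coords d))
      (E.K * (10 * L.pre.length + 10 * L.post.length + E.S * (10 * L.vpre.length +
        10 * L.vpost.length + E.M * (16 * E.N + 63) + 11) + 10) + 3) s := by
  rw [locationsList, List.flatMap_assoc]
  refine Emits.mono (T := E.K * ((10 * L.pre.length + 10 * L.post.length +
    E.S * (10 * L.vpre.length + 10 * L.vpost.length + E.M * (16 * E.N + 63) + 11) + 5) + 1 + 1 + 3)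
      + 3) (θ' := 14) ?_ le_rfl (le_of_eq (by ring))
  refine Emits.for h.hK h.r13 h.r1 (by norm_num) (by norm_num) (by norm_num)
    (by norm_num) (by norm_num) (by norm_num) (by norm_num) fun k s' hk hs' hA => ?_
  refine Emits.const_seq (by norm_num) (Emits.op_seq trivial (by norm_num) ?_)
  generalize hs₃ : NState.setReg _ 16 _ = s₃
  have hB : Agree 15 s' s₃ := by
    rw [← hs₃]
    exact ((Agree.refl _ _).setReg (by norm_num) _).setReg (by norm_num) _
  refine Emits.mono (emits_emitLocation ((h.of_agree hA (by norm_num)).of_agree hB (by norm_num))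
    hk hM ?_ ?_) (by norm_num) le_rfl
  · rw [hB 14 (by omega), hs']
  · rw [← hs₃]
    simp [BinOp.natEval, hs']

end Layout

end WordRAM

/-! ### Computing the sizes and rearranging the memory -/

namespace WordRAM

variable {w d H T T' θ : ℕ} {F : ℕ → ℕ} {s s' : NState} {l l' out : List ℕ}

def Prog.block : List Prog → Prog
  | [] => .skip
  | p :: l => .seq p (Prog.block l)

/-- Write the binary length of the register `3` to the register `27`. -/
def binaryLength : Prog :=
  Prog.block [.op .add 26 3 0, .const 27 0,
    .loop 26 (.seq (.op .shr 26 26 1) (.op .add 27 27 1))]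

theorem wp_binaryLength {M : ℕ} (h0 : s.reg 0 = 0) (h1 : s.reg 1 = 1) (h3 : s.reg 3 = M)
    (hM : M < 2 ^ w) :
    wp w binaryLength (fun t s' => t ≤ 3 * Nat.size M + 4 ∧ s'.mem = s.mem ∧
      s'.reg 27 = Nat.size M ∧ Agree 26 s s') s := by
  simp only [binaryLength, Prog.block]
  refine ⟨trivial, wp_seq.2 (wp_const.2 ?_)⟩
  rw [wp_seq]
  refine wp_loop (C := 2) (n := Nat.size M) (fun j s' => s'.mem = s.mem ∧ s'.reg 27 = j ∧
    s'.reg 26 = M >>> j ∧ Agree 26 s s') ?_ ?_ ?_ ?_ ?_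
  · refine ⟨rfl, by simp, by simp [BinOp.natEval, h0, h3], ?_⟩
    exact ((Agree.refl _ _).setReg (by norm_num) _).setReg (by norm_num) _
  · rintro j s' ⟨-, -, h, -⟩
    rw [h, Nat.shiftRight_eq_div_pow]
    exact (Nat.div_le_self _ _).trans_lt hM
  · rintro j s' ⟨-, -, h, -⟩
    rw [h, Nat.shiftRight_eq_div_pow, Nat.lt_size]
    exact ⟨fun h => (Nat.div_ne_zero_iff.1 h).2, fun h => Nat.div_ne_zero_iff.2 ⟨by positivity, h⟩⟩
  · rintro j s' hj ⟨h, h', h'', hA⟩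
    have h1' : s'.reg 1 = 1 := by rw [hA 1 (by omega), h1]
    have hw : 1 < 2 ^ w := by
      have := Nat.lt_size.1 hj
      have := Nat.one_le_two_pow (n := j)
      omega
    refine ⟨⟨?_, by rw [h1']; exact hw⟩, trivial, by norm_num, h, ?_, ?_, ?_⟩
    · rw [h'', Nat.shiftRight_eq_div_pow]
      exact (Nat.div_le_self _ _).trans_lt hM
    · simp [BinOp.natEval, h', h1']
    · simp [BinOp.natEval, h'', h1', Nat.shiftRight_add]
    · exact (hA.setReg (by norm_num) _).setReg (by norm_num) _
  · rintro t s' ht ⟨h, h', -, hA⟩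
    exact ⟨by omega, h, h', hA⟩

/-- The constants on which the number of locations and the number of vectors depend. -/
structure Tuning where
  p : ℕ
  r : ℕ
  C : ℕ
  N₀ : ℕ

namespace Tuning

variable (τ : Tuning)

/-- The quotient shares the `N` variables among `r + 2 * p` portions. The other summands compensate
for the rounding and provide the slack that absorbs factors polynomial in `M`. -/
def level (N M : ℕ) : ℕ := N / (τ.r + 2 * τ.p) + τ.C * Nat.size M + τ.N₀

/-- The number of vectors of a location. -/
def vectors (N M : ℕ) : ℕ := 2 ^ (τ.p * τ.level N M)

/-- The number of locations. -/
def locations (N M : ℕ) : ℕ := 2 ^ (τ.r * τ.level N M)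

def lengthP (N M : ℕ) : ℕ := τ.locations N M * (τ.vectors N M * (4 * M + 3) + 5)

def lengthQ (N M : ℕ) : ℕ := τ.locations N M * (τ.vectors N M * (4 * M + 1) + 6) + 6

/-- The address to which the formula is moved. -/
def offset (d N M : ℕ) : ℕ := d * (τ.lengthP N M + τ.lengthQ N M) + (2 + 2 * (N * M))

def computeSizes : Prog :=
  Prog.block [.const 29 (τ.r + 2 * τ.p), .op .div 28 2 29, .const 29 τ.C, .op .mul 29 29 27,
    .op .add 28 28 29, .const 29 τ.N₀, .op .add 28 28 29, .const 29 τ.p, .op .mul 10 29 28,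
    .op .shl 12 1 10, .const 29 τ.r, .op .mul 29 29 28, .op .shl 13 1 29]

theorem wp_computeSizes {N M : ℕ} (h1 : s.reg 1 = 1) (h2 : s.reg 2 = N)
    (h27 : s.reg 27 = Nat.size M) (hN : N < 2 ^ w) (hq : τ.r + 2 * τ.p < 2 ^ w)
    (hp : τ.p * τ.level N M < 2 ^ w) (hr : τ.r * τ.level N M < 2 ^ w) :
    wp w τ.computeSizes (fun t s' => t = 14 ∧ s'.mem = s.mem ∧
      (∀ r, r < 10 ∨ r = 11 ∨ 30 ≤ r → s'.reg r = s.reg r) ∧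
      s'.reg 10 = τ.p * τ.level N M ∧ s'.reg 12 = τ.vectors N M ∧
      s'.reg 13 = τ.locations N M) s := by
  simp only [computeSizes, Prog.block, wp, BinOp.Safe, BinOp.natEval, NState.reg_setReg,
    Nat.reduceEqDiff, if_true, if_false, h1, h2, h27, true_and, NState.mem_setReg,
    Nat.one_shiftLeft]
  refine ⟨⟨hN, hq⟩, hp, hr, ?_, rfl, rfl, rfl⟩
  intro r hr
  simp only [show r ≠ 10 by omega, show r ≠ 12 by omega, show r ≠ 13 by omega,
    show r ≠ 28 by omega, show r ≠ 29 by omega, if_false]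

def computeLengths (d : ℕ) : Prog :=
  Prog.block [.const 9 (d - 1), .op .mul 11 2 3, .op .add 11 11 11, .const 29 2,
    .op .add 11 29 11, .const 29 4, .op .mul 31 29 3, .const 29 3, .op .add 30 31 29,
    .op .mul 30 12 30, .const 29 5, .op .add 30 30 29, .op .mul 30 13 30, .op .add 32 31 1,
    .op .mul 32 12 32, .const 29 6, .op .add 32 32 29, .op .mul 32 13 32, .op .add 32 32 29,
    .op .add 33 30 32, .const 29 d, .op .mul 33 29 33, .op .add 33 33 11, .const 29 2,
    .op .add 4 33 29]

theorem wp_computeLengths {N M : ℕ} (h1 : s.reg 1 = 1) (h2 : s.reg 2 = N) (h3 : s.reg 3 = M)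
    (h12 : s.reg 12 = τ.vectors N M) (h13 : s.reg 13 = τ.locations N M) :
    wp w (computeLengths d) (fun t s' => t = 26 ∧ s'.mem = s.mem ∧
      (∀ r, r < 4 ∨ r = 10 ∨ r = 12 ∨ r = 13 ∨ 40 ≤ r → s'.reg r = s.reg r) ∧
      s'.reg 9 = d - 1 ∧ s'.reg 11 = 2 + 2 * (N * M) ∧ s'.reg 30 = τ.lengthP N M ∧
      s'.reg 32 = τ.lengthQ N M ∧ s'.reg 33 = τ.offset d N M ∧
      s'.reg 4 = τ.offset d N M + 2) s := by
  simp only [computeLengths, Prog.block, wp, BinOp.Safe, BinOp.natEval, NState.reg_setReg,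
    Nat.reduceEqDiff, if_true, if_false, h1, h2, h3, h12, h13, true_and, NState.mem_setReg,
    ← two_mul]
  refine ⟨by norm_num, ?_, rfl, rfl, rfl, rfl⟩
  intro r hr
  simp only [show r ≠ 4 by omega, show r ≠ 9 by omega, show r ≠ 11 by omega,
    show r ≠ 29 by omega, show r ≠ 30 by omega, show r ≠ 31 by omega, show r ≠ 32 by omega,
    show r ≠ 33 by omega, if_false]

end Tuning

/-- Move the cells below `reg 11` by `reg 33`. -/
def moveInput : Prog :=
  Prog.for 14 15 11 (Prog.block [.load 26 14, .op .add 27 14 33, .store 27 26, .const 26 0,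
    .store 14 26])

/-- `n ≤ H` keeps source and target disjoint. The source cells are zeroed so that coordinates that
are never written read as `0`. -/
theorem wp_moveInput {n : ℕ} (h1 : s.reg 1 = 1) (h11 : s.reg 11 = n) (h33 : s.reg 33 = H)
    (hmem : s.mem = F) (hF : ∀ a, n ≤ a → F a = 0) (hn : n ≤ H) (hw : H + n < 2 ^ w) :
    wp w moveInput (fun t s' => t ≤ n * 9 + 3 ∧ s'.mem = memOf H F [] ∧
      ∀ r, r < 14 ∨ 28 ≤ r → s'.reg r = s.reg r) s := by
  refine wp_for (C := 6) (n := n) (fun j s' => (∀ a, s'.mem a =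
    if a < j then 0 else if a < H then F a else if a < H + j then F (a - H) else 0) ∧
      ∀ r, r < 14 ∨ 28 ≤ r → s'.reg r = s.reg r) (by omega) (by norm_num) (by norm_num) ?_ ?_ ?_
      ?_ ?_
  · refine ⟨fun a => ?_, fun r _ => rfl⟩
    rw [hmem]
    split_ifs
    · omega
    · rfl
    · omega
    · exact hF a (by omega)
  · rintro j s' ⟨-, h⟩
    exact ⟨by rw [h 11 (by omega), h11], by rw [h 1 (by omega), h1]⟩
  · rintro j s' ⟨h, h'⟩ x
    refine ⟨⟨h, fun r hr => ?_⟩, ⟨h, fun r hr => ?_⟩⟩ <;>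
      rw [NState.reg_setReg, if_neg (by omega), h' r hr]
  · rintro j s' hj hj' ⟨h, h'⟩
    have h33' : s'.reg 33 = H := by rw [h' 33 (by omega), h33]
    simp only [Prog.block, wp, BinOp.Safe, BinOp.natEval, NState.reg_setReg, NState.reg_setMem,
      Nat.reduceEqDiff, if_true, if_false, hj', h33', true_and, NState.mem_setReg,
      NState.mem_setMem]
    refine ⟨by omega, by omega, by omega, by norm_num, fun a => ?_, fun r hr => ?_⟩
    · simp only [Function.update_apply, h]
      by_cases h1 : a = j
      · rw [if_pos h1, if_pos (by omega)]
      · rw [if_neg h1]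
        by_cases h2 : a = j + H
        · rw [if_pos h2, if_neg (by omega), if_pos (by omega), if_neg (by omega),
            if_neg (by omega), if_pos (by omega)]
          exact congrArg F (by omega)
        · rw [if_neg h2]
          refine ite_congr (propext (by omega)) (fun _ => rfl) fun _ => ?_
          exact if_congr Iff.rfl rfl (if_congr (by omega) rfl rfl)
    · rw [if_neg (by omega), if_neg (by omega), if_neg (by omega), h' r hr]
  · rintro t s' ht ⟨h, h'⟩
    refine ⟨ht, funext fun a => ?_, h'⟩
    rw [h, memOf]
    split_ifs
    · simp
    · omega
    · have : F a = 0 := hF a (by omega)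
      simpa using this
    · rfl
    · rw [hF _ (by omega)]

/-- Clear the cells from `reg 33` on, as many as `reg 11` says. -/
def clearInput : Prog :=
  Prog.for 14 15 11 (Prog.block [.op .add 26 14 33, .const 27 0, .store 26 27])

/-- Removing the copy of the formula leaves a memory with nothing but the written list, as the
approximation algorithm expects. -/
theorem wp_clearInput {n : ℕ} (h1 : s.reg 1 = 1) (h11 : s.reg 11 = n) (h33 : s.reg 33 = H)
    (hmem : s.mem = memOf H F out) (hF : ∀ a, n ≤ a → F a = 0) (hout : out.length ≤ H)
    (hw : H + n < 2 ^ w) :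
    wp w clearInput (fun t s' => t ≤ n * 7 + 3 ∧ (s'.mem = fun a => out.getD a 0) ∧
      ∀ r, 40 ≤ r → s'.reg r = s.reg r) s := by
  refine wp_for (C := 4) (n := n) (fun j s' => (∀ a, s'.mem a =
    if a < H then out.getD a 0 else if a < H + j then 0 else F (a - H)) ∧
      ∀ r, r < 14 ∨ 28 ≤ r → s'.reg r = s.reg r) (by omega) (by norm_num) (by norm_num) ?_ ?_ ?_
      ?_ ?_
  · refine ⟨fun a => ?_, fun r _ => rfl⟩
    rw [hmem, memOf]
    split_ifs
    · rfl
    · omega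
    · rfl
  · rintro j s' ⟨-, h⟩
    exact ⟨by rw [h 11 (by omega), h11], by rw [h 1 (by omega), h1]⟩
  · rintro j s' ⟨h, h'⟩ x
    refine ⟨⟨h, fun r hr => ?_⟩, ⟨h, fun r hr => ?_⟩⟩ <;>
      rw [NState.reg_setReg, if_neg (by omega), h' r hr]
  · rintro j s' hj hj' ⟨h, h'⟩
    have h33' : s'.reg 33 = H := by rw [h' 33 (by omega), h33]
    simp only [Prog.block, wp, BinOp.Safe, BinOp.natEval, NState.reg_setReg, NState.reg_setMem,
      Nat.reduceEqDiff, if_true, if_false, hj', h33', true_and, NState.mem_setReg,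
      NState.mem_setMem]
    refine ⟨by omega, by norm_num, fun a => ?_, fun r hr => ?_⟩
    · simp only [Function.update_apply, h]
      by_cases h1 : a = j + H
      · rw [if_pos h1, if_neg (by omega), if_pos (by omega)]
      · rw [if_neg h1]
        by_cases h2 : a < H
        · rw [if_pos h2, if_pos h2]
        · rw [if_neg h2, if_neg h2]
          exact if_congr (by omega) rfl rfl
    · rw [if_neg (by omega), if_neg (by omega), h' r (by omega)]
  · rintro t s' ht ⟨h, h'⟩
    refine ⟨ht, funext fun a => ?_, fun r hr => h' r (by omega)⟩
    rw [h]
    split_ifs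
    · rfl
    · rw [List.getD_eq_default _ _ (by omega)]
    · rw [hF _ (by omega), List.getD_eq_default _ _ (by omega)]

/-- Clear the registers below `n`. -/
def clearRegs : ℕ → Prog
  | 0 => .skip
  | n + 1 => .seq (clearRegs n) (.const n 0)

theorem wp_clearRegs (n : ℕ) : wp w (clearRegs n) (fun t s' => t = n + 1 ∧ s'.mem = s.mem ∧
    ∀ r, s'.reg r = if r < n then 0 else s.reg r) s := by
  induction n with
  | zero => exact ⟨rfl, rfl, fun r => by simp⟩
  | succ n ih =>
    refine wp_mono (p := clearRegs n) ih ?_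
    rintro t s' ⟨ht, h, h'⟩
    refine ⟨by omega, h, fun r => ?_⟩
    rw [NState.reg_setReg, h']
    split_ifs <;> first | rfl | omega

end WordRAM

/-! ### The complete construction program -/

namespace WordRAM

variable {w d H T T' θ : ℕ} {F : ℕ → ℕ} {s s' : NState} {l l' out : List ℕ}

/-- The first curve. -/
def layoutP : Layout where
  pre := []
  vpre := [(30, 135), (10, 95)]
  right := 113
  mid := 113
  left := 113
  vpost := [(50, 95)]
  post := [(100, 135), (100, 95), (100, 8), (100, 95), (100, 135)]

/-- The second curve, without its last vertices. -/
def layoutQ : Layout where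
  pre := [(30, 175), (30, 85), (5, 0)]
  vpre := [(30, 5)]
  right := 13
  mid := 13
  left := 15
  vpost := []
  post := [(55, 0), (30, 85), (30, 175)]

/-- Write the numbers of vertices, and prepare for the first curve. -/
def prepareP : Prog :=
  Prog.block [.const 26 0, .store 26 30, .store 1 32, .const 39 2, .op .lt 26 10 2,
    .op .mul 27 26 10, .op .sub 28 1 26, .op .mul 28 28 2, .op .add 5 27 28, .op .sub 6 2 5,
    .op .add 7 12 0, .const 8 1]

/-- Prepare for the second curve. -/
def prepareQ : Prog :=
  Prog.block [.op .add 6 5 0, .const 5 0, .const 7 1, .const 8 0]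

/-- The end of the second curve. -/
def writeEnd : Prog :=
  .seq (.const 16 140) (.seq (.op .mul 16 16 13) (emitList (layoutQ.pre ++ layoutQ.post)))

namespace Tuning

variable (τ : Tuning)

/-- The first curve tests the variables from `p * level` on; the factor `step = 2 ^ (p * level)`
puts the digits of `k * S + i` there. The minimum is needed because `p * level` can exceed `N`. -/
def settingP (N M : ℕ) : Setting where
  N := N
  M := M
  lo := min (τ.p * τ.level N M) N
  cnt := N - min (τ.p * τ.level N M) N
  step := τ.vectors N M
  flag := 1
  S := τ.vectors N M
  K := τ.locations N M

/-- The second curve tests the low variables, on which the location has no influence. The flag is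
`0` because its vertices are raised when the clause is satisfied. -/
def settingQ (N M : ℕ) : Setting where
  N := N
  M := M
  lo := 0
  cnt := min (τ.p * τ.level N M) N
  step := 1
  flag := 0
  S := τ.vectors N M
  K := τ.locations N M

/-- The numbers that occur in the construction of the curves are words. -/
structure Fits (w d N M : ℕ) : Prop where
  hq : τ.r + 2 * τ.p < 2 ^ w
  hp : τ.p * τ.level N M < 2 ^ w
  hr : τ.r * τ.level N M < 2 ^ w
  hX : τ.locations N M * τ.vectors N M * τ.vectors N M < 2 ^ w
  hN : N < 2 ^ w
  haddr : 2 * τ.offset d N M < 2 ^ w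

/-- The vertices of the first curve. -/
noncomputable def verticesP (F : ℕ → ℕ) (N M : ℕ) : List (ℕ × ℕ) :=
  layoutP.locationsList (τ.locations N M) (τ.vectors N M) M ((τ.settingP N M).bit F)

noncomputable def verticesQ (F : ℕ → ℕ) (N M : ℕ) : List (ℕ × ℕ) :=
  layoutQ.locationsList (τ.locations N M) (τ.vectors N M) M ((τ.settingQ N M).bit F) ++
    (layoutQ.pre ++ layoutQ.post).map fun q => (140 * τ.locations N M + q.1, q.2)

theorem vectors_pos (N M : ℕ) : 0 < τ.vectors N M := by unfold vectors; positivity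

theorem locations_pos (N M : ℕ) : 0 < τ.locations N M := by unfold locations; positivity

theorem length_flatMap_coords (hd : 2 ≤ d) (l : List (ℕ × ℕ)) :
    (l.flatMap (coords d)).length = d * l.length := by
  induction l with
  | nil => simp
  | cons q l ih =>
    rw [List.flatMap_cons, List.length_append, ih, length_coords hd, List.length_cons]; ring

end Tuning

/-- The clause `c` is not satisfied by the digits for the vector `i` of the location `k`. -/
noncomputable def Setting.unsat (E : Setting) (F : ℕ → ℕ) (k i c : ℕ) : Bool :=
  open Classical in decide (Unsat F E.N E.lo E.cnt ((k * E.S + i) * E.step) c)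

theorem Setting.bit_of_flag_eq_one {E : Setting} (h : E.flag = 1) (F : ℕ → ℕ) (k i c : ℕ) :
    E.bit F k i c = (E.unsat F k i c).toNat := by
  classical
  by_cases h' : Unsat F E.N E.lo E.cnt ((k * E.S + i) * E.step) c <;>
    simp [Setting.bit, Setting.unsat, h, h']

theorem Setting.bit_of_flag_eq_zero {E : Setting} (h : E.flag = 0) (F : ℕ → ℕ) (k i c : ℕ) :
    E.bit F k i c = (!E.unsat F k i c).toNat := by
  classical
  by_cases h' : Unsat F E.N E.lo E.cnt ((k * E.S + i) * E.step) c <;>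
    simp [Setting.bit, Setting.unsat, h, h']

namespace Tuning

variable (τ : Tuning)

theorem verticesP_eq (F : ℕ → ℕ) (N M : ℕ) :
    τ.verticesP F N M = (pSyms (τ.locations N M) (τ.vectors N M) M).map
      (PSym.pos ((τ.settingP N M).unsat F)) := by
  simp only [verticesP, pSyms, List.map_flatMap, pBlock, pVec, List.map_append, List.map_cons,
    List.map_nil, PSym.pos, Layout.locationsList, Layout.locationList, Layout.vectorList,
    layoutP, Layout.clauseList, Setting.bit_of_flag_eq_one (E := τ.settingP N M) rfl,
    List.nil_append, two_mul, add_assoc]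

theorem verticesQ_eq (F : ℕ → ℕ) (N M : ℕ) :
    τ.verticesQ F N M = (qSyms (τ.locations N M) (τ.vectors N M) M).map
      (QSym.pos ((τ.settingQ N M).unsat F)) := by
  simp only [verticesQ, qSyms, List.map_flatMap, qBlock, qVec, List.map_append, List.map_cons,
    List.map_nil, QSym.pos, Layout.locationsList, Layout.locationList, Layout.vectorList,
    layoutQ, Layout.clauseList, Setting.bit_of_flag_eq_zero (E := τ.settingQ N M) rfl,
    List.append_nil, two_mul, add_assoc, List.range_zero, List.flatMap_nil]

theorem length_verticesP (F : ℕ → ℕ) (N M : ℕ) :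
    (τ.verticesP F N M).length = τ.lengthP N M := by
  rw [verticesP_eq, List.length_map, length_pSyms, lengthP]

theorem length_verticesQ (F : ℕ → ℕ) (N M : ℕ) :
    (τ.verticesQ F N M).length = τ.lengthQ N M := by
  rw [verticesQ_eq, List.length_map, length_qSyms, lengthQ]

theorem locations_le_lengthP (N M : ℕ) :
    τ.locations N M ≤ τ.lengthP N M ∧ τ.vectors N M ≤ τ.lengthP N M ∧ M ≤ τ.lengthP N M ∧
      1 ≤ τ.lengthP N M := by
  have hK := τ.locations_pos N M
  have hS := τ.vectors_pos N M
  have h1 : 1 ≤ τ.vectors N M * (4 * M + 3) + 5 := by omega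
  have h2 : τ.vectors N M ≤ τ.vectors N M * (4 * M + 3) := Nat.le_mul_of_pos_right _ (by omega)
  have h3 : 4 * M + 3 ≤ τ.vectors N M * (4 * M + 3) := Nat.le_mul_of_pos_left _ hS
  have h4 : τ.locations N M ≤ τ.lengthP N M := Nat.le_mul_of_pos_right _ h1
  have h5 : τ.vectors N M * (4 * M + 3) + 5 ≤ τ.lengthP N M := Nat.le_mul_of_pos_left _ hK
  omega

theorem lt_of_fits {N M : ℕ} (h : τ.Fits w d N M) (hd : 2 ≤ d) :
    τ.offset d N M + 2 + 2 * (M * N) + 1 < 2 ^ w ∧ τ.locations N M < 2 ^ w ∧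
      τ.vectors N M < 2 ^ w ∧ M < 2 ^ w := by
  have h1 := h.haddr
  have h2 := τ.locations_le_lengthP N M
  have h3 : 2 * (τ.lengthP N M + τ.lengthQ N M) ≤ d * (τ.lengthP N M + τ.lengthQ N M) :=
    Nat.mul_le_mul_right _ hd
  have h4 : τ.offset d N M = d * (τ.lengthP N M + τ.lengthQ N M) + (2 + 2 * (N * M)) := rfl
  rw [Nat.mul_comm M N]
  omega

theorem wp_prepareP {N M : ℕ} (hτ : τ.Fits w d N M) (hd : 2 ≤ d)
    (h0 : s.reg 0 = 0) (h1 : s.reg 1 = 1) (h2 : s.reg 2 = N)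
    (h10 : s.reg 10 = τ.p * τ.level N M) (h12 : s.reg 12 = τ.vectors N M)
    (h30 : s.reg 30 = τ.lengthP N M)
    (h32 : s.reg 32 = τ.lengthQ N M) (hmem : s.mem = memOf (τ.offset d N M) F []) :
    wp w prepareP (fun t s' => t = 13 ∧
      Writing (τ.offset d N M) F [τ.lengthP N M, τ.lengthQ N M] s' ∧
      s'.reg 5 = min (τ.p * τ.level N M) N ∧ s'.reg 6 = N - min (τ.p * τ.level N M) N ∧
      s'.reg 7 = τ.vectors N M ∧ s'.reg 8 = 1 ∧
      ∀ r, r < 5 ∨ (9 ≤ r ∧ r < 14) ∨ 40 ≤ r → s'.reg r = s.reg r) s := by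
  obtain ⟨hw1, -⟩ := τ.lt_of_fits hτ hd
  have hoff : 2 ≤ τ.offset d N M := by unfold offset; omega
  have hmem' : Function.update (Function.update (memOf (τ.offset d N M) F []) 0 (τ.lengthP N M)) 1
      (τ.lengthQ N M) = memOf (τ.offset d N M) F [τ.lengthP N M, τ.lengthQ N M] :=
    memOf_coords (d := 2) (out := []) (τ.lengthP N M, τ.lengthQ N M) hoff
  -- The program computes this minimum without a branch, weighting both numbers by the comparison
  -- bit.
  have hlo : (if τ.p * τ.level N M < N then 1 else 0) * (τ.p * τ.level N M) +
      (1 - if τ.p * τ.level N M < N then 1 else 0) * N = min (τ.p * τ.level N M) N := by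
    split_ifs <;> omega
  have hp := hτ.hp
  have hN := hτ.hN
  simp only [prepareP, Prog.block, wp, BinOp.Safe, BinOp.natEval, NState.reg_setReg,
    NState.reg_setMem, Nat.reduceEqDiff, if_true, if_false, h0, h1, h2, h10, h12, h30, h32,
    true_and, NState.mem_setReg, NState.mem_setMem, hmem, hmem', hlo, Writing]
  refine ⟨by omega, by omega, ⟨hp, hN⟩, ⟨by split_ifs <;> omega, by omega⟩, ⟨by omega, hN⟩,
    by simp, rfl, ?_⟩
  intro r hr
  simp only [show r ≠ 5 by omega, show r ≠ 6 by omega, show r ≠ 7 by omega, show r ≠ 8 by omega,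
    show r ≠ 26 by omega, show r ≠ 27 by omega, show r ≠ 28 by omega, show r ≠ 39 by omega,
    if_false]

theorem wp_prepareQ {g5 : ℕ} (h0 : s.reg 0 = 0) (h5 : s.reg 5 = g5) :
    wp w prepareQ (fun t s' => t = 5 ∧ s'.mem = s.mem ∧ s'.reg 5 = 0 ∧ s'.reg 6 = g5 ∧
      s'.reg 7 = 1 ∧ s'.reg 8 = 0 ∧
      ∀ r, r < 5 ∨ 9 ≤ r → s'.reg r = s.reg r) s := by
  simp only [prepareQ, Prog.block, wp, BinOp.Safe, BinOp.natEval, NState.reg_setReg,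
    Nat.reduceEqDiff, if_true, if_false, h0, h5, true_and, NState.mem_setReg]
  refine ⟨by norm_num, ?_⟩
  intro r hr
  simp only [show r ≠ 5 by omega, show r ≠ 6 by omega, show r ≠ 7 by omega, show r ≠ 8 by omega,
    if_false]

/-- The program that produces the two curves from the formula. -/
def build (d : ℕ) : Prog :=
  Prog.block [.const 1 1, .load 2 0, .load 3 1, binaryLength, τ.computeSizes, computeLengths d,
    moveInput, prepareP, layoutP.emitLocations, prepareQ, layoutQ.emitLocations, writeEnd,
    .const 29 2, .op .sub 33 4 29, clearInput, clearRegs 40]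

/-- A bound on the running time of the program. -/
def buildTime (N M : ℕ) : ℕ :=
  3 * Nat.size M + τ.locations N M * (τ.vectors N M * (32 * M * N + 126 * M + 62) + 130) +
    32 * (N * M) + 300

-- The final state has to be known completely, registers included: the approximation algorithm is
-- specified only when started from its initial state.
set_option maxHeartbeats 1000000 in
theorem wp_build {N M : ℕ} (hτ : τ.Fits w d N M) (hd : 2 ≤ d) (hF : ∀ a, F a < 2 ^ w)
    (hF0 : F 0 = N) (hF1 : F 1 = M) (hFN : ∀ a, 2 + 2 * (N * M) ≤ a → F a = 0) :
    wp w (τ.build d) (fun t s' => t ≤ τ.buildTime N M ∧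
      s' = ⟨fun _ => 0, fun a => ([τ.lengthP N M, τ.lengthQ N M] ++
        (τ.verticesP F N M).flatMap (coords d) ++
        (τ.verticesQ F N M).flatMap (coords d)).getD a 0⟩) ⟨fun _ => 0, F⟩ := by
  obtain ⟨hw1, hw2, hw3, hw4⟩ := τ.lt_of_fits hτ hd
  have hoff : τ.offset d N M = d * (τ.lengthP N M + τ.lengthQ N M) + (2 + 2 * (N * M)) := rfl
  rw [Nat.mul_comm M N] at hw1
  rw [build, Prog.block, wp_seq, wp_const]
  rw [Prog.block, wp_seq, wp_load]
  refine ⟨by simp, ?_⟩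
  rw [Prog.block, wp_seq, wp_load]
  refine ⟨by simp only [NState.reg_setReg, Nat.reduceEqDiff, if_true, if_false]; omega, ?_⟩
  simp only [NState.reg_setReg, NState.mem_setReg, Nat.reduceEqDiff, if_true, if_false, hF0, hF1]
  generalize hs₁ : NState.setReg _ 3 M = s₁
  have a0 : s₁.reg 0 = 0 := by rw [← hs₁]; simp
  have a1 : s₁.reg 1 = 1 := by rw [← hs₁]; simp
  have a2 : s₁.reg 2 = N := by rw [← hs₁]; simp
  have a3 : s₁.reg 3 = M := by rw [← hs₁]; simp
  have a40 : ∀ r, 40 ≤ r → s₁.reg r = 0 := fun r hr => by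
    rw [← hs₁]
    simp [show r ≠ 1 by omega, show r ≠ 2 by omega, show r ≠ 3 by omega]
  have am : s₁.mem = F := by rw [← hs₁]; rfl
  clear hs₁
  rw [Prog.block, wp_seq]
  refine wp_mono (wp_binaryLength a0 a1 a3 hw4) ?_
  rintro t₂ s₂ ⟨ht₂, bm, b27, bA⟩
  have b0 : ∀ r < 26, s₂.reg r = s₁.reg r := fun r hr => bA r (.inl hr)
  rw [Prog.block, wp_seq]
  refine wp_mono (τ.wp_computeSizes (by rw [b0 _ (by norm_num), a1])
    (by rw [b0 _ (by norm_num), a2]) b27 hτ.hN hτ.hq hτ.hp hτ.hr) ?_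
  rintro t₃ s₃ ⟨ht₃, cm, cA, c10, c12, c13⟩
  rw [Prog.block, wp_seq]
  refine wp_mono (τ.wp_computeLengths (d := d) (N := N) (M := M)
    (by rw [cA _ (by norm_num), b0 _ (by norm_num), a1])
    (by rw [cA _ (by norm_num), b0 _ (by norm_num), a2])
    (by rw [cA _ (by norm_num), b0 _ (by norm_num), a3]) c12 c13) ?_
  rintro t₄ s₄ ⟨ht₄, dm, dA, d9, d11, d30, d32, d33, d4⟩
  have d1 : s₄.reg 1 = 1 := by
    rw [dA _ (by norm_num), cA _ (by norm_num), b0 _ (by norm_num), a1]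
  rw [Prog.block, wp_seq]
  refine wp_mono (wp_moveInput (F := F) d1 d11 d33 (by rw [dm, cm, bm, am]) hFN (by omega)
    (by omega)) ?_
  rintro t₅ s₅ ⟨ht₅, em, eA⟩
  have e0 : s₅.reg 0 = 0 := by
    rw [eA _ (by norm_num), dA _ (by norm_num), cA _ (by norm_num), b0 _ (by norm_num), a0]
  have e1 : s₅.reg 1 = 1 := by rw [eA _ (by norm_num), d1]
  have e2 : s₅.reg 2 = N := by
    rw [eA _ (by norm_num), dA _ (by norm_num), cA _ (by norm_num), b0 _ (by norm_num), a2]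
  have e3 : s₅.reg 3 = M := by
    rw [eA _ (by norm_num), dA _ (by norm_num), cA _ (by norm_num), b0 _ (by norm_num), a3]
  have e4 : s₅.reg 4 = τ.offset d N M + 2 := by rw [eA _ (by norm_num), d4]
  have e9 : s₅.reg 9 = d - 1 := by rw [eA _ (by norm_num), d9]
  have e10 : s₅.reg 10 = τ.p * τ.level N M := by rw [eA _ (by norm_num), dA _ (by norm_num), c10]
  have e11 : s₅.reg 11 = 2 + 2 * (N * M) := by rw [eA _ (by norm_num), d11]
  have e12 : s₅.reg 12 = τ.vectors N M := by rw [eA _ (by norm_num), dA _ (by norm_num), c12]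
  have e13 : s₅.reg 13 = τ.locations N M := by rw [eA _ (by norm_num), dA _ (by norm_num), c13]
  have e40 : ∀ r, 40 ≤ r → s₅.reg r = 0 := fun r hr => by
    rw [eA _ (by omega), dA _ (by omega), cA _ (by omega), bA _ (by omega), a40 r hr]
  rw [Prog.block, wp_seq]
  refine wp_mono (τ.wp_prepareP hτ hd e0 e1 e2 e10 e12 (by rw [eA _ (by norm_num), d30])
    (by rw [eA _ (by norm_num), d32]) em) ?_
  rintro t₆ s₆ ⟨ht₆, fW, f5, f6, f7, f8, fA⟩
  have hP : (τ.settingP N M).Holds w d (τ.offset d N M) F s₆ := by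
    constructor
    case hN => simp [settingP]
    case hflag => simp [settingP]
    case hX => exact hτ.hX
    case hH => omega
    case haddr => change _ + 2 * (M * N) + 1 < _; rw [Nat.mul_comm M N]; omega
    case r1 => rw [fA _ (by norm_num), e1]
    case r2 => rw [fA _ (by norm_num), e2]; rfl
    case r3 => rw [fA _ (by norm_num), e3]; rfl
    case r4 => rw [fA _ (by norm_num), e4]
    case r9 => rw [fA _ (by norm_num), e9]
    case r12 => rw [fA _ (by norm_num), e12]; rfl
    case r13 => rw [fA _ (by norm_num), e13]; rfl
    all_goals assumption
  have hVP : layoutP.locationsList (τ.settingP N M).K (τ.settingP N M).S (τ.settingP N M).M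
    ((τ.settingP N M).bit F) = τ.verticesP F N M := rfl
  have hlP : ((τ.verticesP F N M).flatMap (coords d)).length = d * τ.lengthP N M := by
    rw [length_flatMap_coords hd, length_verticesP]
  have hlQ : ((τ.verticesQ F N M).flatMap (coords d)).length = d * τ.lengthQ N M := by
    rw [length_flatMap_coords hd, length_verticesQ]
  rw [Nat.mul_add] at hoff
  have hP' := Layout.emits_emitLocations (L := layoutP) hP hw4 _ fW
  rw [hVP, hlP] at hP'
  rw [Prog.block, wp_seq]
  refine wp_mono (hP' (by simp only [List.length_cons, List.length_nil]; omega)) ?_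
  rintro t₇ s₇ ⟨ht₇, gW, gA⟩
  have g0 : ∀ r, r < 5 ∨ (9 ≤ r ∧ r < 14) ∨ 40 ≤ r → s₇.reg r = s₅.reg r := fun r hr => by
    rw [gA r (by omega), fA r (by omega)]
  rw [Prog.block, wp_seq]
  refine wp_mono (wp_prepareQ (g5 := s₇.reg 5) ?_ rfl) ?_
  · rw [g0 0 (by norm_num), e0]
  rintro t₈ s₈ ⟨ht₈, hm, h5, h6, h7, h8, hA⟩
  have h0 : ∀ r, r < 5 ∨ (9 ≤ r ∧ r < 14) ∨ 40 ≤ r → s₈.reg r = s₅.reg r := fun r hr => by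
    rw [hA r (by omega), g0 r hr]
  have hQ : (τ.settingQ N M).Holds w d (τ.offset d N M) F s₈ := by
    constructor
    case hN => simp [settingQ]
    case hflag => simp [settingQ]
    case hX =>
      change τ.locations N M * τ.vectors N M * 1 < _
      refine lt_of_le_of_lt ?_ hτ.hX
      exact Nat.mul_le_mul_left _ (τ.vectors_pos N M)
    case hH => omega
    case haddr => change _ + 2 * (M * N) + 1 < _; rw [Nat.mul_comm M N]; omega
    case r1 => rw [h0 _ (by norm_num), e1]
    case r2 => rw [h0 _ (by norm_num), e2]; rfl
    case r3 => rw [h0 _ (by norm_num), e3]; rfl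
    case r4 => rw [h0 _ (by norm_num), e4]
    case r6 => rw [h6, gA 5 (by norm_num), f5]; rfl
    case r9 => rw [h0 _ (by norm_num), e9]
    case r12 => rw [h0 _ (by norm_num), e12]; rfl
    case r13 => rw [h0 _ (by norm_num), e13]; rfl
    all_goals assumption
  set outP := [τ.lengthP N M, τ.lengthQ N M] ++ (τ.verticesP F N M).flatMap (coords d) with houtP
  have hloutP : outP.length = 2 + d * τ.lengthP N M := by
    rw [houtP, List.length_append, hlP]; rfl
  set mainQ := layoutQ.locationsList (τ.locations N M) (τ.vectors N M) M
    ((τ.settingQ N M).bit F) with hmainQ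
  set endQ := (layoutQ.pre ++ layoutQ.post).map fun q => (140 * τ.locations N M + q.1, q.2)
    with hendQ
  have hVQ : τ.verticesQ F N M = mainQ ++ endQ := rfl
  have hlQ' : (mainQ.flatMap (coords d)).length + (endQ.flatMap (coords d)).length =
      d * τ.lengthQ N M := by
    rw [← hlQ, hVQ, List.flatMap_append, List.length_append]
  have hQ' : Emits _ _ _ _ _ (mainQ.flatMap (coords d)) _ _ :=
    Layout.emits_emitLocations (L := layoutQ) hQ hw4
  rw [Prog.block, wp_seq]
  refine wp_mono (hQ' outP ⟨by rw [hm, gW.1], by rw [hA 39 (by norm_num), gW.2]⟩ (by omega)) ?_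
  rintro t₉ s₉ ⟨ht₉, iW, iA⟩
  have i0 : ∀ r, r < 5 ∨ (9 ≤ r ∧ r < 14) ∨ 40 ≤ r → s₉.reg r = s₅.reg r := fun r hr => by
    rw [iA r (by omega), h0 r hr]
  have hEnd : Emits w (τ.offset d N M) F 14 writeEnd (endQ.flatMap (coords d))
      (10 * 6 + 1 + 1 + 1) s₉ := by
    refine Emits.const_seq (by norm_num) (Emits.op_seq trivial (by norm_num) ?_)
    generalize hu : NState.setReg _ 16 _ = u
    have hB : Agree 14 s₉ u := by
      rw [← hu]
      exact ((Agree.refl _ _).setReg (by norm_num) _).setReg (by norm_num) _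
    refine Emits.mono (Layout.emits_emitList_of_holds ((hQ.of_agree iA le_rfl).of_agree hB le_rfl)
      (layoutQ.pre ++ layoutQ.post) ?_) (by norm_num) le_rfl
    rw [← hu]
    simp [BinOp.natEval, i0 13 (by norm_num), e13]
  rw [Prog.block, wp_seq]
  refine wp_mono (hEnd _ iW (by rw [List.length_append]; omega)) ?_
  rintro t₁₀ s₁₀ ⟨ht₁₀, jW, jA⟩
  have j0 : ∀ r, r < 5 ∨ (9 ≤ r ∧ r < 14) ∨ 40 ≤ r → s₁₀.reg r = s₅.reg r := fun r hr => by
    rw [jA r (by omega), i0 r hr]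
  rw [List.append_assoc, ← List.flatMap_append, ← hVQ] at jW
  -- Register `33` is not among those that the writers preserve, so the offset is recovered from
  -- register `4`, which holds it plus `2`.
  rw [Prog.block, wp_seq, wp_const, Prog.block, wp_seq, wp_op]
  refine ⟨by simp [BinOp.Safe, j0 4 (by norm_num), e4]; omega, ?_⟩
  rw [Prog.block, wp_seq]
  refine wp_mono (wp_clearInput (n := 2 + 2 * (N * M)) (H := τ.offset d N M) (F := F)
    (out := outP ++ (τ.verticesQ F N M).flatMap (coords d)) ?_ ?_ ?_ ?_ hFN ?_ (by omega)) ?_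
  · simp [j0 1 (by norm_num), e1]
  · simp [j0 11 (by norm_num), e11]
  · simp [BinOp.natEval, j0 4 (by norm_num), e4]
  · simpa using jW.1
  · rw [List.length_append, hlQ]; omega
  rintro t₁₁ s₁₁ ⟨ht₁₁, km, kA⟩
  rw [Prog.block, wp_seq]
  refine wp_mono (wp_clearRegs 40) ?_
  rintro t₁₂ s₁₂ ⟨ht₁₂, lm, lA⟩
  constructor
  · simp only [layoutP, layoutQ, List.length_cons, List.length_nil] at ht₇ ht₉
    simp only [settingP, settingQ] at ht₇ ht₉
    have : τ.locations N M * (τ.vectors N M * (32 * M * N + 126 * M + 62) + 130) =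
        τ.locations N M * (10 * 0 + 10 * (0 + 1 + 1 + 1 + 1 + 1) + τ.vectors N M *
          (10 * (0 + 1 + 1) + 10 * (0 + 1) + M * (16 * N + 63) + 11) + 10) +
        τ.locations N M * (10 * (0 + 1 + 1 + 1) + 10 * (0 + 1 + 1 + 1) + τ.vectors N M *
          (10 * (0 + 1) + 10 * 0 + M * (16 * N + 63) + 11) + 10) := by ring
    unfold buildTime
    omega
  · obtain ⟨reg, mem⟩ := s₁₂
    simp only at lm lA
    congr 1
    · funext r
      rw [lA]
      split_ifs with hr
      · rfl
      · rw [kA r (by omega)]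
        simp [show r ≠ 33 by omega, show r ≠ 29 by omega, j0 r (by omega), e40 r (by omega)]
    · rw [lm, km]

end Tuning

end WordRAM

/-! ## The curves and the formula -/

namespace CNFFormula

variable (φ : CNFFormula)

theorem length_encode : φ.encode.length = 2 + 2 * (φ.N * φ.M) := by
  simp [encode, List.length_flatMap]
  ring

theorem getElem?_flatMap_finRange {α : Type*} {n m : ℕ} {f : Fin n → List α}
    (hf : ∀ i, (f i).length = m) (i : Fin n) {b : ℕ} (hb : b < m) :
    ((List.finRange n).flatMap f)[i.val * m + b]? = (f i)[b]? := by
  have : (List.finRange n).flatMap f =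
      (List.range n).flatMap fun k => if h : k < n then f ⟨k, h⟩ else [] := by
    rw [← List.map_coe_finRange_eq_range, List.flatMap_map]
    simp
  rw [this, getElem?_flatMap_range (fun k hk => by simp [hk, hf]) i.isLt hb]
  simp

theorem getElem?_encode (c : Fin φ.M) (i : Fin φ.N) {b : ℕ} (hb : b < 2) :
    φ.encode[2 + 2 * (c.val * φ.N + i.val) + b]? =
      [if i ∈ φ.pos c then 1 else 0, if i ∈ φ.neg c then 1 else 0][b]? := by
  rw [encode, List.getElem?_append_right (by simp; omega)]
  simp only [List.length_cons, List.length_nil]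
  rw [show 2 + 2 * (c.val * φ.N + i.val) + b - (0 + 1 + 1) =
    c.val * (φ.N * 2) + (i.val * 2 + b) by rw [← Nat.mul_assoc]; omega]
  rw [getElem?_flatMap_finRange (fun c' => ?_) c (by omega)]
  · rw [getElem?_flatMap_finRange (m := 2) (fun _ => rfl) i hb]
  · simp [List.length_flatMap]

theorem getD_encode_pos (c : Fin φ.M) (i : Fin φ.N) :
    φ.encode.getD (2 + 2 * (c.val * φ.N + i.val)) 0 = if i ∈ φ.pos c then 1 else 0 := by
  rw [List.getD_eq_getElem?_getD]
  have := φ.getElem?_encode c i (b := 0) (by norm_num)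
  rw [Nat.add_zero] at this
  rw [this]
  simp

theorem getD_encode_neg (c : Fin φ.M) (i : Fin φ.N) :
    φ.encode.getD (2 + 2 * (c.val * φ.N + i.val) + 1) 0 = if i ∈ φ.neg c then 1 else 0 := by
  rw [List.getD_eq_getElem?_getD, φ.getElem?_encode c i (b := 1) (by norm_num)]
  simp

theorem getD_encode_le (a : ℕ) : φ.encode.getD a 0 ≤ φ.N + φ.M + 1 := by
  rw [List.getD_eq_getElem?_getD]
  by_cases h : a < φ.encode.length
  · rw [List.getElem?_eq_getElem h, Option.getD_some]
    have h' := List.getElem_mem h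
    generalize φ.encode[a] = x at h'
    simp only [encode, List.mem_append, List.mem_cons, List.mem_flatMap, List.not_mem_nil,
      or_false] at h'
    rcases h' with (rfl | rfl) | ⟨j, -, i, -, rfl | rfl⟩ <;> first | omega | (split_ifs <;> omega)
  · rw [List.getElem?_eq_none (by omega)]
    simp

theorem unsat_iff {lo cnt X : ℕ} (h : lo + cnt ≤ φ.N) (c : Fin φ.M) :
    WordRAM.Unsat (fun a => φ.encode.getD a 0) φ.N lo cnt X c ↔
      ∀ i : Fin φ.N, lo ≤ i.val → i.val < lo + cnt →
        (X.testBit i = true → i ∉ φ.pos c) ∧ (X.testBit i = false → i ∉ φ.neg c) := by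
  have key : ∀ i : Fin φ.N, φ.encode.getD
      (2 + 2 * (c.val * φ.N + i.val) + 1 - (X.testBit i.val).toNat) 0 = 0 ↔
        (X.testBit i = true → i ∉ φ.pos c) ∧ (X.testBit i = false → i ∉ φ.neg c) := by
    intro i
    cases hX : X.testBit i.val
    · rw [Bool.toNat_false, Nat.sub_zero, getD_encode_neg]
      simp
    · rw [Bool.toNat_true, Nat.add_sub_cancel, getD_encode_pos]
      simp
  constructor
  · intro h' i hi hi'
    have := h' (i - lo) (by omega)
    rw [Nat.add_sub_cancel' hi] at this
    exact (key i).1 this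
  · intro h' j hj
    exact (key ⟨lo + j, by omega⟩).2 (h' ⟨lo + j, by omega⟩ (by simp) (by simpa using hj))

end CNFFormula

/-! ### Compatible vectors and satisfying assignments -/

namespace WordRAM

theorem Setting.unsat_eq_true_iff {E : Setting} {F : ℕ → ℕ} {k i c : ℕ} :
    E.unsat F k i c = true ↔ Unsat F E.N E.lo E.cnt ((k * E.S + i) * E.step) c := by
  classical
  simp [unsat]

namespace Tuning

variable (τ : Tuning) (φ : CNFFormula)

/-- The digits of the first curve. -/
noncomputable def bitP : ℕ → ℕ → ℕ → Bool :=
  (τ.settingP φ.N φ.M).unsat fun a => φ.encode.getD a 0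

/-- The digits of the second curve. -/
noncomputable def bitQ : ℕ → ℕ → ℕ → Bool :=
  (τ.settingQ φ.N φ.M).unsat fun a => φ.encode.getD a 0

theorem bitP_eq_true_iff (k i : ℕ) (c : Fin φ.M) : τ.bitP φ k i c = true ↔
    ∀ x : Fin φ.N, τ.p * τ.level φ.N φ.M ≤ x →
      (((k * τ.vectors φ.N φ.M + i) * τ.vectors φ.N φ.M).testBit x = true → x ∉ φ.pos c) ∧
      (((k * τ.vectors φ.N φ.M + i) * τ.vectors φ.N φ.M).testBit x = false → x ∉ φ.neg c) := by
  rw [bitP, Setting.unsat_eq_true_iff]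
  refine (φ.unsat_iff (by simp only [settingP]; omega) c).trans ?_
  simp only [settingP]
  refine forall_congr' fun x => ?_
  have hx := x.isLt
  exact ⟨fun h h' => h (by omega) (by omega), fun h h' _ => h (by omega)⟩

theorem bitQ_eq_true_iff (k j : ℕ) (c : Fin φ.M) : τ.bitQ φ k j c = true ↔
    ∀ x : Fin φ.N, x < τ.p * τ.level φ.N φ.M →
      ((k * τ.vectors φ.N φ.M + j).testBit x = true → x ∉ φ.pos c) ∧
      ((k * τ.vectors φ.N φ.M + j).testBit x = false → x ∉ φ.neg c) := by
  rw [bitQ, Setting.unsat_eq_true_iff]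
  refine (φ.unsat_iff (by simp only [settingQ]; omega) c).trans ?_
  simp only [settingQ, Nat.mul_one]
  refine forall_congr' fun x => ?_
  have hx := x.isLt
  exact ⟨fun h h' => h (by omega) (by omega), fun h _ h' => h (by omega)⟩

/-- Low digits come from `j` and high digits from `(k, i)`. A clause that the glued assignment fails
is unsatisfied by both parts, hence a conflict. -/
theorem satisfiable_of_compatible {k i j : ℕ}
    (h : ∀ c < φ.M, ¬ (τ.bitP φ k i c = true ∧ τ.bitQ φ k j c = true)) : φ.Satisfiable := by
  refine ⟨fun x => if x.val < τ.p * τ.level φ.N φ.M then (k * τ.vectors φ.N φ.M + j).testBit x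
    else ((k * τ.vectors φ.N φ.M + i) * τ.vectors φ.N φ.M).testBit x, fun c => ?_⟩
  have := h c c.isLt
  contrapose! this
  obtain ⟨h1, h2⟩ := this
  constructor
  · rw [bitP_eq_true_iff]
    intro x hx
    refine ⟨fun h h' => h1 x h' ?_, fun h h' => h2 x h' ?_⟩ <;> simpa [hx.not_gt] using h
  · rw [bitQ_eq_true_iff]
    intro x hx
    refine ⟨fun h h' => h1 x h' ?_, fun h h' => h2 x h' ?_⟩ <;> simpa [hx] using h

/-- Read a satisfying assignment as a binary number `α`; its digits in base `S` give `j`, then `i`,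
then the location. -/
theorem exists_compatible_of_satisfiable (hN : φ.N ≤ (τ.r + 2 * τ.p) * τ.level φ.N φ.M)
    (h : φ.Satisfiable) : ∃ k i j, k < τ.locations φ.N φ.M ∧ i < τ.vectors φ.N φ.M ∧
      j < τ.vectors φ.N φ.M ∧
      ∀ c < φ.M, ¬ (τ.bitP φ k i c = true ∧ τ.bitQ φ k j c = true) := by
  obtain ⟨a, ha⟩ := h
  set α := Nat.ofBits a with hα
  set S := τ.vectors φ.N φ.M with hS
  have hS0 : 0 < S := τ.vectors_pos _ _
  have hS' : S = 2 ^ (τ.p * τ.level φ.N φ.M) := rfl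
  have hαlt : α < τ.locations φ.N φ.M * S * S := by
    refine (Nat.ofBits_lt_two_pow a).trans_le ?_
    rw [hS', locations, ← pow_add, ← pow_add]
    exact Nat.pow_le_pow_right (by norm_num) (hN.trans (le_of_eq (by ring)))
  have hbit : ∀ x : Fin φ.N, α.testBit x = a x := fun x => by
    rw [hα, Nat.testBit_ofBits_lt a x x.isLt]
  refine ⟨α / S / S, α / S % S, α % S, ?_, Nat.mod_lt _ hS0, Nat.mod_lt _ hS0, ?_⟩
  · rw [Nat.div_lt_iff_lt_mul hS0, Nat.div_lt_iff_lt_mul hS0]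
    exact hαlt
  · rintro c hc ⟨h1, h2⟩
    rw [show c = ((⟨c, hc⟩ : Fin φ.M) : ℕ) from rfl, bitP_eq_true_iff] at h1
    rw [show c = ((⟨c, hc⟩ : Fin φ.M) : ℕ) from rfl, bitQ_eq_true_iff] at h2
    rw [← hS] at h1 h2
    have hP : ∀ x : Fin φ.N, τ.p * τ.level φ.N φ.M ≤ x →
        ((α / S / S * S + α / S % S) * S).testBit x = a x := fun x hx => by
      rw [Nat.div_add_mod', ← hbit, hS', Nat.testBit_mul_two_pow, Nat.testBit_div_two_pow]
      simp [hx]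
    -- Adding a multiple of `S = 2 ^ (p * level)` does not change the digits below `p * level`.
    have hQ : ∀ x : Fin φ.N, x < τ.p * τ.level φ.N φ.M →
        (α / S / S * S + α % S).testBit x = a x := fun x hx => by
      have : (α / S / S * S + α % S) % S = α % S := by
        rw [Nat.mul_add_mod_self_right, Nat.mod_mod]
      rw [← hbit]
      have h3 := congrArg (fun y => y.testBit x) this
      simp only [hS', Nat.testBit_mod_two_pow, hx, decide_true, Bool.true_and] at h3
      rwa [hS']
    have h3 : ∀ x : Fin φ.N, (a x = true → x ∉ φ.pos ⟨c, hc⟩) ∧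
        (a x = false → x ∉ φ.neg ⟨c, hc⟩) := fun x => by
      rcases lt_or_ge x.val (τ.p * τ.level φ.N φ.M) with hx | hx
      · have := h2 x hx
        rwa [hQ x hx] at this
      · have := h1 x hx
        rwa [hP x hx] at this
    rcases ha ⟨c, hc⟩ with ⟨x, hx, hx'⟩ | ⟨x, hx, hx'⟩
    · exact (h3 x).1 hx' hx
    · exact (h3 x).2 hx' hx

end Tuning

end WordRAM

/-! ### The instance produced from a formula and the decision program -/

/-- The grid curve with vertices in the plane spanned by the first two axes. -/
def planarCurve (d : ℕ) (l : List (ℕ × ℕ)) : GridCurve d :=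
  l.map fun q i => if i.val = 0 then q.1 else if i.val = 1 then q.2 else 0

theorem toCurve_planarCurve (d : ℕ) (l : List (ℕ × ℕ)) :
    (planarCurve d l).toCurve = l.map (gridPoint d) := by
  rw [planarCurve, GridCurve.toCurve, List.map_map]
  refine List.map_congr_left fun q _ => ?_
  simp only [Function.comp, gridPoint]
  congr 1
  funext i
  split_ifs <;> simp

theorem flatMap_planarCurve {d : ℕ} (hd : 2 ≤ d) (l : List (ℕ × ℕ)) :
    (planarCurve d l).flatMap List.ofFn = l.flatMap (WordRAM.coords d) := by
  rw [planarCurve, List.flatMap_map]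
  congr 1
  funext q
  obtain ⟨d, rfl⟩ := Nat.exists_eq_add_of_le' hd
  simp [WordRAM.coords, List.ofFn_succ, List.ofFn_const]

theorem encodePair_planarCurve {d : ℕ} (hd : 2 ≤ d) (l l' : List (ℕ × ℕ)) :
    GridCurve.encodePair (planarCurve d l) (planarCurve d l') =
      [l.length, l'.length] ++ l.flatMap (WordRAM.coords d) ++ l'.flatMap (WordRAM.coords d) := by
  rw [GridCurve.encodePair, flatMap_planarCurve hd, flatMap_planarCurve hd]
  simp [planarCurve]

namespace WordRAM

theorem init_eq_emb (w : ℕ) (input : List ℕ) :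
    State.init w input = NState.emb w ⟨fun _ => 0, fun a => input.getD a 0⟩ := rfl

namespace Tuning

variable (τ : Tuning) (φ : CNFFormula)

/-- The first curve for a formula. -/
noncomputable def curveP (d : ℕ) : GridCurve d :=
  planarCurve d (τ.verticesP (fun a => φ.encode.getD a 0) φ.N φ.M)

/-- The second curve for a formula. -/
noncomputable def curveQ (d : ℕ) : GridCurve d :=
  planarCurve d (τ.verticesQ (fun a => φ.encode.getD a 0) φ.N φ.M)

theorem length_curveP (d : ℕ) : (τ.curveP φ d).length = τ.lengthP φ.N φ.M := by
  rw [curveP, planarCurve, List.length_map, length_verticesP]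

theorem length_curveQ (d : ℕ) : (τ.curveQ φ d).length = τ.lengthQ φ.N φ.M := by
  rw [curveQ, planarCurve, List.length_map, length_verticesQ]

theorem toCurve_curveP (d : ℕ) : (τ.curveP φ d).toCurve =
    (pSyms (τ.locations φ.N φ.M) (τ.vectors φ.N φ.M) φ.M).map
      fun p => gridPoint d (p.pos (τ.bitP φ)) := by
  rw [curveP, toCurve_planarCurve, verticesP_eq, List.map_map]; rfl

theorem toCurve_curveQ (d : ℕ) : (τ.curveQ φ d).toCurve =
    (qSyms (τ.locations φ.N φ.M) (τ.vectors φ.N φ.M) φ.M).map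
      fun q => gridPoint d (q.pos (τ.bitQ φ)) := by
  rw [curveQ, toCurve_planarCurve, verticesQ_eq, List.map_map]; rfl

theorem exists_runs_build {w d : ℕ} (hτ : τ.Fits w d φ.N φ.M) (hd : 2 ≤ d)
    (hw : φ.N + φ.M + 1 < 2 ^ w) :
    ∃ t, Runs (τ.build d) (State.init w φ.encode) t
      (State.init w (GridCurve.encodePair (τ.curveP φ d) (τ.curveQ φ d))) ∧
      t ≤ τ.buildTime φ.N φ.M := by
  obtain ⟨t, s, h, ht, hs⟩ := exists_runs_of_wp (τ.wp_build (F := fun a => φ.encode.getD a 0) hτ hd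
    (fun a => (φ.getD_encode_le a).trans_lt hw) (by simp [CNFFormula.encode])
    (by simp [CNFFormula.encode])
    (fun a ha => List.getD_eq_default _ _ (by rwa [φ.length_encode])))
  refine ⟨t, ?_, ht⟩
  rw [init_eq_emb, init_eq_emb, curveP, curveQ, encodePair_planarCurve hd, length_verticesP,
    length_verticesQ, ← hs]
  exact h

/-- The two distances tell whether the formula is satisfiable. -/
theorem frechet_curves {d : ℕ} (hd : 2 ≤ d)
    (hN : φ.N ≤ (τ.r + 2 * τ.p) * τ.level φ.N φ.M)
    {D : Curve d → Curve d → ℝ} (hD : D = Curve.frechetDist ∨ D = Curve.discreteFrechetDist) :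
    (φ.Satisfiable → D (τ.curveP φ d).toCurve (τ.curveQ φ d).toCurve ≤ 100) ∧
    (¬ φ.Satisfiable → 101 ≤ D (τ.curveP φ d).toCurve (τ.curveQ φ d).toCurve) := by
  rw [toCurve_curveP, toCurve_curveQ]
  constructor
  · intro h
    obtain ⟨k, i, j, hk, hi, hj, h⟩ := τ.exists_compatible_of_satisfiable φ hN h
    have := near_frechet_of_compatible (d := d) hk hi hj h
    rcases hD with rfl | rfl
    · exact this.1
    · exact this.2
  · intro h
    -- A formula without clauses is satisfiable, so the gadgets here are nonempty.
    have hM : 0 < φ.M := by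
      by_contra hM
      exact h ⟨fun _ => true, fun c => by have := c.isLt; omega⟩
    have := far_frechet_of_conflicts (d := d) (a := τ.bitP φ) (b := τ.bitQ φ) hd
      (τ.locations_pos φ.N φ.M) (τ.vectors_pos φ.N φ.M) hM (fun k i j _ _ _ => by
        by_contra h'
        push Not at h'
        exact h (τ.satisfiable_of_compatible φ (k := k) (i := i) (j := j)
          fun c hc ⟨h1, h2⟩ => h' c hc h1 h2))
    rcases hD with rfl | rfl
    · exact this.1
    · exact this.2

/-- Decide whether the number computed by the algorithm `p` is less than `101`. -/
def decide (d : ℕ) (p : Prog) : Prog :=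
  .seq (τ.build d) (.seq p (.seq (.op .div 0 0 1) (.seq (.const 1 101) (.op .lt 0 0 1))))

theorem runs_decide {w d t t' : ℕ} {p : Prog} {s₀ s₁ s₂ : State w} (hw : 101 < 2 ^ w)
    (h : Runs (τ.build d) s₀ t s₁) (h' : Runs p s₁ t' s₂) :
    ∃ s, Runs (τ.decide d p) s₀ (t + (t' + 3)) s ∧
      (s.reg 0 ≠ 0 ↔ (s₂.reg 0).toNat / (s₂.reg 1).toNat < 101) := by
  refine ⟨_, .seq h (.seq h' (.seq (.op .div 0 0 1 _) (.seq (.const 1 101 _)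
    (.op .lt 0 0 1 _)))), ?_⟩
  have hw0 : w ≠ 0 := by
    rintro rfl
    norm_num at hw
  simp only [BinOp.eval, Function.update_self, Function.update_of_ne (a := 0) (a' := 1) (by norm_num),
    BitVec.lt_def, BitVec.toNat_udiv, BitVec.toNat_ofNat, Nat.mod_eq_of_lt hw]
  split_ifs with h2 <;> simp [hw0, h2]

end Tuning

end WordRAM

namespace WordRAM

namespace Tuning

/-! ## Bounds for the sizes and the running time -/

variable {τ : Tuning} {N M d : ℕ}

theorem two_pow_size_le (M : ℕ) : 2 ^ Nat.size M ≤ 2 * (M + 1) := by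
  rcases h : Nat.size M with _ | m
  · omega
  · have : 2 ^ m ≤ M := Nat.lt_size.1 (by omega)
    rw [pow_succ]; omega

theorem succ_le_two_pow_size (M : ℕ) : M + 1 ≤ 2 ^ Nat.size M := Nat.lt_size_self M

theorem two_pow_mul_size_le (e M : ℕ) : 2 ^ (e * (Nat.size M + 8)) ≤ (512 * (M + 1)) ^ e := by
  rw [mul_comm, pow_mul]
  refine Nat.pow_le_pow_left ?_ _
  rw [pow_add]
  have := two_pow_size_le M
  omega

theorem level_eq (hτ : τ.N₀ = 8 * τ.C) :
    τ.level N M = N / (τ.r + 2 * τ.p) + τ.C * (Nat.size M + 8) := by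
  rw [level, hτ]; ring

/-- The quotient in `level` is rounded down; the summand `C * (size M + 8) ≥ 1` makes up for it. -/
theorem le_mul_level (hτ : τ.N₀ = 8 * τ.C) (hC : 0 < τ.C) (hp : 0 < τ.p) :
    N ≤ (τ.r + 2 * τ.p) * τ.level N M := by
  have h1 : N < (τ.r + 2 * τ.p) * (N / (τ.r + 2 * τ.p) + 1) :=
    Nat.lt_mul_div_succ N (by omega)
  refine h1.le.trans (Nat.mul_le_mul_left _ ?_)
  rw [level_eq hτ]
  have : 1 ≤ τ.C * (Nat.size M + 8) := Nat.mul_pos hC (by omega)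
  omega

/-- The exponent `(r + 2 * p) * level` exceeds `N` at most by a multiple of `size M + 8`, and `2 ^
(size M + 8)` is at most `512 * (M + 1)`. -/
theorem locations_mul_vectors_mul_vectors_le (hτ : τ.N₀ = 8 * τ.C) :
    τ.locations N M * τ.vectors N M * τ.vectors N M ≤
      2 ^ N * (512 * (M + 1)) ^ ((τ.r + 2 * τ.p) * τ.C) := by
  have h : (τ.r + 2 * τ.p) * τ.level N M ≤
      N + (τ.r + 2 * τ.p) * τ.C * (Nat.size M + 8) := by
    rw [level_eq hτ, mul_add, ← mul_assoc]
    have := Nat.mul_div_le N (τ.r + 2 * τ.p)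
    omega
  calc τ.locations N M * τ.vectors N M * τ.vectors N M
      = 2 ^ ((τ.r + 2 * τ.p) * τ.level N M) := by
        rw [locations, vectors, ← pow_add, ← pow_add]; ring
    _ ≤ 2 ^ (N + (τ.r + 2 * τ.p) * τ.C * (Nat.size M + 8)) :=
        Nat.pow_le_pow_right (by norm_num) h
    _ ≤ _ := by
        rw [pow_add]
        exact Nat.mul_le_mul_left _ (two_pow_mul_size_le _ _)

/-- This controls the time of the construction. Only one of the two vector indices counts, so the
exponent is the fraction `(p + r) / (r + 2 * p)` of `N`, less than `1` because `p` is positive. -/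
theorem locations_mul_vectors_le (hτ : τ.N₀ = 8 * τ.C) (hp : 0 < τ.p) :
    (τ.locations N M : ℝ) * τ.vectors N M ≤
      ((2 : ℝ) ^ ((τ.p + τ.r : ℝ) / (τ.r + 2 * τ.p))) ^ N *
        ((512 * (M + 1)) ^ ((τ.r + 2 * τ.p) * τ.C) : ℕ) := by
  have hq : (0 : ℝ) < τ.r + 2 * τ.p := by positivity
  have h : ((τ.p + τ.r) * τ.level N M : ℝ) ≤
      (τ.p + τ.r : ℝ) / (τ.r + 2 * τ.p) * N + ((τ.p + τ.r) * τ.C * (Nat.size M + 8) : ℕ) := by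
    rw [level_eq hτ]
    have h1 : ((N / (τ.r + 2 * τ.p) : ℕ) : ℝ) ≤ N / (τ.r + 2 * τ.p) := by
      have := Nat.cast_div_le (α := ℝ) (m := N) (n := τ.r + 2 * τ.p)
      push_cast at this ⊢
      exact this
    have h2 : (0 : ℝ) ≤ τ.p + τ.r := by positivity
    have h3 := mul_le_mul_of_nonneg_left h1 h2
    have h4 : (τ.p + τ.r : ℝ) / (τ.r + 2 * τ.p) * N = (τ.p + τ.r) * (N / (τ.r + 2 * τ.p)) := by
      ring
    rw [h4]
    push_cast at h3 ⊢
    linarith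
  calc (τ.locations N M : ℝ) * τ.vectors N M
      = (2 : ℝ) ^ ((τ.p + τ.r) * τ.level N M : ℝ) := by
        have : ((τ.p + τ.r) * τ.level N M : ℝ) = ((τ.r * τ.level N M + τ.p * τ.level N M : ℕ) : ℝ) := by
          push_cast; ring
        rw [this, Real.rpow_natCast, locations, vectors, pow_add]; push_cast; rfl
    _ ≤ (2 : ℝ) ^ ((τ.p + τ.r : ℝ) / (τ.r + 2 * τ.p) * N +
          ((τ.p + τ.r) * τ.C * (Nat.size M + 8) : ℕ)) :=
        Real.rpow_le_rpow_of_exponent_le (by norm_num) h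
    _ = ((2 : ℝ) ^ ((τ.p + τ.r : ℝ) / (τ.r + 2 * τ.p))) ^ N *
          ((2 ^ ((τ.p + τ.r) * τ.C * (Nat.size M + 8)) : ℕ) : ℝ) := by
        rw [Real.rpow_add (by norm_num), Real.rpow_mul (by norm_num), Real.rpow_natCast,
          Real.rpow_natCast]
        push_cast; rfl
    _ ≤ _ := by
        refine mul_le_mul_of_nonneg_left ?_ (by positivity)
        exact_mod_cast (two_pow_mul_size_le _ _).trans (Nat.pow_le_pow_right (by omega)
          (Nat.mul_le_mul_right _ (by omega)))

theorem lengthP_le : τ.lengthP N M ≤ 13 * (M + 1) * (τ.locations N M * τ.vectors N M) := by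
  have hS := τ.vectors_pos N M
  unfold lengthP
  calc _ ≤ τ.locations N M * (13 * (M + 1) * τ.vectors N M) :=
        Nat.mul_le_mul_left _ (by nlinarith)
    _ = _ := by ring

theorem lengthQ_le : τ.lengthQ N M ≤ 13 * (M + 1) * (τ.locations N M * τ.vectors N M) := by
  have hS := τ.vectors_pos N M
  have hK := τ.locations_pos N M
  unfold lengthQ
  calc _ ≤ τ.locations N M * (τ.vectors N M * (4 * M + 1) + 6 + 6) := by nlinarith
    _ ≤ τ.locations N M * (13 * (M + 1) * τ.vectors N M) :=
        Nat.mul_le_mul_left _ (by nlinarith)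
    _ = _ := by ring

theorem le_lengthP : τ.locations N M * τ.vectors N M ≤ τ.lengthP N M := by
  unfold lengthP
  exact Nat.mul_le_mul_left _ (by nlinarith)

theorem buildTime_le : τ.buildTime N M ≤
    600 * (N + M + 1) ^ 2 * (τ.locations N M * τ.vectors N M) := by
  have hS := τ.vectors_pos N M
  have hK := τ.locations_pos N M
  have hKS : 1 ≤ τ.locations N M * τ.vectors N M := Nat.mul_pos hK hS
  have hsz : Nat.size M ≤ M := Nat.size_le.2 Nat.lt_two_pow_self
  have h1 : τ.locations N M * (τ.vectors N M * (32 * M * N + 126 * M + 62) + 130) ≤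
      τ.locations N M * τ.vectors N M * (32 * M * N + 126 * M + 192) := by
    calc _ ≤ τ.locations N M * (τ.vectors N M * (32 * M * N + 126 * M + 192)) :=
          Nat.mul_le_mul_left _ (by nlinarith)
      _ = _ := by ring
  have h2 : 3 * M + 32 * (N * M) + 300 ≤
      τ.locations N M * τ.vectors N M * (3 * M + 32 * (N * M) + 300) :=
    Nat.le_mul_of_pos_left _ hKS
  unfold buildTime
  calc _ ≤ τ.locations N M * τ.vectors N M * (32 * M * N + 126 * M + 192) +
        τ.locations N M * τ.vectors N M * (3 * M + 32 * (N * M) + 300) := by omega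
    _ = τ.locations N M * τ.vectors N M * (64 * (M * N) + 129 * M + 492) := by ring
    _ ≤ τ.locations N M * τ.vectors N M * (600 * (N + M + 1) ^ 2) :=
        Nat.mul_le_mul_left _ (by nlinarith [Nat.zero_le (M * N)])
    _ = _ := by ring

/-- A power of `2 ^ N + M + 1` that bounds all numbers in the construction. -/
def wordExponent (τ : Tuning) (d : ℕ) : ℕ :=
  d + 11 * ((τ.r + 2 * τ.p) * τ.C) + (τ.r + 2 * τ.p) + 20

/-- Polynomial bounds in `y = 2 ^ N + M + 1` are all that matters, as the decision program may
choose its word length constant; numerical factors become powers of `y` because `y ≥ 2`. -/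
theorem pow_wordExponent_bounds (hτ : τ.N₀ = 8 * τ.C) :
    τ.r + 2 * τ.p ≤ (2 ^ N + M + 1) ^ τ.wordExponent d ∧
    τ.locations N M * τ.vectors N M * τ.vectors N M ≤ (2 ^ N + M + 1) ^ τ.wordExponent d ∧
    2 * τ.offset d N M + 140 * τ.locations N M + 175 ≤
      (2 ^ N + M + 1) ^ τ.wordExponent d ∧
    101 + N + M + 1 ≤ (2 ^ N + M + 1) ^ τ.wordExponent d := by
  set y := 2 ^ N + M + 1 with hy
  set e := (τ.r + 2 * τ.p) * τ.C with he
  have hS := τ.vectors_pos N M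
  have hK := τ.locations_pos N M
  have h2N := Nat.one_le_two_pow (n := N)
  have hN : N < 2 ^ N := Nat.lt_two_pow_self
  have hy2 : 2 ≤ y := by omega
  have hpow : ∀ k, 2 ^ k ≤ y ^ k := fun k => Nat.pow_le_pow_left hy2 k
  have hmono : ∀ {a b}, a ≤ b → y ^ a ≤ y ^ b := fun h => Nat.pow_le_pow_right (by omega) h
  have hU : τ.locations N M * τ.vectors N M * τ.vectors N M ≤ y ^ (1 + 10 * e) := by
    refine (locations_mul_vectors_mul_vectors_le hτ).trans ?_
    rw [pow_add, pow_one]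
    refine Nat.mul_le_mul (by omega) ?_
    rw [← he, pow_mul y 10 e]
    refine Nat.pow_le_pow_left ?_ _
    calc 512 * (M + 1) ≤ y ^ 9 * y := Nat.mul_le_mul (hpow 9) (by omega)
      _ = y ^ 10 := by ring
  have hKS : τ.locations N M * τ.vectors N M ≤ y ^ (1 + 10 * e) :=
    (Nat.le_mul_of_pos_right _ hS).trans hU
  have hKU : τ.locations N M ≤ y ^ (1 + 10 * e) := (Nat.le_mul_of_pos_right _ hS).trans hKS
  have hE : τ.wordExponent d = d + 11 * e + (τ.r + 2 * τ.p) + 20 := rfl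
  refine ⟨?_, hU.trans (hmono (by omega)), ?_, ?_⟩
  · calc τ.r + 2 * τ.p ≤ 2 ^ (τ.r + 2 * τ.p) := Nat.lt_two_pow_self.le
      _ ≤ y ^ (τ.r + 2 * τ.p) := hpow _
      _ ≤ _ := hmono (by omega)
  · have h1 : d * (τ.lengthP N M + τ.lengthQ N M) ≤ y ^ (d + 10 * e + 7) := by
      calc d * (τ.lengthP N M + τ.lengthQ N M)
          ≤ y ^ d * (y ^ 5 * y * y ^ (1 + 10 * e)) := by
            refine Nat.mul_le_mul (Nat.lt_two_pow_self.le.trans (hpow d)) ?_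
            have h3 := (lengthP_le (τ := τ) (N := N) (M := M))
            have h4 := (lengthQ_le (τ := τ) (N := N) (M := M))
            calc _ ≤ 32 * (M + 1) * (τ.locations N M * τ.vectors N M) := by linarith
              _ ≤ _ := Nat.mul_le_mul (Nat.mul_le_mul (hpow 5) (by omega)) hKS
        _ = _ := by ring
    have h2 : N * M ≤ y ^ 2 := by rw [sq]; exact Nat.mul_le_mul (by omega) (by omega)
    have h3 := hmono (show 2 ≤ d + 10 * e + 7 by omega)
    have h4 := hmono (show 1 + 10 * e ≤ d + 10 * e + 7 by omega)
    have h5 : 1 ≤ y ^ (d + 10 * e + 7) := Nat.one_le_pow _ _ (by omega)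
    calc 2 * τ.offset d N M + 140 * τ.locations N M + 175
        ≤ 512 * y ^ (d + 10 * e + 7) := by unfold offset; omega
      _ ≤ y ^ 9 * y ^ (d + 10 * e + 7) := Nat.mul_le_mul_right _ (hpow 9)
      _ = y ^ (9 + (d + 10 * e + 7)) := by rw [← pow_add]
      _ ≤ _ := hmono (by omega)
  · calc 101 + N + M + 1 ≤ 2 ^ 7 * y := by omega
      _ ≤ y ^ 7 * y := Nat.mul_le_mul_right _ (hpow 7)
      _ = y ^ 8 := by ring
      _ ≤ _ := hmono (by omega)

theorem fits_of_le {w : ℕ} (hτ : τ.N₀ = 8 * τ.C)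
    (hw : (2 ^ N + M + 1) ^ τ.wordExponent d < 2 ^ w) : τ.Fits w d N M := by
  obtain ⟨h1, h2, h3, h4⟩ := pow_wordExponent_bounds (d := d) (N := N) (M := M) hτ
  have hS := τ.vectors_pos N M
  have hK := τ.locations_pos N M
  have hKS : τ.locations N M * τ.vectors N M ≤
      τ.locations N M * τ.vectors N M * τ.vectors N M := Nat.le_mul_of_pos_right _ hS
  have h5 : τ.locations N M ≤ τ.locations N M * τ.vectors N M := Nat.le_mul_of_pos_right _ hS
  have h6 : τ.vectors N M ≤ τ.locations N M * τ.vectors N M := Nat.le_mul_of_pos_left _ hK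
  have h7 : τ.p * τ.level N M < τ.vectors N M := Nat.lt_two_pow_self
  have h8 : τ.r * τ.level N M < τ.locations N M := Nat.lt_two_pow_self
  constructor <;> omega

/-- The entries of the input for the curves are small. -/
theorem entry_add_length_le (hτ : τ.N₀ = 8 * τ.C) (hd : 2 ≤ d) (φ : CNFFormula) :
    ∀ x ∈ GridCurve.encodePair (τ.curveP φ d) (τ.curveQ φ d),
      x + (GridCurve.encodePair (τ.curveP φ d) (τ.curveQ φ d)).length ≤
        (2 ^ φ.N + φ.M + 1) ^ τ.wordExponent d := by
  have h3 := (pow_wordExponent_bounds (d := d) (N := φ.N) (M := φ.M) hτ).2.2.1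
  have hK := τ.locations_pos φ.N φ.M
  have hl : (GridCurve.encodePair (τ.curveP φ d) (τ.curveQ φ d)).length ≤
      τ.offset d φ.N φ.M := by
    rw [curveP, curveQ, encodePair_planarCurve hd, List.length_append, List.length_append,
      length_flatMap_coords hd, length_flatMap_coords hd, length_verticesP, length_verticesQ,
      offset, mul_add]
    simp only [List.length_cons, List.length_nil]
    omega
  have hoff : τ.lengthP φ.N φ.M + τ.lengthQ φ.N φ.M ≤ τ.offset d φ.N φ.M := by
    unfold offset; nlinarith
  intro x hx
  suffices h : x ≤ τ.offset d φ.N φ.M ∨ x ≤ 140 * τ.locations φ.N φ.M + 175 by omega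
  rw [curveP, curveQ, encodePair_planarCurve hd, length_verticesP, length_verticesQ] at hx
  have hcoords : ∀ q : ℕ × ℕ, q.1 ≤ 140 * τ.locations φ.N φ.M + 140 → q.2 ≤ 175 →
      x ∈ coords d q → x ≤ 140 * τ.locations φ.N φ.M + 175 := by
    intro q h1 h2 hx
    simp only [coords, List.mem_cons, List.mem_replicate] at hx
    omega
  simp only [List.mem_append, List.mem_cons, List.not_mem_nil, or_false, List.mem_flatMap] at hx
  rcases hx with ((rfl | rfl) | ⟨q, hq, hx⟩) | ⟨q, hq, hx⟩
  · omega
  · omega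
  · rw [verticesP_eq] at hq
    obtain ⟨p, hp, rfl⟩ := List.mem_map.1 hq
    obtain ⟨k, hk, hp⟩ := List.mem_flatMap.1 hp
    have := pos_of_mem_pBlock (a := (τ.settingP φ.N φ.M).unsat fun a => φ.encode.getD a 0) hp
    have := List.mem_range.1 hk
    exact Or.inr (hcoords _ (by omega) (by omega) hx)
  · rw [verticesQ_eq] at hq
    obtain ⟨p, hp, rfl⟩ := List.mem_map.1 hq
    rcases List.mem_append.1 hp with hp | hp
    · obtain ⟨k, hk, hp⟩ := List.mem_flatMap.1 hp
      have := pos_of_mem_qBlock (b := (τ.settingQ φ.N φ.M).unsat fun a => φ.encode.getD a 0) hp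
      have := List.mem_range.1 hk
      exact Or.inr (hcoords _ (by omega) (by omega) hx)
    · have := pos_of_mem_qBlock (b := (τ.settingQ φ.N φ.M).unsat fun a => φ.encode.getD a 0) hp
      exact Or.inr (hcoords _ (by omega) (by omega) hx)

end Tuning

end WordRAM

/-! ### The exponent of the packedness -/

namespace WordRAM

namespace Tuning

/-- The constants for a rational exponent of the packedness between two real numbers. -/
theorem exists_tuning {x y : ℝ} (hx : 0 ≤ x) (hxy : x < y) (hy : y ≤ 1) :
    ∃ τ : Tuning, 0 < τ.p ∧ 0 < τ.r ∧ 0 < τ.C ∧ τ.N₀ = 8 * τ.C ∧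
      1 ≤ τ.C * (τ.p - (τ.p + τ.r) * x) ∧ 1 ≤ τ.C * ((τ.p + τ.r) * y - τ.p) := by
  obtain ⟨θ, h1, h2⟩ := exists_rat_btwn hxy
  have hθ0 : 0 < θ := by exact_mod_cast hx.trans_lt h1
  have hθ1 : θ < 1 := by exact_mod_cast h2.trans_le hy
  -- `θ = p / (p + r)` with `p` its numerator and `r` its denominator minus `p`; `C` is then taken
  -- large enough to scale both gaps to at least `1`.
  obtain ⟨p, hp⟩ := Int.eq_ofNat_of_zero_le (Rat.num_pos.2 hθ0).le
  have hp0 : 0 < p := by have := Rat.num_pos.2 hθ0; omega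
  have hpd : p < θ.den := by
    have := Rat.num_lt_denom_iff.2 hθ1
    omega
  have hden : (0 : ℝ) < θ.den := by exact_mod_cast θ.pos
  have hθ : (θ : ℝ) * θ.den = p := by
    have h3 := Rat.mul_den_eq_num θ
    rw [hp] at h3
    exact_mod_cast h3
  have e1 : 0 < (p : ℝ) - θ.den * x := by rw [← hθ]; nlinarith
  have e2 : 0 < θ.den * y - (p : ℝ) := by rw [← hθ]; nlinarith
  obtain ⟨C, hC⟩ := exists_nat_gt (max (1 / ((p : ℝ) - θ.den * x)) (1 / (θ.den * y - (p : ℝ))))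
  have hC1 := (le_max_left _ _).trans_lt hC
  have hC2 := (le_max_right _ _).trans_lt hC
  have hC0 : 0 < C := by
    have : (0 : ℝ) < C := lt_trans (by positivity) hC1
    exact_mod_cast this
  have hsum : (p : ℝ) + (θ.den - p : ℕ) = θ.den := by
    rw [Nat.cast_sub hpd.le]; ring
  refine ⟨⟨p, θ.den - p, C, 8 * C⟩, hp0, by simp only; omega, hC0, rfl, ?_, ?_⟩
  · simp only [hsum]
    exact ((div_lt_iff₀ e1).1 hC1).le
  · simp only [hsum]
    exact ((div_lt_iff₀ e2).1 hC2).le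

variable {τ : Tuning} {N M d : ℕ}

theorem cast_locations_mul_vectors_le (hτ : τ.N₀ = 8 * τ.C) (hp : 0 < τ.p) :
    (τ.locations N M : ℝ) * τ.vectors N M ≤
      ((2 : ℝ) ^ ((τ.p + τ.r : ℝ) / (τ.r + 2 * τ.p))) ^ N *
        (512 * ((M : ℝ) + 1)) ^ ((τ.r + 2 * τ.p) * τ.C) := by
  have := locations_mul_vectors_le (N := N) (M := M) hτ hp
  push_cast at this
  exact this

theorem cast_locations_mul_vectors_mul_vectors_le (hτ : τ.N₀ = 8 * τ.C) :
    (τ.locations N M : ℝ) * τ.vectors N M * τ.vectors N M ≤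
      2 ^ N * (512 * ((M : ℝ) + 1)) ^ ((τ.r + 2 * τ.p) * τ.C) := by
  exact_mod_cast locations_mul_vectors_mul_vectors_le (N := N) (M := M) hτ

theorem cast_buildTime_le : (τ.buildTime N M : ℝ) ≤
    600 * ((N : ℝ) + M + 1) ^ 2 * (τ.locations N M * τ.vectors N M) := by
  exact_mod_cast buildTime_le (τ := τ) (N := N) (M := M)

theorem add_eight_le_mul_level {e : ℝ} (hτ : τ.N₀ = 8 * τ.C) (he : 1 ≤ τ.C * e) :
    (Nat.size M + 8 : ℝ) ≤ e * τ.level N M := by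
  have he0 : 0 ≤ e := by
    by_contra h
    have : (0 : ℝ) ≤ τ.C := by positivity
    nlinarith
  have h : ((τ.C * (Nat.size M + 8) : ℕ) : ℝ) ≤ τ.level N M := by
    rw [level_eq hτ]
    exact_mod_cast Nat.le_add_left _ _
  push_cast at h
  have h1 := mul_le_mul_of_nonneg_left h he0
  have h2 := mul_le_mul_of_nonneg_right he (show (0 : ℝ) ≤ Nat.size M + 8 by positivity)
  nlinarith

/-- A gap `e` in the exponent, multiplied by the level, pays for a factor linear in `M`. It is used
with the gaps of `p` to `(p + r) * x` and to `(p + r) * y`. -/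
theorem mul_succ_le_rpow {e : ℝ} (hτ : τ.N₀ = 8 * τ.C) (he : 1 ≤ τ.C * e) :
    (256 : ℝ) * (M + 1) ≤ 2 ^ (e * τ.level N M) := by
  calc (256 : ℝ) * (M + 1) ≤ 256 * 2 ^ Nat.size M := by
        have := succ_le_two_pow_size M
        gcongr
        exact_mod_cast this
    _ = 2 ^ (Nat.size M + 8 : ℝ) := by
        rw [Real.rpow_add (by norm_num), Real.rpow_natCast]
        norm_num
        ring
    _ ≤ _ := Real.rpow_le_rpow_of_exponent_le (by norm_num) (add_eight_le_mul_level hτ he)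

/-- The packedness of the two curves is in the given range. -/
theorem packedness_bounds {x y n c : ℝ} {φ : CNFFormula} (hd : 2 ≤ d) (hx : 0 ≤ x) (hx1 : x ≤ 1)
    (hy : 0 ≤ y) (hτ : τ.N₀ = 8 * τ.C) (h1 : 1 ≤ τ.C * (τ.p - (τ.p + τ.r) * x))
    (h2 : 1 ≤ τ.C * ((τ.p + τ.r) * y - τ.p))
    (hn : n = max (τ.curveP φ d).length (τ.curveQ φ d).length)
    (hc : Curve.IsPackedness c (τ.curveP φ d).toCurve (τ.curveQ φ d).toCurve) :
    n ^ x ≤ c ∧ c ≤ n ^ y ∧ 1 ≤ n ∧ 1 ≤ c ∧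
      c * n ≤ 1872 * ((φ.M : ℝ) + 1) ^ 2 *
        (2 ^ φ.N * (512 * ((φ.M : ℝ) + 1)) ^ ((τ.r + 2 * τ.p) * τ.C)) := by
  have hS := τ.vectors_pos φ.N φ.M
  have hK := τ.locations_pos φ.N φ.M
  have hS' : (1 : ℝ) ≤ τ.vectors φ.N φ.M := by exact_mod_cast hS
  have hK' : (1 : ℝ) ≤ τ.locations φ.N φ.M := by exact_mod_cast hK
  have hcS : (τ.vectors φ.N φ.M : ℝ) ≤ 10 * c := by
    have := hc.1.1
    rw [toCurve_curveP] at this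
    exact le_of_isPacked_pSyms hd hK this
  have hcM : c ≤ 144 * (φ.M + 1) * τ.vectors φ.N φ.M := by
    refine (hc.2 ⟨by rw [toCurve_curveP]; exact isPacked_pSyms hd,
      by rw [toCurve_curveQ]; exact isPacked_qSyms hd⟩).trans ?_
    push_cast
    nlinarith [show (0 : ℝ) ≤ φ.M from Nat.cast_nonneg _]
  rw [length_curveP, length_curveQ] at hn
  have hnl : (τ.locations φ.N φ.M : ℝ) * τ.vectors φ.N φ.M ≤ n := by
    rw [hn]
    exact_mod_cast le_lengthP.trans (le_max_left _ _)
  have hnu : n ≤ 13 * (φ.M + 1) * (τ.locations φ.N φ.M * τ.vectors φ.N φ.M) := by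
    rw [hn]
    exact_mod_cast max_le lengthP_le lengthQ_le
  have hKS : (τ.locations φ.N φ.M : ℝ) * τ.vectors φ.N φ.M =
      2 ^ ((τ.p + τ.r : ℝ) * τ.level φ.N φ.M) := by
    rw [locations, vectors, ← Nat.cast_mul, ← pow_add, ← Nat.cast_add, ← Nat.cast_mul,
      Real.rpow_natCast, ← add_mul, add_comm τ.r]
    push_cast
    rfl
  have hS2 : (τ.vectors φ.N φ.M : ℝ) = 2 ^ ((τ.p : ℝ) * τ.level φ.N φ.M) := by
    rw [vectors, Nat.cast_pow, ← Nat.cast_mul, Real.rpow_natCast]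
    norm_num
  have hKS1 : (1 : ℝ) ≤ τ.locations φ.N φ.M * τ.vectors φ.N φ.M := by nlinarith
  have hM0 : (0 : ℝ) ≤ φ.M := Nat.cast_nonneg _
  -- `n ^ x` loses at most a factor `13 * (M + 1)` because `x ≤ 1`, and `c` loses a factor `10`
  -- against `S`; the gap yields `256 * (M + 1)`, more than the product of the two.
  have hx' : n ^ x ≤ c := by
    have h3 := mul_succ_le_rpow (N := φ.N) (M := φ.M) hτ h1
    have h4 : n ^ x ≤ 13 * (φ.M + 1) * 2 ^ ((τ.p + τ.r : ℝ) * x * τ.level φ.N φ.M) := by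
      calc n ^ x ≤ (13 * (φ.M + 1) * (τ.locations φ.N φ.M * τ.vectors φ.N φ.M)) ^ x :=
            Real.rpow_le_rpow (by linarith) hnu hx
        _ = (13 * (φ.M + 1)) ^ x * (τ.locations φ.N φ.M * τ.vectors φ.N φ.M) ^ x :=
            Real.mul_rpow (by positivity) (by positivity)
        _ ≤ (13 * (φ.M + 1)) * (τ.locations φ.N φ.M * τ.vectors φ.N φ.M) ^ x := by
            gcongr
            refine (Real.rpow_le_rpow_of_exponent_le (by linarith) hx1).trans ?_
            rw [Real.rpow_one]
        _ = _ := by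
            rw [hKS, ← Real.rpow_mul (by norm_num)]
            congr 2
            ring
    have h5 : (2 : ℝ) ^ ((τ.p : ℝ) * τ.level φ.N φ.M) =
        2 ^ ((τ.p - (τ.p + τ.r) * x) * τ.level φ.N φ.M) *
          2 ^ ((τ.p + τ.r : ℝ) * x * τ.level φ.N φ.M) := by
      rw [← Real.rpow_add (by norm_num)]
      congr 1
      ring
    have h6 : (0 : ℝ) < 2 ^ ((τ.p + τ.r : ℝ) * x * τ.level φ.N φ.M) := by positivity
    rw [hS2, h5] at hcS
    nlinarith
  refine ⟨hx', ?_, hKS1.trans hnl, ?_, ?_⟩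
  · have h3 := mul_succ_le_rpow (N := φ.N) (M := φ.M) hτ h2
    have h5 : (2 : ℝ) ^ (((τ.p + τ.r) * y - τ.p) * τ.level φ.N φ.M) * τ.vectors φ.N φ.M =
        (τ.locations φ.N φ.M * τ.vectors φ.N φ.M) ^ y := by
      rw [hKS, hS2, ← Real.rpow_mul (by norm_num), ← Real.rpow_add (by norm_num)]
      congr 1
      ring
    calc c ≤ 256 * (φ.M + 1) * τ.vectors φ.N φ.M := by nlinarith
      _ ≤ 2 ^ (((τ.p + τ.r) * y - τ.p) * τ.level φ.N φ.M) * τ.vectors φ.N φ.M := by gcongr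
      _ = _ := h5
      _ ≤ n ^ y := Real.rpow_le_rpow (by linarith) hnl hy
  · refine le_trans ?_ hx'
    exact Real.one_le_rpow (hKS1.trans hnl) hx
  · calc c * n ≤ (144 * (φ.M + 1) * τ.vectors φ.N φ.M) *
          (13 * (φ.M + 1) * (τ.locations φ.N φ.M * τ.vectors φ.N φ.M)) :=
          mul_le_mul hcM hnu (by linarith) (by positivity)
      _ = 1872 * ((φ.M : ℝ) + 1) ^ 2 *
          (τ.locations φ.N φ.M * τ.vectors φ.N φ.M * τ.vectors φ.N φ.M) := by ring
      _ ≤ _ := mul_le_mul_of_nonneg_left (cast_locations_mul_vectors_mul_vectors_le hτ)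
          (by positivity)

end Tuning

end WordRAM

/-! ### From an approximation algorithm to deciding satisfiability -/

/-- The time for the construction and for the algorithm on the constructed curves. -/
theorem time_le {t₁ t₂ A m B e β c n k₀ : ℝ} {N g K L : ℕ} (hm1 : 1 ≤ m)
    (he0 : 0 ≤ e) (he : e ≤ 1) (hB0 : 0 ≤ B) (hB : B ≤ β) (he2 : 2 ^ e ≤ β) (hβ : 1 ≤ β)
    (h₁ : t₁ ≤ 600 * m ^ 2 * k₀) (hk : k₀ ≤ B ^ N * (512 * A) ^ g) (hA : 1 ≤ A) (hAm : A ≤ m)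
    (hcn0 : 0 ≤ c * n) (hcn : c * n ≤ 1872 * A ^ 2 * (2 ^ N * (512 * A) ^ g))
    (h₂ : t₂ ≤ K * (c * n) ^ e) (hL1 : (600 + K * 1872) * 512 ^ g + 3 ≤ L) (hL2 : g + 2 ≤ L) :
    t₁ + (t₂ + 3) ≤ L * m ^ L * β ^ N := by
  have hβN : 1 ≤ β ^ N := one_le_pow₀ hβ
  have hA' : (512 * A) ^ g ≤ 512 ^ g * m ^ g := by rw [← mul_pow]; gcongr
  have hZ : 1 ≤ 1872 * A ^ 2 * (512 * A) ^ g := by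
    have : (1 : ℝ) ≤ (512 * A) ^ g := one_le_pow₀ (by linarith)
    nlinarith
  have e1 : t₁ ≤ 600 * 512 ^ g * m ^ (g + 2) * β ^ N := by
    calc t₁ ≤ 600 * m ^ 2 * (β ^ N * (512 ^ g * m ^ g)) := by
          refine h₁.trans (mul_le_mul_of_nonneg_left (hk.trans ?_) (by positivity))
          gcongr
      _ = _ := by ring
  have e2 : (c * n) ^ e ≤ 1872 * 512 ^ g * m ^ (g + 2) * β ^ N := by
    calc (c * n) ^ e ≤ (1872 * A ^ 2 * (512 * A) ^ g * 2 ^ N) ^ e :=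
          Real.rpow_le_rpow hcn0 (hcn.trans (le_of_eq (by ring))) he0
      _ = (1872 * A ^ 2 * (512 * A) ^ g) ^ e * (2 ^ e) ^ N := by
          rw [Real.mul_rpow (by positivity) (by positivity), ← Real.rpow_natCast 2 N,
            ← Real.rpow_natCast (2 ^ e) N, ← Real.rpow_mul (by norm_num),
            ← Real.rpow_mul (by norm_num), mul_comm (N : ℝ)]
      _ ≤ (1872 * m ^ 2 * (512 ^ g * m ^ g)) * β ^ N := by
          have : (1872 * A ^ 2 * (512 * A) ^ g) ^ e ≤ 1872 * m ^ 2 * (512 ^ g * m ^ g) := by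
            refine (Real.rpow_le_rpow_of_exponent_le hZ he).trans ?_
            rw [Real.rpow_one]
            gcongr
          gcongr
      _ = _ := by ring
  have e3 : t₂ ≤ K * (1872 * 512 ^ g * m ^ (g + 2) * β ^ N) :=
    h₂.trans (mul_le_mul_of_nonneg_left e2 (Nat.cast_nonneg _))
  have e4 : (1 : ℝ) ≤ m ^ (g + 2) := one_le_pow₀ hm1
  have e5 : (1 : ℝ) ≤ m ^ (g + 2) * β ^ N := one_le_mul_of_one_le_of_one_le e4 hβN
  have e6 : m ^ (g + 2) ≤ m ^ L := pow_le_pow_right₀ hm1 hL2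
  have e7 : (((600 + K * 1872) * 512 ^ g + 3 : ℕ) : ℝ) ≤ L := by exact_mod_cast hL1
  push_cast at e7
  calc t₁ + (t₂ + 3) ≤ ((600 + K * 1872) * 512 ^ g + 3) * (m ^ (g + 2) * β ^ N) := by linarith
    _ ≤ L * (m ^ L * β ^ N) := by gcongr
    _ = _ := by ring

open WordRAM Tuning in
/-- An approximation algorithm decides satisfiability. -/
theorem not_SETHprime_of_hasApproxAlgorithm {d : ℕ} (hd : 2 ≤ d) {D : Curve d → Curve d → ℝ}
    (hD : D = Curve.frechetDist ∨ D = Curve.discreteFrechetDist) {x y e : ℝ} (hx : 0 ≤ x)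
    (hxy : x < y) (hy : y ≤ 1) (he0 : 0 ≤ e) (he : e < 1)
    {T : ℝ → ℝ → ℝ} (hT : ∀ n c, 1 ≤ n → 1 ≤ c → T n c ≤ (c * n) ^ e)
    (h : HasApproxAlgorithm d D 1.001 (fun n c => n ^ x ≤ c ∧ c ≤ n ^ y) T) : ¬ SETHprime := by
  obtain ⟨p, K, κ, h⟩ := h
  obtain ⟨τ, hp, hr, hC, hτ, hτx, hτy⟩ := exists_tuning hx hxy hy
  -- The larger of two growth rates per variable: the algorithm's, from `c * n` being about `2 ^ N`,
  -- and that of the construction.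
  set β : ℝ := max (2 ^ e) (2 ^ ((τ.p + τ.r : ℝ) / (τ.r + 2 * τ.p))) with hβ
  have hp' : (0 : ℝ) < τ.p := by exact_mod_cast hp
  have hβ1 : 1 ≤ β := le_max_of_le_left (Real.one_le_rpow (by norm_num) he0)
  have hβ2 : β < 2 := by
    refine max_lt ?_ ?_
    · calc (2 : ℝ) ^ e < 2 ^ (1 : ℝ) := Real.rpow_lt_rpow_of_exponent_lt (by norm_num) he
        _ = 2 := Real.rpow_one 2
    · calc (2 : ℝ) ^ ((τ.p + τ.r : ℝ) / (τ.r + 2 * τ.p)) < 2 ^ (1 : ℝ) := by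
            refine Real.rpow_lt_rpow_of_exponent_lt (by norm_num) ?_
            rw [div_lt_one (by positivity)]
            linarith
        _ = 2 := Real.rpow_one 2
  obtain ⟨L, hL1, hL2⟩ : ∃ L, (600 + K * 1872) * 512 ^ ((τ.r + 2 * τ.p) * τ.C) + 3 ≤ L ∧
      (τ.r + 2 * τ.p) * τ.C + 2 ≤ L :=
    ⟨_, le_max_left _ _, le_max_right _ _⟩
  -- The factor `κ + 2` serves twice: being at least `κ` it meets the algorithm's demand on the word
  -- length, and exceeding `1` it makes the bound for the construction strict.
  refine not_not.2 ⟨2 - β, by linarith, by linarith, τ.decide d p, L,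
    τ.wordExponent d * (κ + 2), fun φ w hw => ?_⟩
  set z := 2 ^ φ.N + φ.M + 1 with hz
  have hz2 : 2 ≤ z := by have := Nat.one_le_two_pow (n := φ.N); omega
  have hE : 0 < τ.wordExponent d := by unfold wordExponent; omega
  have hw1 : z ^ τ.wordExponent d < 2 ^ w :=
    (Nat.pow_lt_pow_right hz2 (lt_mul_of_one_lt_right hE (by omega))).trans_le hw
  have hw2 := (pow_wordExponent_bounds (d := d) (N := φ.N) (M := φ.M) hτ).2.2.2
  rw [← hz] at hw2
  obtain ⟨t₁, hrun₁, ht₁⟩ := τ.exists_runs_build φ (fits_of_le hτ hw1) hd (by omega)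
  have hne : τ.curveP φ d ≠ [] ∧ τ.curveQ φ d ≠ [] := by
    have h1 := τ.length_curveP φ d
    have h2 := τ.length_curveQ φ d
    constructor <;> intro h0
    · rw [h0, List.length_nil, lengthP] at h1
      have := τ.locations_pos φ.N φ.M
      simp at h1
      omega
    · rw [h0, List.length_nil, lengthQ] at h2
      omega
  obtain ⟨c, hc⟩ : ∃ c, Curve.IsPackedness c (τ.curveP φ d).toCurve (τ.curveQ φ d).toCurve := by
    rw [toCurve_curveP, toCurve_curveQ]
    exact Curve.exists_isPackedness (isPacked_pSyms hd) (isPacked_qSyms hd)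
  obtain ⟨b1, b2, b3, b4, b5⟩ := packedness_bounds hd hx (hxy.le.trans hy) (hx.trans hxy.le) hτ
    hτx hτy rfl hc
  obtain ⟨t₂, s, hrun₂, ht₂, hs1, hs2, hs3⟩ := h _ _ hne.1 hne.2 _ c rfl hc ⟨b1, b2⟩ w
    (fun a ha => by
      refine (Nat.pow_le_pow_left (entry_add_length_le hτ hd φ a ha) κ).trans ?_
      rw [← pow_mul]
      exact (Nat.pow_le_pow_right (by omega) (Nat.mul_le_mul_left _ (by omega))).trans hw)
  obtain ⟨s', hrun, hs'⟩ := τ.runs_decide (by omega) hrun₁ hrun₂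
  refine ⟨_, s', hrun, ?_, hs'.trans ?_⟩
  · rw [sub_sub_cancel, Nat.cast_add, Nat.cast_add]
    have hA : (1 : ℝ) ≤ φ.M + 1 := le_add_of_nonneg_left (Nat.cast_nonneg _)
    have hAm : (φ.M : ℝ) + 1 ≤ φ.N + φ.M + 1 := by
      rw [add_assoc]
      exact le_add_of_nonneg_left (Nat.cast_nonneg _)
    refine time_le (m := (φ.N : ℝ) + φ.M + 1) (A := (φ.M : ℝ) + 1) (e := e) (K := K)
      (g := (τ.r + 2 * τ.p) * τ.C)
      (B := (2 : ℝ) ^ ((τ.p + τ.r : ℝ) / (τ.r + 2 * τ.p)))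
      (k₀ := (τ.locations φ.N φ.M : ℝ) * τ.vectors φ.N φ.M) (c := c)
      (n := ((max (τ.curveP φ d).length (τ.curveQ φ d).length : ℕ) : ℝ))
      (hA.trans hAm) he0 he.le (Real.rpow_nonneg zero_le_two _) (le_max_right _ _)
      (le_max_left _ _) hβ1 ?_ ?_ hA hAm
      (mul_nonneg (zero_le_one.trans b4) (zero_le_one.trans b3)) ?_ ?_ hL1 hL2
    · exact (Nat.cast_le.2 ht₁).trans cast_buildTime_le
    · exact cast_locations_mul_vectors_le hτ hp
    · exact b5
    · exact ht₂.trans (mul_le_mul_of_nonneg_left (hT _ _ b3 b4) (Nat.cast_nonneg _))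
  · have hpos : 0 < (s.reg 1).toNat := by
      rw [Nat.pos_iff_ne_zero]
      intro h0
      exact hs1 (BitVec.eq_of_toNat_eq (by simpa using h0))
    have hpos' : (0 : ℝ) < (s.reg 1).toNat := by exact_mod_cast hpos
    obtain ⟨hyes, hno⟩ := τ.frechet_curves φ hd (le_mul_level hτ hC hp) hD
    -- As `101` is an integer, truncating the quotient does not affect the comparison.
    rw [Nat.div_lt_iff_lt_mul hpos]
    constructor
    · intro hlt
      by_contra hsat
      have h1 := (hno hsat).trans hs2
      rw [le_div_iff₀ hpos'] at h1
      have : 101 * (s.reg 1).toNat ≤ (s.reg 0).toNat := by exact_mod_cast h1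
      omega
    · intro hsat
      -- The output is at most `100.1`, below the threshold.
      have h1 := hs3.trans (mul_le_mul_of_nonneg_left (hyes hsat) (by norm_num))
      rw [div_le_iff₀ hpos'] at h1
      have : ((s.reg 0).toNat : ℝ) < 101 * (s.reg 1).toNat := by linarith
      exact_mod_cast this

theorem theorem3 (hSETH : SETHprime) (d : ℕ) (hd : 2 ≤ d)
    (D : Curve d → Curve d → ℝ)
    (hD : D = Curve.frechetDist ∨ D = Curve.discreteFrechetDist) (δ : ℝ) (hδ : 0 < δ) :
    (¬ HasApproxAlgorithm d D 1.001 (fun n c => 1 ≤ c ∧ c ≤ n)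
        (fun n c => (c * n) ^ (1 - δ))) ∧
    (∀ η γ : ℝ, 0 < η → η ≤ γ → γ ≤ 1 - η →
      ¬ HasApproxAlgorithm d D 1.001 (fun n c => n ^ (γ - η) ≤ c ∧ c ≤ n ^ (γ + η))
        (fun n c => (c * n) ^ (1 - δ))) := by
  have key : ∀ x y : ℝ, 0 ≤ x → x < y → y ≤ 1 →
      ¬ HasApproxAlgorithm d D 1.001 (fun n c => n ^ x ≤ c ∧ c ≤ n ^ y)
        (fun n c => (c * n) ^ (1 - δ)) := fun x y hx hxy hy h => by
    -- Capping `δ` at `1 / 2` keeps the exponent nonnegative; the time bound only weakens because `c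
    -- * n ≥ 1`.
    refine not_SETHprime_of_hasApproxAlgorithm (e := 1 - min δ (1 / 2)) hd hD hx hxy hy ?_ ?_ ?_ h
      hSETH
    · have := min_le_right δ (1 / 2)
      linarith
    · have : 0 < min δ (1 / 2) := lt_min hδ (by norm_num)
      linarith
    · intro n c hn hc
      refine Real.rpow_le_rpow_of_exponent_le (by nlinarith) ?_
      have := min_le_left δ (1 / 2)
      linarith
  constructor
  -- The unrestricted range is the case of the exponents `0` and `1`.
  · have := key 0 1 le_rfl one_pos le_rfl
    simpa only [Real.rpow_zero, Real.rpow_one] using this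
  · intro η γ hη h1 h2
    exact key _ _ (by linarith) (by linarith) (by linarith)
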